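/- **Theorem (the AC-automaton can be updated for each pattern in $O(m\log\sigma+u_f+u_o)$ time).** Let $\Sigma$ be a finite alphabet of size $\sigma$ and $D\subset\Sigma^*$ a finite dictionary. The *AC-automaton* of $D$ has as states the prefixes of the patterns in $D$ (the root $\varepsilon$ is always a state), the transitions $\mathrm{goto}(s,c)=sc$ between states, the failure links $\mathrm{flink}(s)=$ the longest proper suffix of $s$ that is a state ($s\neq\varepsilon$), and the outputs $\mathrm{output}(s)=\{q\in D: q \text{ is a suffix of } s\}$. The *DAWG* of $D$ has as nodes the classes $[x]_D$ of substrings $x$ of patterns ($\varepsilon$ included) that have the same set of end positions in the patterns, as edges $[x]_D\xrightarrow{c}[xc]_D$, and the suffix links $\mathrm{slink}([x]_D)=[y]_D$, where $y$ is the longest suffix of $x$ that is not equivalent to $x$. A node is a *trunk node* if it contains a state, which is then unique. There are two programs for a pointer machine (records with a fixed finite set of fields, unit cost per elementary instruction), one for insertion and one for deletion, and a constant $C$, none of them depending on $\Sigma$, $D$ or $p$, such that the following holds. Let $p\in\Sigma^*$ have length $m$, and let $D'=D\cup\{p\}$ with $p\notin D$ (insertion) or $D'=D\setminus\{p\}$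 with $p\in D$ (deletion). Start from a memory that holds $p$, the AC-automaton of $D$, and the DAWG of $D$ with its suffix links, with the list of the inverse suffix links $\mathrm{slink}^{-1}(v)$ of every node $v$, and with a pointer from every trunk node to its state. Then the program turns the AC-automaton of $D$ into that of $D'$ (goto, failure and output functions), leaving surviving states at their locations and the DAWG of $D$ intact, in at most $$C\,(m\log\sigma+u_f+u_o)$$ steps, where $u_f$ (respectively $u_o$) is the number of states common to both automata whose failure link (respectively output) differs between the two, and $\log\sigma$ means $\max(1,\log_2\sigma)$. The subsequent update of the DAWG of $D$ to that of $D'$ is not counted. Storage convention: letters are binary code words of length $\lceil\log_2\sigma\rceil$; $p$ is a linked list of code words; the outgoing transitions of every state and node are stored in a binary search tree over the code words; $\mathrm{output}(s)$ is a linked list in order of decreasing length, starting at a field of $s$, in which each pattern is represented by the record of its own state, which also holds the link to the next pattern (so output lists share their tails). -/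

import Mathlib

namespace DynAC

/-! ### Strings, the Aho-Corasick automaton and the DAWG of a dictionary -/

section Strings

variable {A : Type*}

/-- The states of the AC-automaton of `D`: all prefixes of patterns. The root (the empty string)
is present even if `D` is empty. -/
def states (D : Set (List A)) : Set (List A) := {s | s = [] ∨ ∃ q ∈ D, s <+: q}

/-- `t` is the failure link of `s`: the longest proper suffix of `s` that is a state. -/
def IsFlink (D : Set (List A)) (s t : List A) : Prop :=
  (t ∈ states D ∧ t <:+ s ∧ t ≠ s) ∧
    ∀ u ∈ states D, u <:+ s → u ≠ s → u.length ≤ t.length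

/-- The output function: all patterns that are suffixes of `s`. -/
def output (D : Set (List A)) (s : List A) : Set (List A) := {q | q ∈ D ∧ q <:+ s}

/-- All substrings of patterns; the empty string is present even if `D` is empty. -/
def substr (D : Set (List A)) : Set (List A) := {x | x = [] ∨ ∃ q ∈ D, x <:+: q}

/-- End positions of `x` in the patterns: `(q, j)` with `x = q[j - |x| + 1 : j]`. -/
def ePos (D : Set (List A)) (x : List A) : Set (List A × ℕ) :=
  {e | e.1 ∈ D ∧ e.2 ≤ e.1.length ∧ x <:+ e.1.take e.2}

/-- The equivalence class `[x]_D`. -/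
def cls (D : Set (List A)) (x : List A) : Set (List A) :=
  {y | y ∈ substr D ∧ ePos D y = ePos D x}

/-- The nodes of the DAWG. -/
def nodes (D : Set (List A)) : Set (Set (List A)) := {v | ∃ x ∈ substr D, v = cls D x}

/-- The labelled edges of the DAWG. -/
def IsEdge (D : Set (List A)) (v : Set (List A)) (c : A) (w : Set (List A)) : Prop :=
  ∃ x, x ∈ substr D ∧ x ++ [c] ∈ substr D ∧ ePos D x ≠ ePos D (x ++ [c]) ∧
    v = cls D x ∧ w = cls D (x ++ [c])

/-- `w` is the suffix link of `v`: for `v = [x]`, `w = [y]` with `y` the longest suffix of `x` that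
is not equivalent to `x`. The source has no suffix link. -/
def IsSlink (D : Set (List A)) (v w : Set (List A)) : Prop :=
  ∃ x y, x ∈ substr D ∧ v = cls D x ∧ w = cls D y ∧
    (y <:+ x ∧ ePos D x ≠ ePos D y) ∧
    ∀ z, z <:+ x → ePos D x ≠ ePos D z → z.length ≤ y.length

/-- `u_f`: the number of states present both before and after the update from `D` to `D'` whose
failure link is not the same before and after. -/
noncomputable def failChanges (D D' : Set (List A)) : ℕ :=
  {s | s ∈ states D ∧ s ∈ states D' ∧ ∃ t, IsFlink D s t ∧ ¬ IsFlink D' s t}.ncard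

/-- `u_o`: the number of states present both before and after the update from `D` to `D'` whose
output is not the same before and after. -/
noncomputable def outChanges (D D' : Set (List A)) : ℕ :=
  {s | s ∈ states D ∧ s ∈ states D' ∧ output D s ≠ output D' s}.ncard

end Strings

/-! ### A pointer machine with unit-cost instructions -/

/-- The fields of a record. The fields `aux n` are working space for programs. -/
inductive Slot
  | zero | one | dest
  | flink | out | nextOut
  | toState | slink | isuf | sibling
  | next | code | bit
  | aux (n : ℕ)
  deriving DecidableEq

/-- The memory: registers and record fields hold a pointer or null (`none`); the locations from
`fresh` on have not been allocated yet. -/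
structure Mem where
  reg : ℕ → Option ℕ
  heap : ℕ → Slot → Option ℕ
  fresh : ℕ

/-- Tests on registers. -/
inductive Test
  | isNull (x : ℕ)
  | nonNull (x : ℕ)
  | same (x y : ℕ)
  | differ (x y : ℕ)

def Test.Holds (μ : Mem) : Test → Prop
  | .isNull x => μ.reg x = none
  | .nonNull x => μ.reg x ≠ none
  | .same x y => μ.reg x = μ.reg y
  | .differ x y => μ.reg x ≠ μ.reg y

/-- Programs. -/
inductive Cmd
  | skip
  | setNull (x : ℕ)
  | copy (x y : ℕ)
  | load (x y : ℕ) (f : Slot)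
  | store (x : ℕ) (f : Slot) (y : ℕ)
  | alloc (x : ℕ)
  | seq (p q : Cmd)
  | cond (b : Test) (p q : Cmd)
  | loop (b : Test) (p : Cmd)

def Mem.setReg (μ : Mem) (x : ℕ) (v : Option ℕ) : Mem :=
  { μ with reg := Function.update μ.reg x v }

def Mem.setField (μ : Mem) (l : ℕ) (f : Slot) (v : Option ℕ) : Mem :=
  { μ with heap := Function.update μ.heap l (Function.update (μ.heap l) f v) }

/-- A new record, with all fields null, is created and a pointer to it is put in register `x`. -/
def Mem.create (μ : Mem) (x : ℕ) : Mem where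
  reg := Function.update μ.reg x (some μ.fresh)
  heap := Function.update μ.heap μ.fresh (fun _ => none)
  fresh := μ.fresh + 1

/-- `Exec p μ t μ'`: the program `p`, started in `μ`, halts in `μ'` after exactly `t` steps, where
every elementary instruction and every test costs one step. Following a null pointer is an error:
such a run has no result. -/
inductive Exec : Cmd → Mem → ℕ → Mem → Prop
  | skip {μ} : Exec .skip μ 1 μ
  | setNull {μ x} : Exec (.setNull x) μ 1 (μ.setReg x none)
  | copy {μ x y} : Exec (.copy x y) μ 1 (μ.setReg x (μ.reg y))
  | load {μ x y f l} (h : μ.reg y = some l) : Exec (.load x y f) μ 1 (μ.setReg x (μ.heap l f))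
  | store {μ x y f l} (h : μ.reg x = some l) :
      Exec (.store x f y) μ 1 (μ.setField l f (μ.reg y))
  | alloc {μ x} : Exec (.alloc x) μ 1 (μ.create x)
  | seq {p q μ₁ μ₂ μ₃ t₁ t₂} (h₁ : Exec p μ₁ t₁ μ₂) (h₂ : Exec q μ₂ t₂ μ₃) :
      Exec (.seq p q) μ₁ (t₁ + t₂) μ₃
  | condTrue {b p q μ μ' t} (hb : b.Holds μ) (h : Exec p μ t μ') :
      Exec (.cond b p q) μ (t + 1) μ'
  | condFalse {b p q μ μ' t} (hb : ¬ b.Holds μ) (h : Exec q μ t μ') :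
      Exec (.cond b p q) μ (t + 1) μ'
  | loopDone {b p μ} (hb : ¬ b.Holds μ) : Exec (.loop b p) μ 1 μ
  | loopStep {b p μ₁ μ₂ μ₃ t₁ t₂} (hb : b.Holds μ₁) (h₁ : Exec p μ₁ t₁ μ₂)
      (h₂ : Exec (.loop b p) μ₂ t₂ μ₃) : Exec (.loop b p) μ₁ (t₁ + t₂ + 1) μ₃

/-! ### How the automaton, the DAWG and the pattern are stored

Letters are given by binary code words `enc c` of length `⌈log₂ σ⌉`. The outgoing transitions of a
vertex `a` are stored in a binary search tree over these code words: its root is the record of the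
vertex, it has a record `(a, b)` for every prefix `b` of the code of a letter with an outgoing
transition, the fields `zero` and `one` lead from `(a, b)` to `(a, b0)` and `(a, b1)`, and the field
`dest` of `(a, enc c)` holds the target. One transition is thus followed in `⌈log₂ σ⌉ + 1` steps. -/

section Storage

variable {A : Type*}

/-- The record `(a, b)` is present, for the transition relation `E`. -/
def TreeLive {V : Type*} (enc : A → List Bool) (E : V → A → V → Prop) (a : V) (b : List Bool) :
    Prop :=
  b = [] ∨ ∃ c w, E a c w ∧ b <+: enc c

/-- The search tree of the transitions of the vertex `a`, with the record `(a, b)` at location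
`addr a b`. -/
structure TreeStored {V : Type*} (enc : A → List Bool) (E : V → A → V → Prop)
    (addr : V → List Bool → ℕ) (h : ℕ → Slot → Option ℕ) (a : V) : Prop where
  zero : ∀ b, TreeLive enc E a b → TreeLive enc E a (b ++ [false]) →
    h (addr a b) .zero = some (addr a (b ++ [false]))
  zero_null : ∀ b, TreeLive enc E a b → ¬ TreeLive enc E a (b ++ [false]) →
    h (addr a b) .zero = none
  one : ∀ b, TreeLive enc E a b → TreeLive enc E a (b ++ [true]) →
    h (addr a b) .one = some (addr a (b ++ [true]))
  one_null : ∀ b, TreeLive enc E a b → ¬ TreeLive enc E a (b ++ [true]) →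
    h (addr a b) .one = none
  dest : ∀ c w, E a c w → h (addr a (enc c)) .dest = some (addr w [])
  dest_null : ∀ b, TreeLive enc E a b → (∀ c w, E a c w → b ≠ enc c) →
    h (addr a b) .dest = none

/-- The null-terminated linked list with links in the field `f` that starts at `v` consists of the
records at the given locations, in this order. -/
def ChainAt (h : ℕ → Slot → Option ℕ) (f : Slot) : Option ℕ → List ℕ → Prop
  | v, [] => v = none
  | v, l :: ls => v = some l ∧ ChainAt h f (h l f) ls

/-- The goto function as a transition relation. -/
def IsGoto (D : Set (List A)) (s : List A) (c : A) (t : List A) : Prop :=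
  s ∈ states D ∧ t ∈ states D ∧ t = s ++ [c]

def stateLive (enc : A → List Bool) (D : Set (List A)) (s : List A) (b : List Bool) : Prop :=
  s ∈ states D ∧ TreeLive enc (IsGoto D) s b

def nodeLive (enc : A → List Bool) (D : Set (List A)) (v : Set (List A)) (b : List Bool) : Prop :=
  v ∈ nodes D ∧ TreeLive enc (IsEdge D) v b

/-- The memory `μ` holds the AC-automaton of `D`, with the state `s` at location `α s []`. The value
of the output function at `s` is a linked list in order of decreasing length, which starts at the
field `out` of `s`; a pattern is identified with its state, whose field `nextOut` is the link. (So
output lists share their tails.) -/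
structure ACStored (enc : A → List Bool) (D : Set (List A)) (μ : Mem)
    (α : List A → List Bool → ℕ) : Prop where
  allocated : ∀ s b, stateLive enc D s b → α s b < μ.fresh
  inj : ∀ s b s' b', stateLive enc D s b → stateLive enc D s' b' → α s b = α s' b' →
    s = s' ∧ b = b'
  goto : ∀ s ∈ states D, TreeStored enc (IsGoto D) α μ.heap s
  flink : ∀ s ∈ states D, ∀ t, IsFlink D s t → μ.heap (α s []) .flink = some (α t [])
  flink_root : μ.heap (α [] []) .flink = none
  output : ∀ s ∈ states D, ∃ l : List (List A), l.Pairwise (fun q r => r.length < q.length) ∧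
    (∀ q, q ∈ l ↔ q ∈ output D s) ∧
    ChainAt μ.heap .nextOut (μ.heap (α s []) .out) (l.map fun q => α q [])
  aux_null : ∀ s b, stateLive enc D s b → ∀ n, μ.heap (α s b) (.aux n) = none

/-- The memory `μ` holds the DAWG of `D`, with the node `v` at location `ν v []`. The inverse suffix
links of `v` form a linked list, in some order, which starts at the field `isuf` of `v` and has its
links in the field `sibling`. The field `toState` of a trunk node holds the location of the
corresponding state (it is null for the other nodes). -/
structure DAWGStored (enc : A → List Bool) (D : Set (List A)) (μ : Mem)
    (ν : Set (List A) → List Bool → ℕ) (α : List A → List Bool → ℕ) : Prop where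
  allocated : ∀ v b, nodeLive enc D v b → ν v b < μ.fresh
  inj : ∀ v b v' b', nodeLive enc D v b → nodeLive enc D v' b' → ν v b = ν v' b' →
    v = v' ∧ b = b'
  trans : ∀ v ∈ nodes D, TreeStored enc (IsEdge D) ν μ.heap v
  slink : ∀ v w, IsSlink D v w → μ.heap (ν v []) .slink = some (ν w [])
  slink_source : μ.heap (ν (cls D []) []) .slink = none
  isuf : ∀ v ∈ nodes D, ∃ l : List (Set (List A)), l.Nodup ∧ (∀ u, u ∈ l ↔ IsSlink D u v) ∧
    ChainAt μ.heap .sibling (μ.heap (ν v []) .isuf) (l.map fun u => ν u [])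
  trunk : ∀ v ∈ nodes D, ∀ s ∈ states D, s ∈ v → μ.heap (ν v []) .toState = some (α s [])
  non_trunk : ∀ v ∈ nodes D, (∀ s ∈ states D, s ∉ v) → μ.heap (ν v []) .toState = none
  aux_null : ∀ v b, nodeLive enc D v b → ∀ n, μ.heap (ν v b) (.aux n) = none

/-- A linked list of bits, in records from `S`; a bit is 1 iff the field `bit` is not null. -/
def BitsStored (h : ℕ → Slot → Option ℕ) (S : Set ℕ) : Option ℕ → List Bool → Prop
  | v, [] => v = none
  | v, b :: bs => ∃ l ∈ S, v = some l ∧ (h l .bit).isSome = b ∧ BitsStored h S (h l .next) bs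

/-- A string as a linked list of code words, in records from `S`. -/
def StringStored (enc : A → List Bool) (h : ℕ → Slot → Option ℕ) (S : Set ℕ) :
    Option ℕ → List A → Prop
  | v, [] => v = none
  | v, c :: x => ∃ l ∈ S, v = some l ∧ BitsStored h S (h l .code) (enc c) ∧
      StringStored enc h S (h l .next) x

/-- The records of the automaton of `D'` and those of the DAWG of `D` are different. -/
def Separated (enc : A → List Bool) (D' D : Set (List A)) (α : List A → List Bool → ℕ)
    (ν : Set (List A) → List Bool → ℕ) : Prop :=
  ∀ s b v b', stateLive enc D' s b → nodeLive enc D v b' → α s b ≠ ν v b'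

/-- The memory before an update: it holds the AC-automaton and the DAWG of `D`, and, in other
records, the string `p`; registers 0, 1, 2 point to the root, to the source and to `p`. -/
structure Before (enc : A → List Bool) (D : Set (List A)) (p : List A) (μ : Mem)
    (α : List A → List Bool → ℕ) (ν : Set (List A) → List Bool → ℕ) : Prop where
  ac : ACStored enc D μ α
  dawg : DAWGStored enc D μ ν α
  separated : Separated enc D D α ν
  root : μ.reg 0 = some (α [] [])
  source : μ.reg 1 = some (ν (cls D []) [])
  pattern : StringStored enc μ.heap
    {l | l < μ.fresh ∧ (∀ s b, stateLive enc D s b → l ≠ α s b) ∧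
      (∀ v b, nodeLive enc D v b → l ≠ ν v b)} (μ.reg 2) p

/-- The memory after an update from `D` to `D'`: it holds the AC-automaton of `D'`, in which the
states that were present before are where they were, and the DAWG of `D` is intact. -/
structure After (enc : A → List Bool) (D D' : Set (List A)) (μ' : Mem)
    (α : List A → List Bool → ℕ) (ν : Set (List A) → List Bool → ℕ) : Prop where
  dawg : DAWGStored enc D μ' ν α
  ac : ∃ α', ACStored enc D' μ' α' ∧ Separated enc D' D α' ν ∧
    ∀ s ∈ states D, s ∈ states D' → α' s [] = α s []

end Storage

/-- The program `prog`, run on any memory that holds the AC-automaton and the DAWG of `D` and the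
string `p`, updates the AC-automaton to that of `D'` in at most `C * (m * log₂ σ + u_f + u_o)`
steps, where `m` is the length of `p` and `σ` is the size of the alphabet; a logarithm smaller than 1
(alphabets with fewer than two letters) counts as 1. -/
def UpdatesWithin {A : Type*} [Fintype A] (prog : Cmd) (C : ℝ) (p : List A)
    (D D' : Set (List A)) : Prop :=
  ∀ enc : A → List Bool, Function.Injective enc →
    (∀ a, (enc a).length = Nat.clog 2 (Fintype.card A)) →
    ∀ (μ : Mem) (α : List A → List Bool → ℕ) (ν : Set (List A) → List Bool → ℕ),
      Before enc D p μ α ν →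
      ∃ (t : ℕ) (μ' : Mem), Exec prog μ t μ' ∧ After enc D D' μ' α ν ∧
        (t : ℝ) ≤ C * (p.length * max 1 (Real.logb 2 (Fintype.card A)) +
          failChanges D D' + outChanges D D')

end DynAC

/-!
The suffix links make the nodes of the DAWG a tree: the sets of end positions form a laminar family
(`laminar`), and a node lies below another one if its set is contained in the other one. The end
positions of `x` in the patterns are represented by the states with suffix `x` (`occ`). Thus the
states with suffix `x` are exactly those in the subtree of the node of `x`, and changes of failure
links and outputs can be found by depth-first traversals of subtrees (`Walk`, `walk_spec`). A node
without a state is branching (`exists_two_children`), so a traversal visits at most about twice as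
many nodes as nodes with a state (`Walk.length_le`); if the traversal is stopped at the first states
on every path, these are the states for which something changes, and the traversal is paid for by
`u_f` or `u_o`.

For the insertion of `p`, the search trees are extended by the missing records (`extend_spec`). Then
the new states that are substrings of patterns are processed from the longest to the shortest one
(`redirectLoop_spec`). The failure link of an old state `t` has to be redirected to the new state
`s` if `s` is the longest new or old state among the proper suffixes of `t`; such states are the
first ones below the node of `s`, when the traversal also stops at the marked nodes of longer new
states (`Walk.exists_mem_iff_new`). The marked nodes that are met are not met again, which pays for
them. The failure links of the new states themselves are computed along `p` in the classical
amortized way (`linkNew_spec`). Finally, `p` is inserted into the shared output lists: at the states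
with suffix `p`, the pointers to the longest pattern that is a proper suffix of `p` are replaced by
pointers to `p` (`addOutput_spec`, `lsuf_insert`, `psuf_insert`).

For the deletion of `p`, one walks along `p` and keeps track of the last record that remains for
sure, which is the root, the end of another pattern, or a record with another child (`track_spec`).
All records of the path after it are removed by cutting a single link (`cut_unique`, `Trie.cut`).
The removed states `s` are processed from the shortest to the longest one: the states with failure
link `s` are the first ones strictly below the node of `s` (`Walk.exists_mem_iff_flink`), and they
receive the failure link of `s` (`bypass_spec`); they are removed themselves, or are counted by
`u_f` (`ncard_linked_le`). The outputs are updated as for the insertion (`removeOutput_spec`).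

The pointer programs are verified with weakest preconditions that keep track of the time (`Runs`).
Since code words have length `⌈log₂ σ⌉`, the walks along `p` take `O(m log σ)` steps (`steps_le`).
-/

namespace DynAC

/-! ### The longest suffix of a string in a set of strings -/

section Suffix

variable {A : Type*}

open Classical in
/-- The longest suffix of `s` that belongs to `P`. -/
noncomputable def lsuf (P : Set (List A)) : List A → Option (List A)
  | [] => if [] ∈ P then some [] else none
  | a :: s => if a :: s ∈ P then some (a :: s) else lsuf P s

/-- The longest proper suffix of `s` that belongs to `P`. -/
noncomputable def psuf (P : Set (List A)) : List A → Option (List A)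
  | [] => none
  | _ :: s => lsuf P s

theorem lsuf_of_mem {P : Set (List A)} {s : List A} (h : s ∈ P) : lsuf P s = some s := by
  cases s <;> simp [lsuf, h]

theorem lsuf_of_notMem {P : Set (List A)} {s : List A} (h : s ∉ P) : lsuf P s = psuf P s := by
  cases s <;> simp [lsuf, psuf, h]

theorem lsuf_eq_none_iff {P : Set (List A)} {s : List A} :
    lsuf P s = none ↔ ∀ w ∈ P, ¬ w <:+ s := by
  induction s with
  | nil => by_cases h : [] ∈ P <;> simp [lsuf, h]; exact fun w hw hw' => h (hw' ▸ hw)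
  | cons a s ih =>
    by_cases h : a :: s ∈ P
    · simp only [lsuf, h, if_true, reduceCtorEq, false_iff]
      push Not
      exact ⟨_, h, List.suffix_rfl⟩
    · simp only [lsuf, h, if_false, ih]
      refine forall₂_congr fun w hw => ?_
      rw [List.suffix_cons_iff]
      have : w ≠ a :: s := by rintro rfl; exact h hw
      tauto

theorem lsuf_eq_some_iff {P : Set (List A)} {s u : List A} :
    lsuf P s = some u ↔ u ∈ P ∧ u <:+ s ∧ ∀ w ∈ P, w <:+ s → w.length ≤ u.length := by
  induction s with
  | nil =>
    by_cases h : [] ∈ P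
    · simp only [lsuf, h, if_true, Option.some.injEq, List.suffix_nil]
      constructor
      · rintro rfl; simp [h]
      · tauto
    · simp only [lsuf, h, if_false, reduceCtorEq, List.suffix_nil, false_iff]
      rintro ⟨h1, rfl, _⟩; exact h h1
  | cons a s ih =>
    by_cases h : a :: s ∈ P
    · simp only [lsuf, h, if_true, Option.some.injEq]
      constructor
      · rintro rfl; exact ⟨h, List.suffix_rfl, fun w _ hw => hw.length_le⟩
      · rintro ⟨_, h2, h3⟩
        exact (h2.eq_of_length_le (h3 _ h List.suffix_rfl)).symm
    · simp only [lsuf, h, if_false, ih]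
      constructor
      · rintro ⟨h1, h2, h3⟩
        refine ⟨h1, h2.trans (List.suffix_cons _ _), fun w hw hw' => ?_⟩
        rcases List.suffix_cons_iff.1 hw' with rfl | hw'
        · exact absurd hw h
        · exact h3 w hw hw'
      · rintro ⟨h1, h2, h3⟩
        refine ⟨h1, ?_, fun w hw hw' => h3 w hw (hw'.trans (List.suffix_cons _ _))⟩
        rcases List.suffix_cons_iff.1 h2 with rfl | h2
        · exact absurd h1 h
        · exact h2

theorem suffix_cons_ne {a : A} {s w : List A} : w <:+ a :: s ∧ w ≠ a :: s ↔ w <:+ s := by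
  rw [List.suffix_cons_iff]
  constructor
  · tauto
  · intro h
    refine ⟨Or.inr h, ?_⟩
    rintro rfl
    simpa using h.length_le

theorem psuf_eq_none_iff {P : Set (List A)} {s : List A} :
    psuf P s = none ↔ ∀ w ∈ P, w <:+ s → w = s := by
  cases s with
  | nil => simp [psuf]
  | cons a s =>
    rw [psuf, lsuf_eq_none_iff]
    refine forall₂_congr fun w _ => ?_
    rw [← suffix_cons_ne (a := a)]
    tauto

theorem psuf_eq_some_iff {P : Set (List A)} {s u : List A} :
    psuf P s = some u ↔ u ∈ P ∧ (u <:+ s ∧ u ≠ s) ∧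
      ∀ w ∈ P, w <:+ s → w ≠ s → w.length ≤ u.length := by
  cases s with
  | nil => simp [psuf]
  | cons a s =>
    rw [psuf, lsuf_eq_some_iff, suffix_cons_ne]
    refine and_congr_right fun _ => and_congr_right fun _ => forall₂_congr fun w _ => ?_
    rw [← suffix_cons_ne (a := a)]
    tauto

theorem isFlink_iff {D : Set (List A)} {s t : List A} :
    IsFlink D s t ↔ psuf (states D) s = some t := by
  rw [psuf_eq_some_iff, IsFlink]; tauto

theorem suffix_of_suffix_of_length_le {u w s : List A} (hu : u <:+ s) (hw : w <:+ s)
    (h : u.length ≤ w.length) : u <:+ w :=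
  List.suffix_of_suffix_length_le hu hw h

/-- The longest suffix in a smaller set is found inside the longest suffix in a larger one. -/
theorem lsuf_eq_bind {Y S : Set (List A)} (h : Y ⊆ S) (x : List A) :
    lsuf Y x = (lsuf S x).bind (lsuf Y) := by
  induction x with
  | nil =>
    by_cases h1 : [] ∈ S
    · simp [lsuf, h1]
    · have h2 : ([] : List A) ∉ Y := fun h' => h1 (h h')
      simp [lsuf, h1, h2]
  | cons a s ih =>
    by_cases h1 : a :: s ∈ S
    · simp [lsuf, h1]
    · have h2 : a :: s ∉ Y := fun h' => h1 (h h')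
      simp [lsuf, h1, h2, ih]

theorem psuf_eq_bind {Y S : Set (List A)} (h : Y ⊆ S) (x : List A) :
    psuf Y x = (psuf S x).bind (lsuf Y) := by
  cases x with
  | nil => simp [psuf]
  | cons a s => simp [psuf, lsuf_eq_bind h s]

theorem lsuf_suffix {P : Set (List A)} {s u : List A} (h : lsuf P s = some u) : u <:+ s :=
  (lsuf_eq_some_iff.1 h).2.1

theorem lsuf_mem {P : Set (List A)} {s u : List A} (h : lsuf P s = some u) : u ∈ P :=
  (lsuf_eq_some_iff.1 h).1

theorem psuf_mem {P : Set (List A)} {s u : List A} (h : psuf P s = some u) : u ∈ P :=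
  (psuf_eq_some_iff.1 h).1

theorem psuf_suffix {P : Set (List A)} {s u : List A} (h : psuf P s = some u) : u <:+ s :=
  (psuf_eq_some_iff.1 h).2.1.1

theorem psuf_length_lt {P : Set (List A)} {s u : List A} (h : psuf P s = some u) :
    u.length < s.length := by
  obtain ⟨_, ⟨h1, h2⟩, _⟩ := psuf_eq_some_iff.1 h
  exact lt_of_le_of_ne h1.length_le fun h => h2 (h1.eq_of_length h)

theorem lsuf_insert_of_not_suffix {P : Set (List A)} {p s : List A} (h : ¬ p <:+ s) :
    lsuf (insert p P) s = lsuf P s := by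
  induction s with
  | nil =>
    have : p ≠ [] := by rintro rfl; exact h List.suffix_rfl
    by_cases h' : [] ∈ P <;> simp [lsuf, this.symm, h']
  | cons a s ih =>
    rw [List.suffix_cons_iff] at h
    push Not at h
    by_cases h' : a :: s ∈ P <;> simp [lsuf, h.1.symm, ih h.2, h']

open Classical in
/-- A new element `p` becomes the longest suffix of `s` exactly if the old one is shorter, and then
the old one is the longest suffix of `p`. -/
theorem lsuf_insert {P : Set (List A)} {p s : List A} (hp : p ∉ P) (h : p <:+ s) :
    lsuf (insert p P) s = if lsuf P s = lsuf P p then some p else lsuf P s := by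
  induction s with
  | nil =>
    have : p = [] := List.suffix_nil.1 h
    subst this
    simp [lsuf, hp]
  | cons a s ih =>
    by_cases hq : p = a :: s
    · subst hq
      simp [lsuf, hp]
    · have h' : p <:+ s := by
        rw [← suffix_cons_ne (a := a)]; exact ⟨h, hq⟩
      by_cases hs : a :: s ∈ P
      · have : lsuf P (a :: s) ≠ lsuf P p := by
          rw [lsuf_of_mem hs]
          intro h2
          have := (lsuf_suffix h2.symm).length_le
          have := h'.length_le
          simp at *
          omega
        rw [if_neg this, lsuf_of_mem hs, lsuf_of_mem (Set.mem_insert_of_mem _ hs)]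
      · have h1 : a :: s ∉ insert p P := by
          simp [hs, Ne.symm hq]
        simp only [lsuf, h1, if_false, hs] at *
        rw [ih h']

open Classical in
theorem psuf_insert {P : Set (List A)} {p s : List A} (hp : p ∉ P) (h : p <:+ s) (hne : p ≠ s) :
    psuf (insert p P) s = if psuf P s = lsuf P p then some p else psuf P s := by
  cases s with
  | nil => exact absurd (List.suffix_nil.1 h) hne
  | cons a s =>
    simp only [psuf] at *
    exact lsuf_insert hp (suffix_cons_ne.1 ⟨h, hne⟩)

theorem psuf_insert_of_not_suffix {P : Set (List A)} {p s : List A} (h : ¬ (p <:+ s ∧ p ≠ s)) :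
    psuf (insert p P) s = psuf P s := by
  cases s with
  | nil => rfl
  | cons a s => exact lsuf_insert_of_not_suffix (fun h' => h (suffix_cons_ne.2 h'))

open Classical in
theorem lsuf_diff {P : Set (List A)} {p s : List A} :
    lsuf (P \ {p}) s = if lsuf P s = some p then psuf P p else lsuf P s := by
  induction s with
  | nil =>
    by_cases h : [] ∈ P <;> by_cases hp : [] = p
    · subst hp; simp [lsuf, psuf, h]
    · simp [lsuf, h, hp]
    · simp [lsuf, h]
    · simp [lsuf, h]
  | cons a s ih =>
    by_cases h : a :: s ∈ P <;> by_cases hp : a :: s = p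
    · subst hp
      simp only [lsuf, psuf, h, Set.mem_sdiff, Set.mem_singleton_iff, not_true_eq_false, and_false,
        if_false, if_true, ih]
      have h2 : lsuf P s ≠ some (a :: s) := fun h2 => by
        have := (lsuf_suffix h2).length_le
        simp at this
      rw [if_neg h2]
    · simp [lsuf, h, hp]
    · simp only [lsuf, h, Set.mem_sdiff, false_and, if_false] at *
      exact ih
    · simp only [lsuf, h, Set.mem_sdiff, false_and, if_false] at *
      exact ih

open Classical in
theorem psuf_diff {P : Set (List A)} {p s : List A} :
    psuf (P \ {p}) s = if psuf P s = some p then psuf P p else psuf P s := by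
  cases s with
  | nil => simp [psuf]
  | cons a s => simp only [psuf] at *; exact lsuf_diff

/-- If the longest suffixes in a smaller and in a larger set agree, so does the one in every set in
between. -/
theorem psuf_eq_of_between {P Q R : Set (List A)} {s : List A} (h1 : P ⊆ Q) (h2 : Q ⊆ R)
    (h : psuf R s = psuf P s) : psuf Q s = psuf P s := by
  cases hP : psuf P s with
  | none =>
    rw [hP, psuf_eq_none_iff] at h
    rw [psuf_eq_none_iff]
    exact fun w hw => h w (h2 hw)
  | some u =>
    rw [hP, psuf_eq_some_iff] at h
    rw [psuf_eq_some_iff] at hP ⊢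
    exact ⟨h1 hP.1, h.2.1, fun w hw => h.2.2 w (h2 hw)⟩

end Suffix

/-! ### States and their sets of end positions -/

section Dawg

variable {A : Type*} {D : Set (List A)}

theorem nil_mem_states : [] ∈ states D := Or.inl rfl

theorem mem_states_of_prefix {s t : List A} (h : s <+: t) (ht : t ∈ states D) : s ∈ states D := by
  rcases ht with rfl | ⟨q, hq, ht⟩
  · exact Or.inl (List.prefix_nil.1 h)
  · exact Or.inr ⟨q, hq, h.trans ht⟩

theorem mem_states_of_mem {s : List A} (h : s ∈ D) : s ∈ states D :=
  Or.inr ⟨s, h, List.prefix_rfl⟩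

theorem states_finite (h : D.Finite) : (states D).Finite := by
  have : states D ⊆ {[]} ∪ ⋃ q ∈ D, {s | s ∈ q.inits} := by
    rintro s (rfl | ⟨q, hq, hs⟩)
    · simp
    · right
      simp only [Set.mem_iUnion]
      exact ⟨q, hq, by simpa using hs⟩
  refine Set.Finite.subset (Set.Finite.union (Set.finite_singleton _) (h.biUnion fun q _ => ?_)) this
  exact List.finite_toSet _

theorem states_insert (p : List A) : states (insert p D) = states D ∪ {s | s <+: p} := by
  ext s
  simp only [states, Set.mem_insert_iff, exists_eq_or_imp, Set.mem_ofPred_eq, Set.mem_union]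
  rw [or_comm (a := s <+: p), or_assoc]

/-- The states that have `x` as a suffix. They represent the end positions of `x` in the patterns. -/
def occ (D : Set (List A)) (x : List A) : Set (List A) := {t | t ∈ states D ∧ x <:+ t}

theorem occ_anti {x y : List A} (h : x <:+ y) : occ D y ⊆ occ D x := fun _ ht =>
  ⟨ht.1, h.trans ht.2⟩

theorem self_mem_occ {s : List A} (h : s ∈ states D) : s ∈ occ D s := ⟨h, List.suffix_rfl⟩

theorem mem_substr_iff {x : List A} : x ∈ substr D ↔ (occ D x).Nonempty := by
  constructor
  · rintro (rfl | ⟨q, hq, s, t, h⟩)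
    · exact ⟨[], nil_mem_states, List.suffix_rfl⟩
    · exact ⟨s ++ x, Or.inr ⟨q, hq, t, h⟩, ⟨s, rfl⟩⟩
  · rintro ⟨t, (rfl | ⟨q, hq, ht⟩), h⟩
    · exact Or.inl (List.suffix_nil.1 h)
    · exact Or.inr ⟨q, hq, h.isInfix.trans ht.isInfix⟩

theorem mem_substr_of_suffix {x y : List A} (h : x <:+ y) (hy : y ∈ substr D) : x ∈ substr D :=
  mem_substr_iff.2 ((mem_substr_iff.1 hy).mono (occ_anti h))

theorem mem_substr_of_prefix {x y : List A} (h : x <+: y) (hy : y ∈ substr D) : x ∈ substr D := by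
  rcases hy with rfl | ⟨q, hq, hy⟩
  · exact Or.inl (List.prefix_nil.1 h)
  · exact Or.inr ⟨q, hq, h.isInfix.trans hy⟩

theorem mem_substr_of_mem_states {s : List A} (h : s ∈ states D) : s ∈ substr D :=
  mem_substr_iff.2 ⟨s, self_mem_occ h⟩

theorem mem_ePos_iff {x : List A} {e : List A × ℕ} :
    e ∈ ePos D x ↔ e.1 ∈ D ∧ e.2 ≤ e.1.length ∧ e.1.take e.2 ∈ occ D x := by
  simp only [ePos, occ, Set.mem_ofPred_eq]
  refine and_congr_right fun h1 => and_congr_right fun h2 => ?_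
  have : e.1.take e.2 ∈ states D := Or.inr ⟨_, h1, List.take_prefix _ _⟩
  tauto

theorem ePos_eq_iff {x y : List A} (hx : x ∈ substr D) (hy : y ∈ substr D) :
    ePos D x = ePos D y ↔ occ D x = occ D y := by
  constructor
  · have key : ∀ x y : List A, x ∈ substr D → y ∈ substr D → ePos D x = ePos D y →
        occ D x ⊆ occ D y := by
      rintro x y hx hy h t ⟨ht, hxt⟩
      refine ⟨ht, ?_⟩
      have main : ∀ q ∈ D, t <+: q → y <:+ t := by
        intro q hq htq
        have h1 : (q, t.length) ∈ ePos D x :=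
          ⟨hq, htq.length_le, by simpa [← List.prefix_iff_eq_take.1 htq] using hxt⟩
        rw [h] at h1
        simpa [← List.prefix_iff_eq_take.1 htq] using h1.2.2
      rcases ht with rfl | ⟨q, hq, htq⟩
      · rcases D.eq_empty_or_nonempty with rfl | ⟨q, hq⟩
        · rcases hy with rfl | ⟨q, hq, _⟩
          · exact List.suffix_rfl
          · exact absurd hq (Set.notMem_empty q)
        · exact main q hq List.nil_prefix
      · exact main q hq htq
    exact fun h => (key x y hx hy h).antisymm (key y x hy hx h.symm)
  · intro h
    ext e
    rw [mem_ePos_iff, mem_ePos_iff, h]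

theorem mem_cls_iff {x y : List A} (hx : x ∈ substr D) :
    y ∈ cls D x ↔ y ∈ substr D ∧ occ D y = occ D x :=
  and_congr_right fun hy => ePos_eq_iff hy hx

theorem self_mem_cls {x : List A} (hx : x ∈ substr D) : x ∈ cls D x := ⟨hx, rfl⟩

theorem cls_eq_cls_iff {x y : List A} (hx : x ∈ substr D) (hy : y ∈ substr D) :
    cls D x = cls D y ↔ occ D x = occ D y := by
  constructor
  · intro h
    have := self_mem_cls hx
    rw [h, mem_cls_iff hy] at this
    exact this.2
  · intro h
    ext z
    rw [mem_cls_iff hx, mem_cls_iff hy, h]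

theorem cls_mem_nodes {x : List A} (hx : x ∈ substr D) : cls D x ∈ nodes D := ⟨x, hx, rfl⟩

/-- The end positions of a node, which are those of all its strings. -/
def nodeOcc (D : Set (List A)) (v : Set (List A)) : Set (List A) := ⋃ x ∈ v, occ D x

theorem nodeOcc_cls {x : List A} (hx : x ∈ substr D) : nodeOcc D (cls D x) = occ D x := by
  ext t
  simp only [nodeOcc, Set.mem_iUnion, exists_prop]
  constructor
  · rintro ⟨y, hy, ht⟩
    rw [← ((mem_cls_iff hx).1 hy).2]; exact ht
  · exact fun ht => ⟨x, self_mem_cls hx, ht⟩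

theorem nodeOcc_of_mem {v : Set (List A)} {x : List A} (hv : v ∈ nodes D) (hx : x ∈ v) :
    nodeOcc D v = occ D x := by
  obtain ⟨y, hy, rfl⟩ := hv
  rw [nodeOcc_cls hy, ((mem_cls_iff hy).1 hx).2]

theorem eq_cls_of_mem {v : Set (List A)} {x : List A} (hv : v ∈ nodes D) (hx : x ∈ v) :
    x ∈ substr D ∧ v = cls D x := by
  obtain ⟨y, hy, rfl⟩ := hv
  have := (mem_cls_iff hy).1 hx
  exact ⟨this.1, (cls_eq_cls_iff hy this.1).2 this.2.symm⟩

theorem node_ext {v w : Set (List A)} (hv : v ∈ nodes D) (hw : w ∈ nodes D)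
    (h : nodeOcc D v = nodeOcc D w) : v = w := by
  obtain ⟨x, hx, rfl⟩ := hv
  obtain ⟨y, hy, rfl⟩ := hw
  rw [nodeOcc_cls hx, nodeOcc_cls hy] at h
  exact (cls_eq_cls_iff hx hy).2 h

theorem nodeOcc_nonempty {v : Set (List A)} (hv : v ∈ nodes D) : (nodeOcc D v).Nonempty := by
  obtain ⟨x, hx, rfl⟩ := hv
  rw [nodeOcc_cls hx]
  exact mem_substr_iff.1 hx

/-- A state with end positions among those of `y` has `y` as a suffix. -/
theorem occ_subset_iff_of_state {s y : List A} (hs : s ∈ states D) :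
    occ D s ⊆ occ D y ↔ y <:+ s :=
  ⟨fun h => (h (self_mem_occ hs)).2, occ_anti⟩

/-- A trunk node contains only one state. -/
theorem state_unique {s t : List A} (hs : s ∈ states D) (ht : t ∈ states D)
    (h : occ D s = occ D t) : s = t :=
  ((occ_subset_iff_of_state ht).1 h.ge).eq_of_length_le
    ((occ_subset_iff_of_state hs).1 h.le).length_le

/-- The sets of end positions of nodes form a laminar family. -/
theorem laminar {v w : Set (List A)} (hv : v ∈ nodes D) (hw : w ∈ nodes D) {t : List A}
    (h1 : t ∈ nodeOcc D v) (h2 : t ∈ nodeOcc D w) :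
    nodeOcc D v ⊆ nodeOcc D w ∨ nodeOcc D w ⊆ nodeOcc D v := by
  obtain ⟨x, hx, rfl⟩ := hv
  obtain ⟨y, hy, rfl⟩ := hw
  rw [nodeOcc_cls hx] at h1 ⊢
  rw [nodeOcc_cls hy] at h2 ⊢
  rcases List.suffix_or_suffix_of_suffix h1.2 h2.2 with h | h
  · exact Or.inr (occ_anti h)
  · exact Or.inl (occ_anti h)

theorem occ_append_singleton {x y : List A} {c : A} (h : occ D x = occ D y) :
    occ D (x ++ [c]) ⊆ occ D (y ++ [c]) := by
  rintro t ⟨ht, z, rfl⟩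
  have : z ++ x ∈ occ D x :=
    ⟨mem_states_of_prefix ⟨[c], by simp⟩ ht, ⟨z, rfl⟩⟩
  rw [h] at this
  obtain ⟨_, w, hw⟩ := this
  exact ⟨ht, w, by rw [← List.append_assoc, hw, List.append_assoc]⟩

theorem occ_ne_append {x : List A} {c : A} (hx : x ∈ substr D) :
    occ D x ≠ occ D (x ++ [c]) := by
  -- the shortest end position of `x` would have to be preceded by another one
  intro h
  have key : ∀ n, ∀ t ∈ occ D x, t.length ≠ n := by
    intro n
    induction n with
    | zero =>
      intro t ht h0
      rw [h] at ht
      have := ht.2.length_le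
      simp at this; omega
    | succ n ih =>
      intro t ht hn
      rw [h] at ht
      obtain ⟨ht, z, rfl⟩ := ht
      refine ih (z ++ x) ⟨mem_states_of_prefix ⟨[c], by simp⟩ ht, ⟨z, rfl⟩⟩ ?_
      simp at hn ⊢; omega
  obtain ⟨t, ht⟩ := mem_substr_iff.1 hx
  exact key _ t ht rfl

theorem isEdge_cls_iff {x : List A} (hx : x ∈ substr D) {c : A} {w : Set (List A)} :
    IsEdge D (cls D x) c w ↔ x ++ [c] ∈ substr D ∧ w = cls D (x ++ [c]) := by
  constructor
  · rintro ⟨y, hy, hyc, -, h, rfl⟩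
    rw [cls_eq_cls_iff hx hy] at h
    have h2 : occ D (x ++ [c]) = occ D (y ++ [c]) :=
      (occ_append_singleton h).antisymm (occ_append_singleton h.symm)
    have hxc : x ++ [c] ∈ substr D := by
      rw [mem_substr_iff, h2, ← mem_substr_iff]; exact hyc
    exact ⟨hxc, (cls_eq_cls_iff hyc hxc).2 h2.symm⟩
  · rintro ⟨hxc, rfl⟩
    exact ⟨x, hx, hxc, fun h => occ_ne_append hx ((ePos_eq_iff hx hxc).1 h), rfl, rfl⟩

theorem isSlink_iff {v w : Set (List A)} :
    IsSlink D v w ↔ ∃ x y, x ∈ substr D ∧ v = cls D x ∧ w = cls D y ∧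
      (y <:+ x ∧ occ D x ≠ occ D y) ∧ ∀ z, z <:+ x → occ D x ≠ occ D z → z.length ≤ y.length := by
  refine exists_congr fun x => exists_congr fun y => and_congr_right fun hx =>
    and_congr_right fun _ => and_congr_right fun _ => and_congr (and_congr_right fun h => ?_) ?_
  · exact (ePos_eq_iff hx (mem_substr_of_suffix h hx)).not
  · refine forall₂_congr fun z hz => ?_
    rw [Ne, ePos_eq_iff hx (mem_substr_of_suffix hz hx)]

theorem IsSlink.mem_nodes {v w : Set (List A)} (h : IsSlink D v w) : v ∈ nodes D ∧ w ∈ nodes D := by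
  obtain ⟨x, y, hx, rfl, rfl, ⟨hy, _⟩, _⟩ := h
  exact ⟨cls_mem_nodes hx, cls_mem_nodes (mem_substr_of_suffix hy hx)⟩

theorem IsSlink.ssubset {v w : Set (List A)} (h : IsSlink D v w) : nodeOcc D v ⊂ nodeOcc D w := by
  obtain ⟨x, y, hx, rfl, rfl, ⟨hy, hne⟩, _⟩ := isSlink_iff.1 h
  rw [nodeOcc_cls hx, nodeOcc_cls (mem_substr_of_suffix hy hx)]
  exact (occ_anti hy).ssubset_of_ne hne

theorem isSlink_cons {a : A} {x : List A} (hx : a :: x ∈ substr D)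
    (h : occ D (a :: x) ≠ occ D x) : IsSlink D (cls D (a :: x)) (cls D x) := by
  refine isSlink_iff.2 ⟨a :: x, x, hx, rfl, rfl, ⟨List.suffix_cons _ _, h⟩, fun z hz hne => ?_⟩
  rcases List.suffix_cons_iff.1 hz with rfl | hz
  · exact absurd rfl hne
  · exact hz.length_le

/-- Below a node, every other node lies below one of its children in the suffix link tree. -/
theorem exists_child {u v : Set (List A)} (hu : u ∈ nodes D) (hv : v ∈ nodes D)
    (h : nodeOcc D u ⊂ nodeOcc D v) : ∃ c, IsSlink D c v ∧ nodeOcc D u ⊆ nodeOcc D c := by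
  obtain ⟨x, hx, rfl⟩ := hu
  obtain ⟨y, hy, rfl⟩ := hv
  rw [nodeOcc_cls hx, nodeOcc_cls hy] at h
  have hyx : y <:+ x := by
    obtain ⟨t, ht⟩ := mem_substr_iff.1 hx
    rcases List.suffix_or_suffix_of_suffix ht.2 (h.1 ht).2 with h' | h'
    · exact absurd (occ_anti h') h.2
    · exact h'
  -- lengthen `y` inside `x` until the end positions change
  have key : ∀ z : List A, ∀ y', z ++ y' = x → occ D y' = occ D y →
      ∃ c, IsSlink D c (cls D y) ∧ nodeOcc D (cls D x) ⊆ nodeOcc D c := by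
    intro z
    induction z using List.reverseRecOn with
    | nil =>
      rintro y' rfl hy'
      exact absurd hy'.ge h.2
    | append_singleton z a ih =>
      intro y' hzy hy'
      have hay : a :: y' <:+ x := ⟨z, by simpa using hzy⟩
      have hay' := mem_substr_of_suffix hay hx
      by_cases hocc : occ D (a :: y') = occ D y'
      · exact ih (a :: y') (by simpa using hzy) (hocc.trans hy')
      · refine ⟨cls D (a :: y'), ?_, ?_⟩
        · rw [(cls_eq_cls_iff hy (mem_substr_of_suffix (List.suffix_cons _ _) hay')).2 hy'.symm]
          exact isSlink_cons hay' hocc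
        · rw [nodeOcc_cls hx, nodeOcc_cls hay']
          exact occ_anti hay
  obtain ⟨z, hz⟩ := hyx
  exact key z y hz rfl

/-- Different children of a node have no end position in common. -/
theorem children_disjoint {c c' v : Set (List A)} (h : IsSlink D c v) (h' : IsSlink D c' v)
    {t : List A} (ht : t ∈ nodeOcc D c) (ht' : t ∈ nodeOcc D c') : c = c' := by
  have key : ∀ c c', IsSlink D c v → IsSlink D c' v → nodeOcc D c' ⊆ nodeOcc D c → c = c' := by
    intro c c' h h' hcc
    by_contra hne
    have hss := h.ssubset
    have h1 := h.mem_nodes.1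
    have h2 := h'.mem_nodes.1
    obtain ⟨x, hx, rfl⟩ := h1
    obtain ⟨x', y', hx', rfl, rfl, ⟨hy', hne'⟩, hmax⟩ := isSlink_iff.1 h'
    rw [nodeOcc_cls hx, nodeOcc_cls hx'] at hcc
    rw [nodeOcc_cls hx, nodeOcc_cls (mem_substr_of_suffix hy' hx')] at hss
    have hocc : occ D x' ≠ occ D x := fun h => hne ((cls_eq_cls_iff hx hx').2 h.symm)
    have hxx' : x <:+ x' := by
      obtain ⟨t, ht⟩ := mem_substr_iff.1 hx'
      rcases List.suffix_or_suffix_of_suffix ht.2 (hcc ht).2 with h' | h'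
      · exact absurd (hcc.antisymm (occ_anti h')) hocc
      · exact h'
    have := hmax x hxx' hocc
    exact hss.2 (occ_anti (suffix_of_suffix_of_length_le hxx' hy' this))
  rcases laminar h.mem_nodes.1 h'.mem_nodes.1 ht ht' with hs | hs
  · exact (key c' c h' h hs).symm
  · exact key c c' h h' hs

/-- The node contains a state. -/
def Trunk (D : Set (List A)) (v : Set (List A)) : Prop := ∃ s ∈ states D, s ∈ v

/-- A node that contains no state has two children in the suffix link tree: its longest string is
preceded by at least two different letters. -/
theorem exists_two_children {v : Set (List A)} (hv : v ∈ nodes D) (h : ¬ Trunk D v) :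
    ∃ c c', c ≠ c' ∧ IsSlink D c v ∧ IsSlink D c' v := by
  obtain ⟨y, hy, rfl⟩ := hv
  obtain ⟨t₀, ht₀⟩ := mem_substr_iff.1 hy
  -- the longest string of the node
  have : ∃ x, occ D x = occ D y ∧ ∀ a, occ D (a :: x) ≠ occ D y := by
    by_contra hcon
    push Not at hcon
    have : ∀ n, ∃ x : List A, x.length = n + y.length ∧ occ D x = occ D y := by
      intro n
      induction n with
      | zero => exact ⟨y, by simp, rfl⟩
      | succ n ih =>
        obtain ⟨x, hl, hx⟩ := ih
        obtain ⟨a, ha⟩ := hcon x hx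
        exact ⟨a :: x, by simp [hl]; omega, ha⟩
    obtain ⟨x, hl, hx⟩ := this (t₀.length + 1)
    rw [← hx] at ht₀
    have := ht₀.2.length_le
    omega
  obtain ⟨x, hxy, hmax⟩ := this
  have hx : x ∈ substr D := by rw [mem_substr_iff, hxy, ← mem_substr_iff]; exact hy
  rw [(cls_eq_cls_iff hy hx).2 hxy.symm] at h ⊢
  rw [← hxy] at hmax ht₀
  have hns : x ∉ states D := fun hs => h ⟨x, hs, self_mem_cls hx⟩
  have hcons : ∀ t ∈ occ D x, ∃ a, t ∈ occ D (a :: x) := by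
    rintro t ⟨ht, z, rfl⟩
    rcases List.eq_nil_or_concat z with rfl | ⟨z, a, rfl⟩
    · exact absurd ht hns
    · exact ⟨a, ht, z, by simp⟩
  obtain ⟨a, ha⟩ := hcons t₀ ht₀
  obtain ⟨t₁, ht₁, hn⟩ : ∃ t ∈ occ D x, t ∉ occ D (a :: x) := by
    by_contra hcon
    push Not at hcon
    exact hmax a ((occ_anti (List.suffix_cons _ _)).antisymm hcon)
  obtain ⟨b, hb⟩ := hcons t₁ ht₁
  have hax := mem_substr_iff.2 ⟨_, ha⟩
  have hbx := mem_substr_iff.2 ⟨_, hb⟩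
  refine ⟨_, _, fun hab => ?_, isSlink_cons hax (hmax a), isSlink_cons hbx (hmax b)⟩
  rw [cls_eq_cls_iff hax hbx] at hab
  rw [hab] at hn
  exact hn hb

end Dawg

/-! ### Depth-first traversals of the suffix link tree -/

section Walk

variable {V : Type*}

/-- `Walk halt ch segs out`: the depth-first traversal with the stack `segs` of lists of siblings
visits the nodes `out`, in this order. The children `ch v` of a node `v` with `halt v` are not
visited. -/
inductive Walk (halt : V → Prop) (ch : V → List V) : List (List V) → List V → Prop
  | done : Walk halt ch [] []
  | pop {segs out} (h : Walk halt ch segs out) : Walk halt ch ([] :: segs) out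
  | visitHalt {v vs segs out} (hv : halt v) (h : Walk halt ch ([] :: vs :: segs) out) :
      Walk halt ch ((v :: vs) :: segs) (v :: out)
  | visit {v vs segs out} (hv : ¬ halt v) (h : Walk halt ch (ch v :: vs :: segs) out) :
      Walk halt ch ((v :: vs) :: segs) (v :: out)

variable {halt : V → Prop} {ch : V → List V}

theorem Walk.append_nil {segs : List (List V)} {out : List V} (h : Walk halt ch segs out) :
    Walk halt ch (segs ++ [[]]) out := by
  induction h with
  | done => exact .pop .done
  | pop _ ih => exact .pop ih
  | visitHalt hv _ ih => exact .visitHalt hv ih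
  | visit hv _ ih => exact .visit hv ih

open Classical in
theorem Walk.of_singleton {v : V} {out : List V}
    (h : Walk halt ch [if halt v then [] else ch v] out) : Walk halt ch [[v]] (v :: out) := by
  split_ifs at h with hv
  · exact .visitHalt hv h.append_nil
  · exact .visit hv h.append_nil

/-- If all nodes that are not good are branching and not stopping, then at least about half of the
visited nodes are good. -/
theorem Walk.length_le {good : V → Prop} [DecidablePred good] {N : V → Prop}
    (hN : ∀ v, N v → ∀ u ∈ ch v, N u)
    (hg : ∀ v, N v → ¬ good v → ¬ halt v ∧ 2 ≤ (ch v).length)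
    {segs : List (List V)} {out : List V} (h : Walk halt ch segs out)
    (hs : ∀ v ∈ segs.flatten, N v) :
    out.length + segs.flatten.length ≤ 2 * out.countP good := by
  induction h with
  | done => simp
  | pop _ ih => simpa using ih (by simpa using hs)
  | @visitHalt v vs segs out hv _ ih =>
    have hv' : good v := by
      by_contra h'
      exact (hg v (hs v (by simp)) h').1 hv
    have := ih fun u hu => hs u (by simp at hu ⊢; tauto)
    simp [hv'] at this ⊢
    omega
  | @visit v vs segs out hv _ ih =>
    have h1 := ih fun u hu => by
      simp only [List.flatten_cons, List.mem_append] at hu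
      rcases hu with hu | hu
      · exact hN v (hs v (by simp)) u hu
      · exact hs u (by simp only [List.flatten_cons, List.mem_append, List.mem_cons]; tauto)
    by_cases hv' : good v
    · simp [hv'] at h1 ⊢
      omega
    · have := (hg v (hs v (by simp)) hv').2
      simp [hv'] at h1 ⊢
      omega

end Walk

section Walk

variable {A : Type*} {D : Set (List A)} {halt : Set (List A) → Prop}
  {ch : Set (List A) → List (Set (List A))}

/-- `ch` lists the children of every node of the suffix link tree. -/
def IsChildren (D : Set (List A)) (ch : Set (List A) → List (Set (List A))) : Prop :=
  ∀ v ∈ nodes D, (ch v).Nodup ∧ ∀ u, u ∈ ch v ↔ IsSlink D u v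

theorem nodeOcc_subset_states (v : Set (List A)) : nodeOcc D v ⊆ states D :=
  Set.iUnion₂_subset fun _ _ _ ht => ht.1

theorem exists_walk (hD : D.Finite) (hch : IsChildren D ch) {segs : List (List (Set (List A)))}
    (hs : ∀ v ∈ segs.flatten, v ∈ nodes D) : ∃ out, Walk halt ch segs out := by
  have hlist : ∀ l : List (Set (List A)),
      (∀ v ∈ l, ∀ vs segs, (∃ out, Walk halt ch (vs :: segs) out) →
        ∃ out, Walk halt ch ((v :: vs) :: segs) out) →
      ∀ segs, (∃ out, Walk halt ch segs out) → ∃ out, Walk halt ch (l :: segs) out := by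
    intro l
    induction l with
    | nil => rintro - segs ⟨out, h⟩; exact ⟨out, .pop h⟩
    | cons v l ih =>
      intro h segs hsegs
      exact h v (by simp) l segs (ih (fun u hu => h u (by simp [hu])) segs hsegs)
  have key : ∀ n, ∀ v ∈ nodes D, (nodeOcc D v).ncard = n → ∀ vs segs,
      (∃ out, Walk halt ch (vs :: segs) out) → ∃ out, Walk halt ch ((v :: vs) :: segs) out := by
    intro n
    induction n using Nat.strong_induction_on with
    | _ n ih =>
      rintro v hv rfl vs segs hw
      by_cases hst : halt v
      · obtain ⟨out, h⟩ := hw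
        exact ⟨_, .visitHalt hst (.pop h)⟩
      · obtain ⟨out, h⟩ := hlist (ch v) (fun u hu vs segs hw => by
          have hsl := ((hch v hv).2 u).1 hu
          have hlt := Set.ncard_lt_ncard hsl.ssubset
            ((states_finite hD).subset (nodeOcc_subset_states v))
          exact ih _ hlt u hsl.mem_nodes.1 rfl vs segs hw) _ hw
        exact ⟨_, .visit hst h⟩
  induction segs with
  | nil => exact ⟨[], .done⟩
  | cons l segs ih =>
    refine hlist l (fun v hv => key _ v (hs v (by simp [hv])) rfl) segs (ih fun v hv => ?_)
    exact hs v (by simp at hv ⊢; tauto)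

/-- A traversal visits exactly the nodes below the initial ones that are not cut off by a stopping
node strictly above them. -/
theorem Walk.mem_iff (hch : IsChildren D ch) {segs : List (List (Set (List A)))}
    {out : List (Set (List A))} (h : Walk halt ch segs out)
    (hs : ∀ v ∈ segs.flatten, v ∈ nodes D) (u : Set (List A)) :
    u ∈ out ↔ u ∈ nodes D ∧ ∃ v ∈ segs.flatten, nodeOcc D u ⊆ nodeOcc D v ∧
      ∀ w ∈ nodes D, nodeOcc D u ⊂ nodeOcc D w → nodeOcc D w ⊆ nodeOcc D v → ¬ halt w := by
  induction h with
  | done => simp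
  | pop _ ih => simpa using ih (by simpa using hs)
  | @visitHalt v vs segs out hv _ ih =>
    have hvn := hs v (by simp)
    rw [List.mem_cons, ih fun u hu => hs u (by simp at hu ⊢; tauto)]
    simp only [List.flatten_cons, List.nil_append, List.cons_append, List.mem_cons,
      exists_eq_or_imp]
    constructor
    · rintro (rfl | h)
      · exact ⟨hvn, .inl ⟨subset_rfl, fun w _ h1 h2 => absurd h2 h1.2⟩⟩
      · exact ⟨h.1, .inr h.2⟩
    · rintro ⟨hu, h | h⟩
      · left
        by_contra hne
        exact h.2 v hvn (h.1.ssubset_of_ne fun h => hne (node_ext hu hvn h)) subset_rfl hv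
      · exact .inr ⟨hu, h⟩
  | @visit v vs segs out hv _ ih =>
    have hvn := hs v (by simp)
    rw [List.mem_cons, ih fun u hu => by
      simp only [List.flatten_cons, List.mem_append] at hu
      rcases hu with hu | hu
      · exact (((hch v hvn).2 u).1 hu).mem_nodes.1
      · exact hs u (by simp only [List.flatten_cons, List.mem_append, List.mem_cons]; tauto)]
    simp only [List.flatten_cons, List.cons_append, List.mem_cons, List.mem_append,
      exists_eq_or_imp]
    constructor
    · rintro (rfl | ⟨hu, c, hc | hc, h⟩)
      · exact ⟨hvn, .inl ⟨subset_rfl, fun w _ h1 h2 => absurd h2 h1.2⟩⟩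
      · rw [(hch v hvn).2] at hc
        refine ⟨hu, .inl ⟨h.1.trans hc.ssubset.1, fun w hw h1 h2 => ?_⟩⟩
        -- `w` lies between the nodes `u` and `v`, hence is `v` or below the same child
        by_cases hwv : w = v
        · rwa [hwv]
        · obtain ⟨c', hc', hwc'⟩ := exists_child hw hvn
            (h2.ssubset_of_ne fun h => hwv (node_ext hw hvn h))
          obtain ⟨t, ht⟩ := nodeOcc_nonempty hu
          rw [children_disjoint hc' hc (hwc' (h1.1 ht)) (h.1 ht)] at hwc'
          exact h.2 w hw h1 hwc'
      · exact ⟨hu, .inr ⟨c, by simpa using hc, h⟩⟩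
    · rintro ⟨hu, h | ⟨c, hc, h⟩⟩
      · by_cases huv : u = v
        · exact .inl huv
        · obtain ⟨c, hc, huc⟩ := exists_child hu hvn
            (h.1.ssubset_of_ne fun h => huv (node_ext hu hvn h))
          exact .inr ⟨hu, c, .inl (((hch v hvn).2 c).2 hc), huc, fun w hw h1 h2 =>
            h.2 w hw h1 (h2.trans hc.ssubset.1)⟩
      · exact .inr ⟨hu, c, .inr (by simpa using hc), h⟩

theorem Walk.nodup (hch : IsChildren D ch) {segs : List (List (Set (List A)))}
    {out : List (Set (List A))} (h : Walk halt ch segs out)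
    (hs : ∀ v ∈ segs.flatten, v ∈ nodes D)
    (hd : segs.flatten.Pairwise fun u v => Disjoint (nodeOcc D u) (nodeOcc D v)) : out.Nodup := by
  induction h with
  | done => simp
  | pop _ ih => exact ih (by simpa using hs) (by simpa using hd)
  | @visitHalt v vs segs out hv h ih =>
    have hvn := hs v (by simp)
    have hs' : ∀ u ∈ ([] :: vs :: segs).flatten, u ∈ nodes D :=
      fun u hu => hs u (by simp at hu ⊢; tauto)
    simp only [List.flatten_cons, List.cons_append, List.pairwise_cons] at hd
    refine List.nodup_cons.2 ⟨fun hmem => ?_, ih hs' (by simpa using hd.2)⟩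
    obtain ⟨_, w, hw, h1, _⟩ := (h.mem_iff hch hs' v).1 hmem
    obtain ⟨t, ht⟩ := nodeOcc_nonempty hvn
    exact Set.disjoint_left.1 (hd.1 w (by simpa using hw)) ht (h1 ht)
  | @visit v vs segs out hv h ih =>
    have hvn := hs v (by simp)
    have hs' : ∀ u ∈ (ch v :: vs :: segs).flatten, u ∈ nodes D := fun u hu => by
      simp only [List.flatten_cons, List.mem_append] at hu
      rcases hu with hu | hu
      · exact (((hch v hvn).2 u).1 hu).mem_nodes.1
      · exact hs u (by simp only [List.flatten_cons, List.mem_append, List.mem_cons]; tauto)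
    simp only [List.flatten_cons, List.cons_append, List.pairwise_cons] at hd
    refine List.nodup_cons.2 ⟨fun hmem => ?_, ih hs' ?_⟩
    · obtain ⟨_, w, hw, h1, _⟩ := (h.mem_iff hch hs' v).1 hmem
      obtain ⟨t, ht⟩ := nodeOcc_nonempty hvn
      simp only [List.flatten_cons, List.mem_append] at hw
      rcases hw with hw | hw
      · exact (((hch v hvn).2 w).1 hw).ssubset.2 h1
      · exact Set.disjoint_left.1 (hd.1 w (by simpa using hw)) ht (h1 ht)
    · simp only [List.flatten_cons]
      refine List.pairwise_append.2 ⟨?_, by simpa using hd.2, fun u hu w hw => ?_⟩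
      · refine (hch v hvn).1.pairwise_of_forall_ne fun u hu w hw hne => ?_
        refine Set.disjoint_left.2 fun t h1 h2 => hne ?_
        exact children_disjoint (((hch v hvn).2 u).1 hu) (((hch v hvn).2 w).1 hw) h1 h2
      · exact (hd.1 w (by simpa using hw)).mono_left (((hch v hvn).2 u).1 hu).ssubset.1

theorem Walk.length_le_countP (hch : IsChildren D ch) {good : Set (List A) → Prop}
    [DecidablePred good] (hg1 : ∀ v, Trunk D v → good v) (hg2 : ∀ v, halt v → good v)
    {segs : List (List (Set (List A)))} {out : List (Set (List A))} (h : Walk halt ch segs out)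
    (hs : ∀ v ∈ segs.flatten, v ∈ nodes D) : out.length ≤ 2 * out.countP good := by
  refine le_trans (Nat.le_add_right _ _) (h.length_le (N := (· ∈ nodes D)) ?_ ?_ hs)
  · exact fun v hv u hu => (((hch v hv).2 u).1 hu).mem_nodes.1
  · intro v hv hv'
    refine ⟨fun h => hv' (hg2 v h), ?_⟩
    obtain ⟨c, c', hne, hc, hc'⟩ := exists_two_children hv fun h => hv' (hg1 v h)
    rw [← (hch v hv).2] at hc hc'
    by_contra hlt
    have hlt : (ch v).length ≤ 1 := by omega
    match hl : ch v, hlt with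
    | [], _ => simp [hl] at hc
    | [x], _ => simp [hl] at hc hc'; exact hne (hc.trans hc'.symm)

end Walk

/-! ### Total correctness of pointer programs -/

section Machine

/-- The contents of the memory. -/
abbrev Heap := ℕ → Slot → Option ℕ

@[simp] theorem Mem.setReg_reg (μ : Mem) (x y : ℕ) (v : Option ℕ) :
    (μ.setReg x v).reg y = if y = x then v else μ.reg y := by
  simp [Mem.setReg, Function.update_apply]

@[simp] theorem Mem.setReg_heap (μ : Mem) (x : ℕ) (v : Option ℕ) :
    (μ.setReg x v).heap = μ.heap := rfl

@[simp] theorem Mem.setReg_fresh (μ : Mem) (x : ℕ) (v : Option ℕ) :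
    (μ.setReg x v).fresh = μ.fresh := rfl

@[simp] theorem Mem.setField_reg (μ : Mem) (l : ℕ) (f : Slot) (v : Option ℕ) :
    (μ.setField l f v).reg = μ.reg := rfl

@[simp] theorem Mem.setField_fresh (μ : Mem) (l : ℕ) (f : Slot) (v : Option ℕ) :
    (μ.setField l f v).fresh = μ.fresh := rfl

@[simp] theorem Mem.setField_heap (μ : Mem) (l : ℕ) (f : Slot) (v : Option ℕ) (l' : ℕ) (f' : Slot) :
    (μ.setField l f v).heap l' f' = if l' = l ∧ f' = f then v else μ.heap l' f' := by
  by_cases h : l' = l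
  · subst h; simp [Mem.setField, Function.update_apply]
  · simp [Mem.setField, h]

@[simp] theorem Mem.create_reg (μ : Mem) (x y : ℕ) :
    (μ.create x).reg y = if y = x then some μ.fresh else μ.reg y := by
  simp [Mem.create, Function.update_apply]

@[simp] theorem Mem.create_fresh (μ : Mem) (x : ℕ) : (μ.create x).fresh = μ.fresh + 1 := rfl

@[simp] theorem Mem.create_heap (μ : Mem) (x l : ℕ) (f : Slot) :
    (μ.create x).heap l f = if l = μ.fresh then none else μ.heap l f := by
  by_cases h : l = μ.fresh
  · subst h; simp [Mem.create]
  · simp [Mem.create, h]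

/-- The program `c`, started in `μ` at time `k`, halts, and the time and the memory at the end
satisfy `Q`. -/
def Runs (c : Cmd) (μ : Mem) (k : ℕ) (Q : ℕ → Mem → Prop) : Prop :=
  ∃ t μ', Exec c μ t μ' ∧ Q (k + t) μ'

theorem Runs.mono {c : Cmd} {μ : Mem} {k : ℕ} {Q Q' : ℕ → Mem → Prop} (h : Runs c μ k Q)
    (hQ : ∀ t μ', Q t μ' → Q' t μ') : Runs c μ k Q' := by
  obtain ⟨t, μ', h, h'⟩ := h
  exact ⟨t, μ', h, hQ _ _ h'⟩

/-- A specification for the start at time 0 can be used at any time. -/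
theorem Runs.later {c : Cmd} {μ : Mem} {k : ℕ} {Q Q' : ℕ → Mem → Prop} (h : Runs c μ 0 Q)
    (hQ : ∀ t μ', Q t μ' → Q' (k + t) μ') : Runs c μ k Q' := by
  obtain ⟨t, μ', h, h'⟩ := h
  exact ⟨t, μ', h, hQ _ _ (by simpa using h')⟩

section Rules

variable {μ : Mem} {k : ℕ} {Q : ℕ → Mem → Prop}

@[simp] theorem runs_skip : Runs .skip μ k Q ↔ Q (k + 1) μ := by
  constructor
  · rintro ⟨t, μ', h, h'⟩; cases h; exact h'
  · exact fun h => ⟨_, _, .skip, h⟩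

@[simp] theorem runs_setNull {x : ℕ} : Runs (.setNull x) μ k Q ↔ Q (k + 1) (μ.setReg x none) := by
  constructor
  · rintro ⟨t, μ', h, h'⟩; cases h; exact h'
  · exact fun h => ⟨_, _, .setNull, h⟩

@[simp] theorem runs_copy {x y : ℕ} : Runs (.copy x y) μ k Q ↔ Q (k + 1) (μ.setReg x (μ.reg y)) := by
  constructor
  · rintro ⟨t, μ', h, h'⟩; cases h; exact h'
  · exact fun h => ⟨_, _, .copy, h⟩

@[simp] theorem runs_load {x y : ℕ} {f : Slot} : Runs (.load x y f) μ k Q ↔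
    ∃ l, μ.reg y = some l ∧ Q (k + 1) (μ.setReg x (μ.heap l f)) := by
  constructor
  · rintro ⟨t, μ', h, h'⟩; cases h with | load hl => exact ⟨_, hl, h'⟩
  · exact fun ⟨l, hl, h⟩ => ⟨_, _, .load hl, h⟩

@[simp] theorem runs_store {x y : ℕ} {f : Slot} : Runs (.store x f y) μ k Q ↔
    ∃ l, μ.reg x = some l ∧ Q (k + 1) (μ.setField l f (μ.reg y)) := by
  constructor
  · rintro ⟨t, μ', h, h'⟩; cases h with | store hl => exact ⟨_, hl, h'⟩
  · exact fun ⟨l, hl, h⟩ => ⟨_, _, .store hl, h⟩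

@[simp] theorem runs_alloc {x : ℕ} : Runs (.alloc x) μ k Q ↔ Q (k + 1) (μ.create x) := by
  constructor
  · rintro ⟨t, μ', h, h'⟩; cases h; exact h'
  · exact fun h => ⟨_, _, .alloc, h⟩

theorem runs_seq {p q : Cmd} :
    Runs (.seq p q) μ k Q ↔ Runs p μ k fun k' μ' => Runs q μ' k' Q := by
  constructor
  · rintro ⟨t, μ', h, h'⟩
    cases h with
    | seq h₁ h₂ => exact ⟨_, _, h₁, _, _, h₂, by rwa [Nat.add_assoc]⟩
  · rintro ⟨t, μ', h₁, t', μ'', h₂, h⟩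
    exact ⟨_, _, .seq h₁ h₂, by rwa [← Nat.add_assoc]⟩

@[simp] theorem runs_cond {b : Test} {p q : Cmd} : Runs (.cond b p q) μ k Q ↔
    (b.Holds μ → Runs p μ (k + 1) Q) ∧ (¬ b.Holds μ → Runs q μ (k + 1) Q) := by
  constructor
  · rintro ⟨t, μ', h, h'⟩
    cases h with
    | condTrue hb h =>
      exact ⟨fun _ => ⟨_, _, h, by convert h' using 1; omega⟩, fun h => absurd hb h⟩
    | condFalse hb h =>
      exact ⟨fun h => absurd h hb, fun _ => ⟨_, _, h, by convert h' using 1; omega⟩⟩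
  · rintro ⟨h1, h2⟩
    by_cases hb : b.Holds μ
    · obtain ⟨t, μ', h, h'⟩ := h1 hb
      exact ⟨_, _, .condTrue hb h, by convert h' using 1; omega⟩
    · obtain ⟨t, μ', h, h'⟩ := h2 hb
      exact ⟨_, _, .condFalse hb h, by convert h' using 1; omega⟩

theorem runs_loop_done {b : Test} {p : Cmd} (hb : ¬ b.Holds μ) (h : Q (k + 1) μ) :
    Runs (.loop b p) μ k Q := ⟨_, _, .loopDone hb, h⟩

theorem runs_loop_step {b : Test} {p : Cmd} (hb : b.Holds μ)
    (h : Runs p μ (k + 1) fun k' μ' => Runs (.loop b p) μ' k' Q) : Runs (.loop b p) μ k Q := by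
  obtain ⟨t, μ', h₁, t', μ'', h₂, h⟩ := h
  exact ⟨_, _, .loopStep hb h₁ h₂, by convert h using 1; omega⟩

end Rules

/-- Several commands, one after the other. -/
def Cmd.block : List Cmd → Cmd
  | [] => .skip
  | [c] => c
  | c :: d :: l => .seq c (Cmd.block (d :: l))

@[simp] theorem runs_block_one {c : Cmd} {μ : Mem} {k : ℕ} {Q : ℕ → Mem → Prop} :
    Runs (Cmd.block [c]) μ k Q ↔ Runs c μ k Q := Iff.rfl

@[simp] theorem runs_block_cons {c d : Cmd} {l : List Cmd} {μ : Mem} {k : ℕ} {Q : ℕ → Mem → Prop} :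
    Runs (Cmd.block (c :: d :: l)) μ k Q ↔
      Runs c μ k fun k' μ' => Runs (Cmd.block (d :: l)) μ' k' Q := runs_seq

@[simp] theorem holds_isNull {μ : Mem} {x : ℕ} : (Test.isNull x).Holds μ ↔ μ.reg x = none := Iff.rfl
@[simp] theorem holds_nonNull {μ : Mem} {x : ℕ} : (Test.nonNull x).Holds μ ↔ μ.reg x ≠ none :=
  Iff.rfl
@[simp] theorem holds_same {μ : Mem} {x y : ℕ} : (Test.same x y).Holds μ ↔ μ.reg x = μ.reg y :=
  Iff.rfl

end Machine

/-! ### The layout of the memory and the walk along the pattern -/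

section Layout

/-- The fields that the updates change only in new records and where the automaton is cut off. -/
def Slot.structural : Slot → Prop
  | .flink | .out | .nextOut | .aux _ => False
  | _ => True

/-- The structural fields of the records below `n` have the same contents. -/
def Agree (n : ℕ) (h h' : Heap) : Prop := ∀ l < n, ∀ f : Slot, f.structural → h' l f = h l f

theorem Agree.refl (n : ℕ) (h : Heap) : Agree n h h := fun _ _ _ _ => rfl

theorem Agree.trans {n : ℕ} {h₁ h₂ h₃ : Heap} (h : Agree n h₁ h₂) (h' : Agree n h₂ h₃) :
    Agree n h₁ h₃ := fun l hl f hf => (h' l hl f hf).trans (h l hl f hf)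

/-- The memories differ in the given registers at most. -/
structure Mem.OnlyRegs (μ : Mem) (L : List ℕ) (μ' : Mem) : Prop where
  heap : μ'.heap = μ.heap
  fresh : μ'.fresh = μ.fresh
  reg : ∀ x, x ∉ L → μ'.reg x = μ.reg x

variable {A : Type*}

theorem TreeStored.congr {V : Type*} {enc : A → List Bool} {E : V → A → V → Prop}
    {addr : V → List Bool → ℕ} {h h' : Heap} {a : V} (H : TreeStored enc E addr h a)
    (hh : ∀ b, TreeLive enc E a b → ∀ f ∈ [Slot.zero, .one, .dest],
      h' (addr a b) f = h (addr a b) f) (he : ∀ c w, E a c w → TreeLive enc E a (enc c)) :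
    TreeStored enc E addr h' a where
  zero b h1 h2 := by rw [hh b h1 _ (by simp), H.zero b h1 h2]
  zero_null b h1 h2 := by rw [hh b h1 _ (by simp), H.zero_null b h1 h2]
  one b h1 h2 := by rw [hh b h1 _ (by simp), H.one b h1 h2]
  one_null b h1 h2 := by rw [hh b h1 _ (by simp), H.one_null b h1 h2]
  dest c w h := by rw [hh _ (he c w h) _ (by simp), H.dest c w h]
  dest_null b h1 h2 := by rw [hh b h1 _ (by simp), H.dest_null b h1 h2]

theorem treeLive_enc {V : Type*} {enc : A → List Bool} {E : V → A → V → Prop} {a w : V} {c : A}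
    (h : E a c w) : TreeLive enc E a (enc c) := Or.inr ⟨c, w, h, List.prefix_rfl⟩

theorem treeLive_of_prefix {V : Type*} {enc : A → List Bool} {E : V → A → V → Prop} {a : V}
    {b b' : List Bool} (h : b <+: b') (hb : TreeLive enc E a b') : TreeLive enc E a b := by
  rcases hb with rfl | ⟨c, w, hE, hb⟩
  · exact Or.inl (List.prefix_nil.1 h)
  · exact Or.inr ⟨c, w, hE, h.trans hb⟩

theorem ChainAt.congr {h h' : Heap} {f : Slot} {v : Option ℕ} {ls : List ℕ}
    (H : ChainAt h f v ls) (hh : ∀ l ∈ ls, h' l f = h l f) : ChainAt h' f v ls := by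
  induction ls generalizing v with
  | nil => exact H
  | cons l ls ih =>
    refine ⟨H.1, ?_⟩
    rw [hh l (by simp)]
    exact ih H.2 fun l' hl' => hh l' (by simp [hl'])

theorem BitsStored.congr {S : Set ℕ} {h h' : Heap}
    (hh : ∀ l ∈ S, ∀ f : Slot, f.structural → h' l f = h l f) {v : Option ℕ} {b : List Bool}
    (H : BitsStored h S v b) : BitsStored h' S v b := by
  induction b generalizing v with
  | nil => exact H
  | cons i b ih =>
    obtain ⟨l, hl, h1, h2, h3⟩ := H
    refine ⟨l, hl, h1, ?_, ?_⟩
    · rw [hh l hl .bit trivial, h2]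
    · rw [hh l hl .next trivial]; exact ih h3

theorem StringStored.congr {enc : A → List Bool} {S : Set ℕ} {h h' : Heap}
    (hh : ∀ l ∈ S, ∀ f : Slot, f.structural → h' l f = h l f)
    {v : Option ℕ} {x : List A} (H : StringStored enc h S v x) :
    StringStored enc h' S v x := by
  induction x generalizing v with
  | nil => exact H
  | cons c x ih =>
    obtain ⟨l, hl, h1, h2, h3⟩ := H
    refine ⟨l, hl, h1, ?_, ?_⟩
    · rw [hh l hl .code trivial]; exact h2.congr hh
    · rw [hh l hl .next trivial]; exact ih h3

theorem BitsStored.mono {h : Heap} {S S' : Set ℕ} (hS : S ⊆ S') {v : Option ℕ} {b : List Bool}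
    (H : BitsStored h S v b) : BitsStored h S' v b := by
  induction b generalizing v with
  | nil => exact H
  | cons i b ih =>
    obtain ⟨l, hl, h1, h2, h3⟩ := H
    exact ⟨l, hS hl, h1, h2, ih h3⟩

theorem StringStored.mono {enc : A → List Bool} {h : Heap} {S S' : Set ℕ} (hS : S ⊆ S')
    {v : Option ℕ} {x : List A} (H : StringStored enc h S v x) : StringStored enc h S' v x := by
  induction x generalizing v with
  | nil => exact H
  | cons c x ih =>
    obtain ⟨l, hl, h1, h2, h3⟩ := H
    exact ⟨l, hS hl, h1, h2.mono hS, ih h3⟩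

/-- The structural part of the memory during an update: below `n`, the heap `h` holds the goto
function of the automaton of `T`, the DAWG of `D`, in which the inverse suffix links of a node `v`
are listed in the order `ch v`, and the pattern `p`, to which `pp` points. -/
structure Layout (enc : A → List Bool) (T D : Set (List A)) (p : List A)
    (α : List A → List Bool → ℕ) (ν : Set (List A) → List Bool → ℕ)
    (ch : Set (List A) → List (Set (List A))) (n : ℕ) (pp : Option ℕ) (h : Heap) : Prop where
  state_lt : ∀ s b, stateLive enc T s b → α s b < n
  state_inj : ∀ s b s' b', stateLive enc T s b → stateLive enc T s' b' → α s b = α s' b' →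
    s = s' ∧ b = b'
  goto : ∀ s ∈ states T, TreeStored enc (IsGoto T) α h s
  node_lt : ∀ v b, nodeLive enc D v b → ν v b < n
  node_inj : ∀ v b v' b', nodeLive enc D v b → nodeLive enc D v' b' → ν v b = ν v' b' →
    v = v' ∧ b = b'
  trans : ∀ v ∈ nodes D, TreeStored enc (IsEdge D) ν h v
  children : IsChildren D ch
  isuf : ∀ v ∈ nodes D, ChainAt h .sibling (h (ν v []) .isuf) ((ch v).map fun u => ν u [])
  trunk : ∀ v ∈ nodes D, ∀ s ∈ states D, s ∈ v → h (ν v []) .toState = some (α s [])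
  non_trunk : ∀ v ∈ nodes D, (∀ s ∈ states D, s ∉ v) → h (ν v []) .toState = none
  separated : Separated enc T D α ν
  pattern : StringStored enc h {l | l < n} pp p

variable {enc : A → List Bool} {T D : Set (List A)} {p : List A}
    {α : List A → List Bool → ℕ} {ν : Set (List A) → List Bool → ℕ}
    {ch : Set (List A) → List (Set (List A))} {n : ℕ} {pp : Option ℕ} {h h' : Heap}

theorem stateLive_nil {s : List A} (hs : s ∈ states D) : stateLive enc D s [] := ⟨hs, Or.inl rfl⟩

theorem nodeLive_nil {v : Set (List A)} (hv : v ∈ nodes D) : nodeLive enc D v [] := ⟨hv, Or.inl rfl⟩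

theorem IsChildren.mem_nodes (hch : IsChildren D ch) {u v : Set (List A)} (hv : v ∈ nodes D)
    (hu : u ∈ ch v) : u ∈ nodes D := (((hch v hv).2 u).1 hu).mem_nodes.1

theorem Layout.congr (H : Layout enc T D p α ν ch n pp h) (hh : Agree n h h') :
    Layout enc T D p α ν ch n pp h' where
  state_lt := H.state_lt
  state_inj := H.state_inj
  goto s hs := (H.goto s hs).congr (fun b hb f hf => hh _ (H.state_lt _ _ ⟨hs, hb⟩) _ (by
    fin_cases hf <;> trivial)) fun _ _ => treeLive_enc
  node_lt := H.node_lt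
  node_inj := H.node_inj
  trans v hv := (H.trans v hv).congr (fun b hb f hf => hh _ (H.node_lt _ _ ⟨hv, hb⟩) _ (by
    fin_cases hf <;> trivial)) fun _ _ => treeLive_enc
  children := H.children
  isuf v hv := by
    rw [hh _ (H.node_lt _ _ (nodeLive_nil hv)) .isuf trivial]
    refine (H.isuf v hv).congr fun l hl => ?_
    obtain ⟨u, hu, rfl⟩ := List.mem_map.1 hl
    exact hh _ (H.node_lt _ _ (nodeLive_nil (H.children.mem_nodes hv hu))) .sibling trivial
  trunk v hv := by
    rw [hh _ (H.node_lt _ _ (nodeLive_nil hv)) .toState trivial]; exact H.trunk v hv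
  non_trunk v hv := by
    rw [hh _ (H.node_lt _ _ (nodeLive_nil hv)) .toState trivial]; exact H.non_trunk v hv
  separated := H.separated
  pattern := H.pattern.congr hh

theorem Layout.state_ne (H : Layout enc T D p α ν ch n pp h) {s t : List A} (hs : s ∈ states T)
    (ht : t ∈ states T) : α s [] = α t [] ↔ s = t :=
  ⟨fun h => (H.state_inj _ _ _ _ (stateLive_nil hs) (stateLive_nil ht) h).1, fun h => by rw [h]⟩

open Classical in
/-- The location of the node of `x`; null if `x` is not a substring of a pattern. -/
noncomputable def nodePtr (D : Set (List A)) (ν : Set (List A) → List Bool → ℕ) (x : List A) :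
    Option ℕ := if x ∈ substr D then some (ν (cls D x) []) else none

/-- Follows the transition of the vertex in register 10 (null is allowed) that is labelled with the
code word in register 11. -/
def follow : Cmd := .block [
  .loop (.nonNull 11) (.block [
    .cond (.nonNull 10)
      (.block [.load 12 11 .bit, .cond (.isNull 12) (.load 10 10 .zero) (.load 10 10 .one)])
      .skip,
    .load 11 11 .next]),
  .cond (.nonNull 10) (.load 10 10 .dest) .skip]

/-- The field for a bit. -/
def bitSlot (i : Bool) : Slot := if i then .one else .zero

theorem follow_bits {S : Set ℕ} {Q : ℕ → Mem → Prop} (loc : List Bool → Option ℕ)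
    (rest : List Bool) : ∀ (b : List Bool) (μ : Mem) (k : ℕ),
    BitsStored μ.heap S (μ.reg 11) rest → μ.reg 10 = loc b →
    (∀ b' i, (b' ++ [i]) <+: b ++ rest →
      (∀ l, loc b' = some l → μ.heap l (bitSlot i) = loc (b' ++ [i])) ∧
      (loc b' = none → loc (b' ++ [i]) = none)) →
    (∀ k' μ', k' ≤ k + 6 * rest.length + 1 → μ.OnlyRegs [10, 11, 12] μ' →
      μ'.reg 10 = loc (b ++ rest) → Q k' μ') →
    Runs (.loop (.nonNull 11) (.block [
    .cond (.nonNull 10)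
      (.block [.load 12 11 .bit, .cond (.isNull 12) (.load 10 10 .zero) (.load 10 10 .one)])
      .skip,
    .load 11 11 .next])) μ k Q := by
  induction rest with
  | nil =>
    intro b μ k hB h10 _ hQ
    refine runs_loop_done (by simpa [BitsStored] using hB) ?_
    exact hQ _ _ (by simp) ⟨rfl, rfl, fun _ _ => rfl⟩ (by simpa using h10)
  | cons i rest ih =>
    intro b μ k hB h10 hloc hQ
    obtain ⟨l, -, h11, hbit, hB⟩ := hB
    refine runs_loop_step (by simp [h11]) ?_
    have hstep := hloc b i ⟨rest, by simp⟩
    have key : ∀ (k' : ℕ) (μ' : Mem), k' ≤ k + 6 → μ.OnlyRegs [10, 11, 12] μ' →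
        μ'.reg 11 = μ.heap l .next → μ'.reg 10 = loc (b ++ [i]) →
        Runs (.loop (.nonNull 11) (.block [
          .cond (.nonNull 10)
            (.block [.load 12 11 .bit, .cond (.isNull 12) (.load 10 10 .zero) (.load 10 10 .one)])
            .skip,
          .load 11 11 .next])) μ' k' Q := by
      intro k' μ' hk hμ h11' h10'
      refine ih (b ++ [i]) μ' k' (by rw [hμ.heap, h11']; exact hB) h10' ?_ ?_
      · rw [hμ.heap]; simpa using hloc
      · intro k'' μ'' hk' hμ' h10''
        refine hQ _ _ (by simp; omega) ⟨hμ'.heap.trans hμ.heap, hμ'.fresh.trans hμ.fresh,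
          fun x hx => (hμ'.reg x hx).trans (hμ.reg x hx)⟩ (by simpa using h10'')
    cases hl : loc b with
    | none =>
      simp [h10, hl, h11]
      refine key _ _ (by omega) ⟨rfl, rfl, fun x hx => ?_⟩ (by simp) ?_
      · simp at hx; simp [hx]
      · simp [h10, hl, hstep.2 hl]
    | some a =>
      have h1 := hstep.1 a hl
      cases i with
      | false =>
        have hbit' : μ.heap l .bit = none := by simpa using hbit
        simp [h10, hl, h11, hbit']
        refine key _ _ (by omega) ⟨rfl, rfl, fun x hx => ?_⟩ (by simp) ?_
        · simp at hx; simp [hx]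
        · simpa [bitSlot] using h1
      | true =>
        have hbit' : μ.heap l .bit ≠ none := by
          intro h; simp [h] at hbit
        simp [h10, hl, h11, hbit']
        refine key _ _ (by omega) ⟨rfl, rfl, fun x hx => ?_⟩ (by simp) ?_
        · simp at hx; simp [hx]
        · simpa [bitSlot] using h1

theorem follow_null {S : Set ℕ} {μ : Mem} {k : ℕ} {w : List Bool} {Q : ℕ → Mem → Prop}
    (hB : BitsStored μ.heap S (μ.reg 11) w) (h10 : μ.reg 10 = none)
    (hQ : ∀ k' μ', k' ≤ k + 6 * w.length + 3 → μ.OnlyRegs [10, 11, 12] μ' →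
      μ'.reg 10 = none → Q k' μ') : Runs follow μ k Q := by
  refine runs_block_cons.2 (follow_bits (fun _ => none) w [] μ k hB h10 (by simp) ?_)
  intro k' μ' hk hμ h
  simp [h]
  exact hQ _ _ (by omega) hμ h

/-- Following one transition takes time proportional to the length `K` of the code words. -/
theorem follow_tree {V : Type*} {E : V → A → V → Prop} {addr : V → List Bool → ℕ}
    {S : Set ℕ} {μ : Mem} {k K : ℕ} {a : V} {c : A} {Q : ℕ → Mem → Prop}
    (hE : Function.Injective enc) (hK : ∀ c, (enc c).length = K)
    (hT : TreeStored enc E addr μ.heap a)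
    (hB : BitsStored μ.heap S (μ.reg 11) (enc c)) (h10 : μ.reg 10 = some (addr a []))
    (hQ : ∀ k' μ', k' ≤ k + 6 * K + 3 → μ.OnlyRegs [10, 11, 12] μ' →
      (∀ w, E a c w → μ'.reg 10 = some (addr w [])) →
      ((∀ w, ¬ E a c w) → μ'.reg 10 = none) → Q k' μ') : Runs follow μ k Q := by
  classical
  refine runs_block_cons.2 (follow_bits
    (fun b => if TreeLive enc E a b then some (addr a b) else none) (enc c) [] μ k hB
    (by simp [h10, TreeLive]) ?_ ?_)
  · intro b i _
    by_cases hb : TreeLive enc E a b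
    · simp only [hb, if_true, Option.some.injEq, forall_eq', reduceCtorEq, false_imp_iff, and_true]
      by_cases hbi : TreeLive enc E a (b ++ [i])
      · cases i
        · simp [hbi, bitSlot, hT.zero b hb hbi]
        · simp [hbi, bitSlot, hT.one b hb hbi]
      · cases i
        · simp [hbi, bitSlot, hT.zero_null b hb hbi]
        · simp [hbi, bitSlot, hT.one_null b hb hbi]
    · have : ¬ TreeLive enc E a (b ++ [i]) := fun h => hb (treeLive_of_prefix ⟨[i], rfl⟩ h)
      simp [hb, this]
  · intro k' μ' hk hμ h
    rw [hK] at hk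
    by_cases hl : TreeLive enc E a (enc c)
    · simp only [List.nil_append, hl, if_true] at h
      simp [h]
      refine hQ _ _ (by omega) ⟨hμ.heap, hμ.fresh, fun x hx => ?_⟩ ?_ ?_
      · have := hμ.reg x hx
        simp at hx; simp [hx, this]
      · intro w hw; simp [hμ.heap, hT.dest c w hw]
      · intro hw
        simp only [Mem.setReg_reg, if_true, hμ.heap]
        refine hT.dest_null _ hl fun c' w hw' h => ?_
        rw [hE h] at hw
        exact hw w hw'
    · simp only [List.nil_append, hl, if_false] at h
      simp [h]
      refine hQ _ _ (by omega) hμ ?_ fun _ => h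
      exact fun w hw => absurd (treeLive_enc hw) hl

/-- Walks along the pattern, with the current letter in register 3, the state of the current prefix
in register 4, its node (or null) in register 5 and the current code word in register 13. -/
def forPrefixes (body : Cmd) : Cmd := .block [
  .copy 3 2, .copy 4 0, .copy 5 1,
  .loop (.nonNull 3) (.block [
    .load 13 3 .code,
    .copy 10 4, .copy 11 13, follow, .copy 4 10,
    .copy 10 5, .copy 11 13, follow, .copy 5 10,
    body,
    .load 3 3 .next])]

/-- Registers 0, 1 and 2 have their initial contents. -/
structure Anchored (α : List A → List Bool → ℕ) (ν : Set (List A) → List Bool → ℕ)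
    (D : Set (List A)) (pp : Option ℕ) (μ : Mem) : Prop where
  root : μ.reg 0 = some (α [] [])
  source : μ.reg 1 = some (ν (cls D []) [])
  pattern : μ.reg 2 = pp

theorem nil_mem_substr : [] ∈ substr D := Or.inl rfl

/-- The loop invariant `Inv x k μ` also bounds the number of steps: `k` is at least the number of
steps that have been made when the prefix `x` has been processed. Hence it can contain an amortized
estimate. -/
theorem forPrefixes_spec {K : ℕ} (hE : Function.Injective enc) (hK : ∀ c, (enc c).length = K)
    (hp : p ∈ states T) {h₀ : Heap} (hL : Layout enc T D p α ν ch n pp h₀)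
    {Inv : List A → ℕ → Mem → Prop} {body : Cmd}
    (hInv : ∀ x k μ, Inv x k μ → Agree n h₀ μ.heap ∧ Anchored α ν D pp μ)
    (hframe : ∀ x k μ μ', Inv x k μ → μ.OnlyRegs [3, 4, 5, 10, 11, 12, 13] μ' → Inv x k μ')
    (hbody : ∀ x c rest k μ, p = x ++ c :: rest → Inv x k μ →
      μ.reg 4 = some (α (x ++ [c]) []) → μ.reg 5 = nodePtr D ν (x ++ [c]) →
      BitsStored μ.heap {l | l < n} (μ.reg 13) (enc c) →
      Runs body μ 0 fun t μ' => (∀ i ∈ [3, 4, 5], μ'.reg i = μ.reg i) ∧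
        Inv (x ++ [c]) (k + t + (12 * K + 15)) μ')
    {k : ℕ} {μ : Mem} (h0 : Inv [] (k + 4) μ) :
    Runs (forPrefixes body) μ k fun t μ' => ∃ κ ≥ t, Inv p κ μ' ∧
      μ'.reg 4 = some (α p []) ∧ μ'.reg 5 = nodePtr D ν p := by
  have main : ∀ (rest x : List A) (μ : Mem) (k κ : ℕ), p = x ++ rest → k + 1 ≤ κ → Inv x κ μ →
      StringStored enc h₀ {l | l < n} (μ.reg 3) rest → μ.reg 4 = some (α x []) →
      μ.reg 5 = nodePtr D ν x →
      Runs (.loop (.nonNull 3) (.block [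
        .load 13 3 .code,
        .copy 10 4, .copy 11 13, follow, .copy 4 10,
        .copy 10 5, .copy 11 13, follow, .copy 5 10,
        body,
        .load 3 3 .next])) μ k fun t μ' => ∃ κ ≥ t, Inv p κ μ' ∧
          μ'.reg 4 = some (α p []) ∧ μ'.reg 5 = nodePtr D ν p := by
    intro rest
    induction rest with
    | nil =>
      intro x μ k κ hx hk hI h3 h4 h5
      rw [List.append_nil] at hx
      subst hx
      exact runs_loop_done (by simpa [StringStored] using h3) ⟨κ, hk, hI, h4, h5⟩
    | cons c rest ih =>
      intro x μ k κ hx hk hI h3 h4 h5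
      obtain ⟨l, hl, h3, hcode, hnext⟩ := h3
      have hA := (hInv _ _ _ hI).1
      have hL' := hL.congr hA
      have hxc : x ++ [c] ∈ states T := mem_states_of_prefix ⟨rest, by simp [hx]⟩ hp
      have hxs : x ∈ states T := mem_states_of_prefix ⟨[c], rfl⟩ hxc
      have hcode' : BitsStored μ.heap {l | l < n} (μ.heap l .code) (enc c) := by
        rw [hA l hl .code trivial]; exact hcode.congr hA
      have hgoto : IsGoto T x c (x ++ [c]) := ⟨hxs, hxc, rfl⟩
      refine runs_loop_step (by simp [h3]) ?_
      simp [h3]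
      refine follow_tree (a := x) (c := c) hE hK (hL'.goto x hxs) (by simpa using hcode')
        (by simp [h4]) ?_
      intro k₁ μ₁ hk₁ hμ₁ hg _
      replace hg := hg _ hgoto
      -- after the second transition
      have key : ∀ k₂ μ₂, k₂ ≤ k + 12 * K + 13 → μ.OnlyRegs [4, 10, 11, 12, 13] μ₂ →
          μ₂.reg 4 = some (α (x ++ [c]) []) → μ₂.reg 13 = μ.heap l .code →
          μ₂.reg 10 = nodePtr D ν (x ++ [c]) →
          Runs body (μ₂.setReg 5 (μ₂.reg 10)) (k₂ + 1) fun k' μ' =>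
            ∃ l, μ'.reg 3 = some l ∧ Runs (.loop (.nonNull 3) (.block [
              .load 13 3 .code,
              .copy 10 4, .copy 11 13, follow, .copy 4 10,
              .copy 10 5, .copy 11 13, follow, .copy 5 10,
              body,
              .load 3 3 .next])) (μ'.setReg 3 (μ'.heap l .next)) (k' + 1) fun t μ' => ∃ κ ≥ t,
                Inv p κ μ' ∧ μ'.reg 4 = some (α p []) ∧ μ'.reg 5 = nodePtr D ν p := by
        intro k₂ μ₂ hk₂ hμ₂ h4' h13 h10
        have hI' : Inv x κ (μ₂.setReg 5 (μ₂.reg 10)) := by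
          refine hframe _ _ _ _ hI ⟨hμ₂.heap, hμ₂.fresh, fun i hi => ?_⟩
          have := hμ₂.reg i (by simp at hi ⊢; tauto)
          simp at hi; simp [hi, this]
        refine (hbody x c rest κ _ hx hI' (by simp [h4']) (by simp [h10]) ?_).later ?_
        · simpa [h13, hμ₂.heap] using hcode'
        · rintro t μ' ⟨hr, hI''⟩
          have hr3 := hr 3 (by simp)
          have hr4 := hr 4 (by simp)
          have hr5 := hr 5 (by simp)
          have h3' : μ₂.reg 3 = some l := by rw [hμ₂.reg 3 (by simp), h3]
          refine ⟨l, by simp [hr3, h3'], ?_⟩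
          refine ih (x ++ [c]) _ _ (κ + t + (12 * K + 15)) (by simp [hx]) (by omega)
            (hframe _ _ _ _ hI'' ⟨rfl, rfl, fun i hi => ?_⟩) ?_ ?_ ?_
          · simp at hi; simp [hi]
          · have := (hInv _ _ _ hI'').1 l hl .next trivial
            simpa [this] using hnext
          · simp [hr4, h4']
          · simp [hr5, h10]
      by_cases hxD : x ∈ substr D
      · have h5' : μ.reg 5 = some (ν (cls D x) []) := by rw [h5, nodePtr, if_pos hxD]
        refine follow_tree (a := cls D x) (c := c) hE hK (E := IsEdge D) (addr := ν)
          (S := {l | l < n}) ?_ ?_ ?_ ?_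
        · simpa [hμ₁.heap] using hL'.trans _ (cls_mem_nodes hxD)
        · simpa [hμ₁.heap, hμ₁.reg 13] using hcode'
        · simp [hμ₁.reg 5, h5']
        · intro k₂ μ₂ hk₂ hμ₂ he hn
          refine key k₂ μ₂ (by omega) ⟨hμ₂.heap.trans hμ₁.heap, hμ₂.fresh.trans hμ₁.fresh,
            fun i hi => ?_⟩ ?_ ?_ ?_
          · rw [hμ₂.reg i (by simp at hi ⊢; tauto)]
            have := hμ₁.reg i (by simp at hi ⊢; tauto)
            simp at hi; simp [hi, this]
          · rw [hμ₂.reg 4 (by simp)]; simp [hg]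
          · rw [hμ₂.reg 13 (by simp)]; simp [hμ₁.reg 13]
          · simp only [isEdge_cls_iff hxD] at he hn
            by_cases hxcD : x ++ [c] ∈ substr D
            · rw [he _ ⟨hxcD, rfl⟩, nodePtr, if_pos hxcD]
            · rw [hn (by simp [hxcD]), nodePtr, if_neg hxcD]
      · have h5' : μ.reg 5 = none := by rw [h5, nodePtr, if_neg hxD]
        refine follow_null (w := enc c) (S := {l | l < n}) ?_ ?_ ?_
        · simpa [hμ₁.heap, hμ₁.reg 13] using hcode'
        · simp [hμ₁.reg 5, h5']
        · intro k₂ μ₂ hk₂ hμ₂ hn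
          rw [hK] at hk₂
          refine key k₂ μ₂ (by omega) ⟨hμ₂.heap.trans hμ₁.heap, hμ₂.fresh.trans hμ₁.fresh,
            fun i hi => ?_⟩ ?_ ?_ ?_
          · rw [hμ₂.reg i (by simp at hi ⊢; tauto)]
            have := hμ₁.reg i (by simp at hi ⊢; tauto)
            simp at hi; simp [hi, this]
          · rw [hμ₂.reg 4 (by simp)]; simp [hg]
          · rw [hμ₂.reg 13 (by simp)]; simp [hμ₁.reg 13]
          · rw [hn, nodePtr, if_neg fun h => hxD (mem_substr_of_prefix ⟨[c], rfl⟩ h)]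
  obtain ⟨hA, hR⟩ := hInv _ _ _ h0
  simp only [forPrefixes, runs_block_cons, runs_block_one, runs_copy]
  refine main p [] _ _ (k + 4) rfl (by omega) (hframe _ _ _ _ h0 ⟨rfl, rfl, fun i hi => ?_⟩)
    ?_ ?_ ?_
  · simp at hi; simp [hi]
  · simpa [hR.pattern] using hL.pattern
  · simp [hR.root]
  · simp [hR.source, nodePtr, nil_mem_substr]

end Layout

/-! ### The traversal program -/

section Traversal

variable {A : Type*} {enc : A → List Bool} {T D : Set (List A)} {p : List A}
    {α : List A → List Bool → ℕ} {ν : Set (List A) → List Bool → ℕ}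
    {ch : Set (List A) → List (Set (List A))} {n : ℕ} {pp : Option ℕ}

/-- The main loop of a depth-first traversal. Register 20 points to a stack of new records; the
field `aux 0` of each one leads to a node, which stands for itself and its later siblings (or is
null), and the field `aux 1` to the next record. The program `visit` is called for the node in
register 21 and has to leave its first child, or null, in register 23. -/
def walkLoop (visit : Cmd) : Cmd := .loop (.nonNull 20) (.block [
  .load 21 20 (.aux 0), .load 20 20 (.aux 1),
  .cond (.isNull 21) .skip (.block [
    .load 22 21 .sibling, .alloc 24, .store 24 (.aux 0) 22, .store 24 (.aux 1) 20, .copy 20 24,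
    visit,
    .alloc 24, .store 24 (.aux 0) 23, .store 24 (.aux 1) 20, .copy 20 24])])

/-- The traversal that starts with the node in register 23 and its later siblings. -/
def walk (visit : Cmd) : Cmd := .block [.alloc 20, .store 20 (.aux 0) 23, walkLoop visit]

/-- The stack of a traversal, in records between `n` and `m`. The lists of siblings are those of
the heap `h₀`. -/
def Stacked (ν : Set (List A) → List Bool → ℕ) (n m : ℕ) (h₀ h : Heap) :
    Option ℕ → List (List (Set (List A))) → Prop
  | v, [] => v = none
  | v, seg :: segs => ∃ l, n ≤ l ∧ l < m ∧ v = some l ∧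
      ChainAt h₀ .sibling (h l (.aux 0)) (seg.map fun u => ν u []) ∧
      Stacked ν n m h₀ h (h l (.aux 1)) segs

theorem Stacked.congr {m m' : ℕ} {h₀ h h' : Heap} (hm : m ≤ m')
    (hh : ∀ l, n ≤ l → l < m → h' l = h l) {segs : List (List (Set (List A)))} {v : Option ℕ}
    (H : Stacked ν n m h₀ h v segs) : Stacked ν n m' h₀ h' v segs := by
  induction segs generalizing v with
  | nil => exact H
  | cons seg segs ih =>
    obtain ⟨l, h1, h2, h3, h4, h5⟩ := H
    refine ⟨l, h1, h2.trans_le hm, h3, ?_, ?_⟩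
    · rw [hh l h1 h2]; exact h4
    · rw [hh l h1 h2]; exact ih h5

/-- What the program `visit` has to achieve: it takes at most `cv` steps for the node `v` and
establishes `J` for the list of visited nodes, extended by `v`; `ρ` are the parameters. -/
def VisitSpec (ν : Set (List A) → List Bool → ℕ) (D : Set (List A)) (n : ℕ) (h₀ : Heap)
    (ρ : ℕ → Option ℕ) (halt : Set (List A) → Prop) (J : List (Set (List A)) → Heap → Prop)
    (cv : ℕ) (visit : Cmd) : Prop :=
  ∀ v ∈ nodes D, ∀ done μ, J done μ.heap → n ≤ μ.fresh → μ.reg 21 = some (ν v []) →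
    (∀ x < 20, μ.reg x = ρ x) →
    Runs visit μ 0 fun t μ' => t ≤ cv ∧ J (v :: done) μ'.heap ∧ (∀ l ≥ n, μ'.heap l = μ.heap l) ∧
      μ'.fresh = μ.fresh ∧ (∀ x < 23, μ'.reg x = μ.reg x) ∧ (halt v → μ'.reg 23 = none) ∧
      (¬ halt v → μ'.reg 23 = h₀ (ν v []) .isuf)

/-- The memory after a traversal with the parameters `ρ` that started in `μ`. -/
structure Walked (n : ℕ) (ρ : ℕ → Option ℕ) (μ μ' : Mem) : Prop where
  fresh : μ.fresh ≤ μ'.fresh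
  scratch : ∀ l, n ≤ l → l < μ.fresh → μ'.heap l = μ.heap l
  reg : ∀ x < 20, μ'.reg x = ρ x

theorem Walked.trans {ρ : ℕ → Option ℕ} {μ₁ μ₂ μ₃ : Mem} (h : μ₁.fresh ≤ μ₂.fresh)
    (h' : ∀ l, n ≤ l → l < μ₁.fresh → μ₂.heap l = μ₁.heap l) (H : Walked n ρ μ₂ μ₃) :
    Walked n ρ μ₁ μ₃ :=
  ⟨h.trans H.fresh, fun l h1 h2 => (H.scratch l h1 (h2.trans_le h)).trans (h' l h1 h2), H.reg⟩

theorem walkLoop_spec {h₀ : Heap} (hL : Layout enc T D p α ν ch n pp h₀) {ρ : ℕ → Option ℕ}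
    {halt : Set (List A) → Prop} {J : List (Set (List A)) → Heap → Prop} {cv : ℕ} {visit : Cmd}
    (hJ : ∀ done h h', J done h → (∀ l < n, h' l = h l) → J done h')
    (hJA : ∀ done h, J done h → Agree n h₀ h)
    (hV : VisitSpec ν D n h₀ ρ halt J cv visit)
    {segs : List (List (Set (List A)))} {out : List (Set (List A))}
    (hW : Walk halt ch segs out) : ∀ (μ : Mem) (k : ℕ) (done : List (Set (List A))),
    (∀ v ∈ segs.flatten, v ∈ nodes D) → Stacked ν n μ.fresh h₀ μ.heap (μ.reg 20) segs →
    J done μ.heap → n ≤ μ.fresh → (∀ x < 20, μ.reg x = ρ x) →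
    Runs (walkLoop visit) μ k fun t μ' =>
      t ≤ k + (cv + 13) * (segs.length + 2 * out.length) + 1 ∧
      J (out.reverse ++ done) μ'.heap ∧ Walked n ρ μ μ' := by
  -- one iteration that visits a node, up to the choice of the children
  have step : ∀ (v : Set (List A)) vs segs out seg, v ∈ nodes D →
      (∀ (μ : Mem) (k : ℕ) (done : List (Set (List A))),
        Stacked ν n μ.fresh h₀ μ.heap (μ.reg 20) (seg :: vs :: segs) → J done μ.heap →
        n ≤ μ.fresh → (∀ x < 20, μ.reg x = ρ x) →
        Runs (walkLoop visit) μ k fun t μ' =>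
          t ≤ k + (cv + 13) * ((seg :: vs :: segs).length + 2 * out.length) + 1 ∧
          J (out.reverse ++ done) μ'.heap ∧ Walked n ρ μ μ') →
      ((halt v ∧ seg = []) ∨ (¬ halt v ∧ seg = ch v)) →
      ∀ (μ : Mem) (k : ℕ) (done : List (Set (List A))),
        Stacked ν n μ.fresh h₀ μ.heap (μ.reg 20) ((v :: vs) :: segs) → J done μ.heap →
        n ≤ μ.fresh → (∀ x < 20, μ.reg x = ρ x) →
        Runs (walkLoop visit) μ k fun t μ' =>
          t ≤ k + (cv + 13) * (((v :: vs) :: segs).length + 2 * (v :: out).length) + 1 ∧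
          J ((v :: out).reverse ++ done) μ'.heap ∧ Walked n ρ μ μ' := by
    intro v vs segs out seg hv ih hseg μ k done hS hj hn hρ
    obtain ⟨l, hl1, hl2, h20, ⟨h21, hchain⟩, hS⟩ := hS
    have hne : ν v [] < n := hL.node_lt _ _ (nodeLive_nil hv)
    have hsib : μ.heap (ν v []) .sibling = h₀ (ν v []) .sibling := hJA _ _ hj _ hne .sibling trivial
    refine runs_loop_step (by simp [h20]) ?_
    simp [h20, h21]
    refine (hV v hv done _ (hJ _ _ _ hj fun l hl => ?_) ?_ ?_ ?_).later ?_
    · funext f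
      simp [show l ≠ μ.fresh by omega]
    · simp; omega
    · simp
    · intro x hx
      simp [show x ≠ 20 by omega, show x ≠ 24 by omega, show x ≠ 22 by omega,
        show x ≠ 21 by omega, hρ x hx]
    rintro t μ₁ ⟨ht, hj₁, hh₁, hf₁, hr₁, hhalt, hgo⟩
    have hf₁ : μ₁.fresh = μ.fresh + 1 := by simpa using hf₁
    have h20₁ : μ₁.reg 20 = some μ.fresh := by simpa using hr₁ 20 (by omega)
    have e0 : μ₁.heap μ.fresh (.aux 0) = h₀ (ν v []) .sibling := by
      rw [hh₁ _ hn]; simp [hsib]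
    have e1 : μ₁.heap μ.fresh (.aux 1) = μ.heap l (.aux 1) := by
      rw [hh₁ _ hn]; simp
    have ee : ∀ l, n ≤ l → l < μ.fresh → μ₁.heap l = μ.heap l := by
      intro l h1 h2
      rw [hh₁ l h1]
      funext f
      simp [show l ≠ μ.fresh by omega]
    refine (ih _ _ (v :: done) ?_ (hJ _ _ _ hj₁ fun l hl => ?_) ?_ ?_).mono ?_
    · refine ⟨μ₁.fresh, by omega, by simp, by simp, ?_, μ.fresh, hn, by simp [hf₁], by simp [h20₁], ?_, ?_⟩
      · rcases hseg with ⟨hs, rfl⟩ | ⟨hs, rfl⟩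
        · simp [hhalt hs, ChainAt]
        · simpa [hgo hs] using hL.isuf v hv
      · simpa [hf₁, e0] using hchain
      · simp only [Mem.setReg_heap, Mem.setField_heap, Mem.create_heap]
        simp [hf₁, e1]
        refine hS.congr (by omega) fun l h1 h2 => ?_
        funext f
        simp [show l ≠ μ₁.fresh by omega, show l ≠ μ.fresh + 1 by omega, ee l h1 h2]
    · funext f
      simp [show l ≠ μ₁.fresh by omega]
    · simp; omega
    · intro x hx
      simp [show x ≠ 20 by omega, show x ≠ 24 by omega]
      rw [hr₁ x (by omega)]
      simp [show x ≠ 20 by omega, show x ≠ 24 by omega, show x ≠ 22 by omega,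
        show x ≠ 21 by omega, hρ x hx]
    · rintro t' μ' ⟨ht', hj', hw'⟩
      refine ⟨?_, ?_, Walked.trans (μ₂ := _) ?_ ?_ hw'⟩
      · simp only [List.length_cons] at ht' ⊢
        have : (cv + 13) * (segs.length + 1 + 2 * (out.length + 1)) =
          (cv + 13) * (segs.length + 1 + 1 + 2 * out.length) + (cv + 13) := by ring
        omega
      · simpa using hj'
      · simp; omega
      · intro l h1 h2
        funext f
        simp [show l ≠ μ₁.fresh by omega, ee l h1 h2]
  induction hW with
  | done =>
    intro μ k done _ hS hj hn hρ
    exact runs_loop_done (by simpa [Stacked] using hS)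
      ⟨by simp, by simpa using hj, le_rfl, fun _ _ _ => rfl, hρ⟩
  | @pop segs out _ ih =>
    intro μ k done hs hS hj hn hρ
    obtain ⟨l, hl1, hl2, h20, hc, hS⟩ := hS
    have hc : μ.heap l (.aux 0) = none := hc
    refine runs_loop_step (by simp [h20]) ?_
    simp [h20, hc]
    refine (ih _ _ done (by simpa using hs) (by simpa using hS) (by simpa using hj)
      (by simpa using hn) ?_).mono ?_
    · intro x hx
      simp [show x ≠ 20 by omega, show x ≠ 21 by omega, hρ x hx]
    · rintro t' μ' ⟨ht', hj', hw'⟩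
      refine ⟨?_, hj', Walked.trans (by simp) (by simp) hw'⟩
      have : (cv + 13) * (segs.length + 1 + 2 * out.length) =
          (cv + 13) * (segs.length + 2 * out.length) + (cv + 13) := by ring
      omega
  | @visitHalt v vs segs out hv _ ih =>
    intro μ k done hs
    exact step v vs segs out [] (hs v (by simp))
      (fun μ k done => ih μ k done fun u hu => hs u (by simp at hu ⊢; tauto))
      (.inl ⟨hv, rfl⟩) μ k done
  | @visit v vs segs out hv _ ih =>
    intro μ k done hs
    refine step v vs segs out (ch v) (hs v (by simp))
      (fun μ k done => ih μ k done fun u hu => ?_) (.inr ⟨hv, rfl⟩) μ k done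
    simp only [List.flatten_cons, List.mem_append] at hu
    rcases hu with hu | hu
    · exact hL.children.mem_nodes (hs v (by simp)) hu
    · exact hs u (by simp only [List.flatten_cons, List.mem_append, List.mem_cons]; tauto)

theorem walk_spec {h₀ : Heap} (hL : Layout enc T D p α ν ch n pp h₀) {ρ : ℕ → Option ℕ}
    {halt : Set (List A) → Prop} {J : List (Set (List A)) → Heap → Prop} {cv : ℕ} {visit : Cmd}
    (hJ : ∀ done h h', J done h → (∀ l < n, h' l = h l) → J done h')
    (hJA : ∀ done h, J done h → Agree n h₀ h)
    (hV : VisitSpec ν D n h₀ ρ halt J cv visit)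
    {seg : List (Set (List A))} {out : List (Set (List A))} (hW : Walk halt ch [seg] out)
    {μ : Mem} {k : ℕ} {done : List (Set (List A))} (hs : ∀ v ∈ seg, v ∈ nodes D)
    (hc : ChainAt h₀ .sibling (μ.reg 23) (seg.map fun u => ν u []))
    (hj : J done μ.heap) (hn : n ≤ μ.fresh) (hρ : ∀ x < 20, μ.reg x = ρ x) :
    Runs (walk visit) μ k fun t μ' => t ≤ k + (cv + 13) * (2 * out.length + 1) + 3 ∧
      J (out.reverse ++ done) μ'.heap ∧ Walked n ρ μ μ' := by
  simp [walk]
  refine (walkLoop_spec hL hJ hJA hV hW _ _ done (by simpa using hs) ?_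
    (hJ _ _ _ hj fun l hl => ?_) ?_ ?_).mono ?_
  · exact ⟨μ.fresh, hn, by simp, by simp, by simpa using hc, by simp [Stacked]⟩
  · funext f
    simp [show l ≠ μ.fresh by omega]
  · simp; omega
  · intro x hx
    simp [show x ≠ 20 by omega, hρ x hx]
  · rintro t' μ' ⟨ht', hj', hw'⟩
    refine ⟨?_, hj', Walked.trans (μ₂ := _) (by simp) ?_ hw'⟩
    · simp only [List.length_singleton] at ht'
      rw [add_comm (2 * out.length)]
      omega
    · intro l h1 h2
      funext f
      simp [show l ≠ μ.fresh by omega]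

end Traversal

/-! ### Redirecting failure links and outputs below a node -/

section Visits

variable {A : Type*} {enc : A → List Bool} {T D : Set (List A)} {p : List A}
    {α : List A → List Bool → ℕ} {ν : Set (List A) → List Bool → ℕ}
    {ch : Set (List A) → List (Set (List A))} {n : ℕ} {pp : Option ℕ}

/-- Redirects the failure link of the state of an unmarked trunk node (a node is marked if its field
`aux 0` is not null) to the state in register 8. The traversal stops at trunk nodes and at marked
nodes. -/
def visitFlink : Cmd := .block [
  .load 24 21 .toState, .load 25 21 (.aux 0),
  .cond (.nonNull 25) (.setNull 23)
    (.cond (.isNull 24) (.load 23 21 .isuf) (.block [.store 24 .flink 8, .setNull 23]))]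

/-- Replaces the pointer in register 8 by the one in register 9 in the field `f` of the record in
register 24. -/
def replaceField (f : Slot) : Cmd :=
  .block [.load 25 24 f, .cond (.same 25 8) (.store 24 f 9) .skip]

/-- In the fields `out` and `nextOut` of the state of a trunk node, replaces the pointer in register
8 by the one in register 9. -/
def visitOut : Cmd := .block [
  .load 24 21 .toState,
  .cond (.nonNull 24) (.block [replaceField .out, replaceField .nextOut]) .skip,
  .load 23 21 .isuf]

/-- The node is marked in the heap `h`. -/
def Marked (ν : Set (List A) → List Bool → ℕ) (h : Heap) (v : Set (List A)) : Prop :=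
  h (ν v []) (.aux 0) ≠ none

/-- The locations of the states in those nodes from `vs` for which `N` holds. -/
def stateLocs (D : Set (List A)) (α : List A → List Bool → ℕ) (vs : List (Set (List A)))
    (N : Set (List A) → Prop) : Set ℕ :=
  {l | ∃ t ∈ states D, ∃ v ∈ vs, N v ∧ t ∈ v ∧ l = α t []}

/-- Below `n`, the heap `h'` is obtained from `h` by setting the field `flink` of the records from
`X` to `val`. -/
def FlinkSet (n : ℕ) (X : Set ℕ) (val : Option ℕ) (h h' : Heap) : Prop :=
  ∀ l < n, ∀ f, (f = .flink ∧ l ∈ X → h' l f = val) ∧ (¬ (f = .flink ∧ l ∈ X) → h' l f = h l f)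

/-- Below `n`, the heap `h'` is obtained from `h` by replacing `old` by `new` in the fields `out` and
`nextOut` of the records from `X`. -/
def OutReplaced (n : ℕ) (X : Set ℕ) (old new : Option ℕ) (h h' : Heap) : Prop :=
  ∀ l < n, ∀ f, ((f = .out ∨ f = .nextOut) ∧ l ∈ X ∧ h l f = old → h' l f = new) ∧
    (¬ ((f = .out ∨ f = .nextOut) ∧ l ∈ X ∧ h l f = old) → h' l f = h l f)

theorem FlinkSet.agree {X : Set ℕ} {val : Option ℕ} {h h' : Heap} (H : FlinkSet n X val h h') :
    Agree n h h' := by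
  intro l hl f hf
  refine (H l hl f).2 ?_
  rintro ⟨rfl, -⟩
  exact hf

theorem OutReplaced.agree {X : Set ℕ} {old new : Option ℕ} {h h' : Heap}
    (H : OutReplaced n X old new h h') : Agree n h h' := by
  intro l hl f hf
  refine (H l hl f).2 ?_
  rintro ⟨rfl | rfl, -⟩ <;> exact hf

theorem mem_stateLocs_cons {v : Set (List A)} {vs : List (Set (List A))} {N : Set (List A) → Prop}
    {l : ℕ} : l ∈ stateLocs D α (v :: vs) N ↔
      (∃ t ∈ states D, t ∈ v ∧ N v ∧ l = α t []) ∨ l ∈ stateLocs D α vs N := by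
  simp only [stateLocs, Set.mem_ofPred_eq, List.mem_cons]
  constructor
  · rintro ⟨t, ht, u, rfl | hu, hN, htu, rfl⟩
    · exact .inl ⟨t, ht, htu, hN, rfl⟩
    · exact .inr ⟨t, ht, u, hu, hN, htu, rfl⟩
  · rintro (⟨t, ht, htv, hN, rfl⟩ | ⟨t, ht, u, hu, hN, htu, rfl⟩)
    · exact ⟨t, ht, v, .inl rfl, hN, htv, rfl⟩
    · exact ⟨t, ht, u, .inr hu, hN, htu, rfl⟩

theorem node_state_unique {v : Set (List A)} (hv : v ∈ nodes D) {s t : List A} (hs : s ∈ states D)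
    (ht : t ∈ states D) (hsv : s ∈ v) (htv : t ∈ v) : s = t :=
  state_unique hs ht ((nodeOcc_of_mem hv hsv).symm.trans (nodeOcc_of_mem hv htv))

theorem visitFlink_spec {h₀ hb : Heap} (hL : Layout enc T D p α ν ch n pp h₀)
    (hDT : states D ⊆ states T) (hA : Agree n h₀ hb) {ρ : ℕ → Option ℕ} :
    VisitSpec ν D n h₀ ρ (fun v => Trunk D v ∨ Marked ν hb v)
      (fun done h => FlinkSet n (stateLocs D α done fun u => ¬ Marked ν hb u) (ρ 8) hb h)
      6 visitFlink := by
  intro v hv done μ hJ hn h21 hρ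
  have hvn : ν v [] < n := hL.node_lt _ _ (nodeLive_nil hv)
  have hread : ∀ f : Slot, f.structural → μ.heap (ν v []) f = h₀ (ν v []) f := fun f hf =>
    (hJ.agree _ hvn f hf).trans (hA _ hvn f hf)
  have haux : μ.heap (ν v []) (.aux 0) = hb (ν v []) (.aux 0) := (hJ _ hvn _).2 (by simp)
  have h8 := hρ 8 (by omega)
  by_cases hm : Marked ν hb v
  · have hm' : hb (ν v []) (.aux 0) ≠ none := hm
    simp [visitFlink, h21, haux, hm']
    refine ⟨fun l hl f => ?_, fun x hx => ?_, fun _ h => absurd hm h⟩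
    · rw [mem_stateLocs_cons]
      simpa [hm] using hJ l hl f
    · simp [show x ≠ 23 by omega, show x ≠ 24 by omega, show x ≠ 25 by omega]
  · have hm' : hb (ν v []) (.aux 0) = none := by simpa [Marked] using hm
    by_cases ht : Trunk D v
    · obtain ⟨t, htD, htv⟩ := ht
      have htr : μ.heap (ν v []) .toState = some (α t []) := by
        rw [hread .toState trivial]; exact hL.trunk v hv t htD htv
      simp [visitFlink, h21, haux, hm', htr]
      refine ⟨fun l hl f => ?_, fun l hl => ?_, fun x hx => ?_, fun h _ => absurd ⟨t, htD, htv⟩ h⟩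
      · rw [mem_stateLocs_cons]
        have : (∃ t' ∈ states D, t' ∈ v ∧ ¬ Marked ν hb v ∧ l = α t' []) ↔ l = α t [] := by
          constructor
          · rintro ⟨t', h1, h2, -, rfl⟩
            rw [node_state_unique hv h1 htD h2 htv]
          · rintro rfl
            exact ⟨t, htD, htv, hm, rfl⟩
        rw [this]
        have := hJ l hl f
        by_cases h1 : l = α t [] <;> by_cases h2 : f = .flink <;>
          simp_all
      · have hlt := hL.state_lt _ _ (stateLive_nil (enc := enc) (hDT htD))
        funext f
        simp [show l ≠ α t [] by omega]
      · simp [show x ≠ 23 by omega, show x ≠ 24 by omega, show x ≠ 25 by omega]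
    · have htr : μ.heap (ν v []) .toState = none := by
        rw [hread .toState trivial]
        exact hL.non_trunk v hv fun s hs hsv => ht ⟨s, hs, hsv⟩
      simp [visitFlink, h21, haux, hm', htr]
      refine ⟨fun l hl f => ?_, fun x hx => ?_, ?_, fun _ _ => hread .isuf trivial⟩
      · have : ¬ ∃ t ∈ states D, t ∈ v ∧ ¬ Marked ν hb v ∧ l = α t [] :=
          fun ⟨t, h1, h2, _⟩ => ht ⟨t, h1, h2⟩
        rw [mem_stateLocs_cons, or_iff_right this]
        exact hJ l hl f
      · simp [show x ≠ 23 by omega, show x ≠ 24 by omega, show x ≠ 25 by omega]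
      · rintro (h | h)
        · exact absurd h ht
        · exact absurd h hm

theorem replaceField_spec {f : Slot} {a k : ℕ} {μ : Mem} {Q : ℕ → Mem → Prop}
    (h24 : μ.reg 24 = some a)
    (hQ : ∀ k' μ', k' ≤ k + 3 →
      (∀ l g, l ≠ a ∨ g ≠ f ∨ μ.heap a f ≠ μ.reg 8 → μ'.heap l g = μ.heap l g) →
      (μ.heap a f = μ.reg 8 → μ'.heap a f = μ.reg 9) → μ'.fresh = μ.fresh →
      (∀ x ≠ 25, μ'.reg x = μ.reg x) → Q k' μ') : Runs (replaceField f) μ k Q := by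
  by_cases h : μ.heap a f = μ.reg 8
  · simp [replaceField, h24, h]
    refine hQ _ _ (by omega) (fun l g hlg => ?_) (by simp) rfl fun x hx => by simp [hx]
    have : ¬ (l = a ∧ g = f) := by tauto
    simp [this]
  · simp [replaceField, h24, h]
    exact hQ _ _ (by omega) (fun _ _ _ => rfl) (by simp [h]) rfl fun x hx => by simp [hx]

theorem visitOut_spec {h₀ hb : Heap} (hL : Layout enc T D p α ν ch n pp h₀)
    (hDT : states D ⊆ states T) (hA : Agree n h₀ hb) {ρ : ℕ → Option ℕ} :
    VisitSpec ν D n h₀ ρ (fun _ => False)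
      (fun done h => OutReplaced n (stateLocs D α done fun _ => True) (ρ 8) (ρ 9) hb h)
      9 visitOut := by
  classical
  intro v hv done μ hJ hn h21 hρ
  have hvn : ν v [] < n := hL.node_lt _ _ (nodeLive_nil hv)
  have hread : ∀ f : Slot, f.structural → μ.heap (ν v []) f = h₀ (ν v []) f := fun f hf =>
    (hJ.agree _ hvn f hf).trans (hA _ hvn f hf)
  have h8 := hρ 8 (by omega)
  have h9 := hρ 9 (by omega)
  by_cases ht : Trunk D v
  · obtain ⟨t, htD, htv⟩ := ht
    have hlt := hL.state_lt _ _ (stateLive_nil (enc := enc) (hDT htD))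
    have hlne : ∀ v ∈ nodes D, α t [] ≠ ν v [] := fun v hv =>
      hL.separated _ _ _ _ (stateLive_nil (hDT htD)) (nodeLive_nil hv)
    have htr : μ.heap (ν v []) .toState = some (α t []) := by
      rw [hread .toState trivial]; exact hL.trunk v hv t htD htv
    have hloc : ∀ l, (∃ t' ∈ states D, t' ∈ v ∧ True ∧ l = α t' []) ↔ l = α t [] := by
      intro l
      constructor
      · rintro ⟨t', h1, h2, -, rfl⟩
        rw [node_state_unique hv h1 htD h2 htv]
      · rintro rfl
        exact ⟨t, htD, htv, trivial, rfl⟩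
    simp only [visitOut, runs_block_cons, runs_load, h21, Option.some.injEq, exists_eq_left', htr,
      runs_cond, holds_nonNull, Mem.setReg_reg, if_true, ne_eq, reduceCtorEq, not_false_eq_true,
      true_imp_iff, not_true_eq_false, false_imp_iff, and_true, runs_block_one]
    refine replaceField_spec (a := α t []) (by simp) fun k₁ μ₁ hk₁ ho₁ ho₁' hf₁ hr₁ => ?_
    refine replaceField_spec (a := α t []) (by simp [hr₁]) fun k₂ μ₂ hk₂ ho₂ ho₂' hf₂ hr₂ => ?_
    simp only [Mem.setReg_heap, Mem.setReg_reg] at ho₁ ho₁' ho₂ ho₂'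
    have e8 : μ₁.reg 8 = ρ 8 := by simp [hr₁, h8]
    have e9 : μ₁.reg 9 = ρ 9 := by simp [hr₁, h9]
    simp [h8, h9] at ho₁ ho₁'
    rw [e8] at ho₂ ho₂'
    rw [e9] at ho₂'
    have e1 : μ₁.heap (α t []) .nextOut = μ.heap (α t []) .nextOut := ho₁ _ _ (.inr (.inl (by simp)))
    rw [e1] at ho₂ ho₂'
    have e2 : μ₂.heap (α t []) .out = μ₁.heap (α t []) .out := ho₂ _ _ (.inr (.inl (by simp)))
    refine ⟨ν v [], by rw [hr₂ 21 (by omega), hr₁ 21 (by omega)]; simp [h21], ?_, ?_, ?_, ?_, ?_, ?_⟩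
    · omega
    · intro l hl f
      rw [mem_stateLocs_cons, hloc]
      simp only [Mem.setReg_heap]
      have hJl := hJ l hl f
      by_cases h1 : l = α t []
      · subst h1
        have hval : ((f = .out ∨ f = .nextOut) ∧ μ.heap (α t []) f = ρ 8 →
              μ₂.heap (α t []) f = ρ 9) ∧
            (¬ ((f = .out ∨ f = .nextOut) ∧ μ.heap (α t []) f = ρ 8) →
              μ₂.heap (α t []) f = μ.heap (α t []) f) := by
          by_cases h2 : f = .out
          · subst h2
            rw [e2]
            exact ⟨fun h => ho₁' h.2, fun h => ho₁ _ _ (.inr (.inr fun h' => h ⟨.inl rfl, h'⟩))⟩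
          · by_cases h3 : f = .nextOut
            · subst h3
              exact ⟨fun h => ho₂' h.2, fun h =>
                (ho₂ _ _ (.inr (.inr fun h' => h ⟨.inr rfl, h'⟩))).trans e1⟩
            · exact ⟨fun h => absurd h.1 (by simp [h2, h3]), fun _ =>
                (ho₂ _ _ (.inr (.inl h3))).trans (ho₁ _ _ (.inr (.inl h2)))⟩
        by_cases hf : f = .out ∨ f = .nextOut
        · simp only [hf, true_and, true_or] at hval hJl ⊢
          by_cases hX : α t [] ∈ stateLocs D α done fun _ => True
          · simp only [hX, true_and] at hJl
            by_cases hold : hb (α t []) f = ρ 8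
            · refine ⟨fun _ => ?_, fun h => absurd hold h⟩
              by_cases h9 : μ.heap (α t []) f = ρ 8
              · exact hval.1 h9
              · rw [hval.2 h9, hJl.1 hold]
            · refine ⟨fun h => absurd h hold, fun _ => ?_⟩
              rw [hval.2 (by rwa [hJl.2 hold]), hJl.2 hold]
          · simp only [hX, false_and, not_false_eq_true, true_imp_iff] at hJl
            rw [← hJl.2]
            exact hval
        · simp only [hf, false_and, not_false_eq_true, true_imp_iff, false_imp_iff, true_and]
            at hval hJl ⊢
          rw [hval, hJl]
      · rw [ho₂ _ _ (.inl h1), ho₁ _ _ (.inl h1)]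
        simpa [h1] using hJl
    · intro l hl
      funext f
      simp only [Mem.setReg_heap]
      rw [ho₂ _ _ (.inl (by omega)), ho₁ _ _ (.inl (by omega))]
    · simp [hf₁, hf₂]
    · intro x hx
      simp [show x ≠ 23 by omega, show x ≠ 24 by omega, hr₂ x (by omega), hr₁ x (by omega)]
    · simp
      rw [ho₂ _ _ (.inl (hlne v hv).symm), ho₁ _ _ (.inl (hlne v hv).symm)]
      exact hread .isuf trivial
  · have htr : μ.heap (ν v []) .toState = none := by
      rw [hread .toState trivial]
      exact hL.non_trunk v hv fun s hs hsv => ht ⟨s, hs, hsv⟩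
    simp [visitOut, h21, htr]
    refine ⟨fun l hl f => ?_, fun x hx => ?_, hread .isuf trivial⟩
    · have : ¬ ∃ t ∈ states D, t ∈ v ∧ True ∧ l = α t [] :=
        fun ⟨t, h1, h2, _⟩ => ht ⟨t, h1, h2⟩
      rw [mem_stateLocs_cons, or_iff_right this]
      exact hJ l hl f
    · simp [show x ≠ 23 by omega, show x ≠ 24 by omega]

end Visits

/-! ### The states reached by the traversals -/

section Reach

variable {A : Type*} {D : Set (List A)} {halt : Set (List A) → Prop}
  {ch : Set (List A) → List (Set (List A))}

theorem occ_ssubset {s t : List A} (hs : s ∈ states D) (h : s <:+ t) (hne : s ≠ t) :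
    occ D t ⊂ occ D s :=
  ⟨occ_anti h, fun h' => hne (h.eq_of_length_le (h' (self_mem_occ hs)).2.length_le)⟩

theorem length_lt_of_suffix {s t : List A} (h : s <:+ t) (hne : s ≠ t) : s.length < t.length :=
  lt_of_le_of_ne h.length_le fun h' => hne (h.eq_of_length h')

/-- Which states are in the nodes visited by a traversal. -/
theorem Walk.exists_mem_iff (hch : IsChildren D ch) {segs : List (List (Set (List A)))}
    {out : List (Set (List A))} (h : Walk halt ch segs out)
    (hs : ∀ v ∈ segs.flatten, v ∈ nodes D) {N : Set (List A) → Prop} {t : List A}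
    (ht : t ∈ states D) :
    (∃ v ∈ out, N v ∧ t ∈ v) ↔ N (cls D t) ∧ ∃ v ∈ segs.flatten, occ D t ⊆ nodeOcc D v ∧
      ∀ w ∈ nodes D, occ D t ⊂ nodeOcc D w → nodeOcc D w ⊆ nodeOcc D v → ¬ halt w := by
  have hts := mem_substr_of_mem_states ht
  rw [← nodeOcc_cls hts]
  constructor
  · rintro ⟨v, hv, hN, htv⟩
    have hvn := ((h.mem_iff hch hs v).1 hv).1
    have : v = cls D t := (eq_cls_of_mem hvn htv).2
    subst this
    exact ⟨hN, ((h.mem_iff hch hs _).1 hv).2⟩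
  · rintro ⟨hN, h'⟩
    exact ⟨_, (h.mem_iff hch hs _).2 ⟨cls_mem_nodes hts, h'⟩, hN, self_mem_cls hts⟩

theorem Walk.exists_mem_iff_suffix (hch : IsChildren D ch) {p : List A} (hp : p ∈ substr D)
    {out : List (Set (List A))} (h : Walk (fun _ => False) ch [[cls D p]] out) {t : List A}
    (ht : t ∈ states D) : (∃ v ∈ out, True ∧ t ∈ v) ↔ p <:+ t := by
  rw [h.exists_mem_iff hch (N := fun _ => True) (by simpa using cls_mem_nodes hp) ht]
  simp [nodeOcc_cls hp, occ_subset_iff_of_state ht]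

/-- The first states strictly below the node of a state `s` are those with failure link `s`. -/
theorem Walk.exists_mem_iff_flink (hch : IsChildren D ch) {s : List A} (hs : s ∈ states D)
    (hhalt : ∀ v ∈ nodes D, (halt v ↔ Trunk D v)) {out : List (Set (List A))}
    (h : Walk halt ch [ch (cls D s)] out) {t : List A} (ht : t ∈ states D) :
    (∃ v ∈ out, True ∧ t ∈ v) ↔ psuf (states D) t = some s := by
  have hss := mem_substr_of_mem_states hs
  have hsn := cls_mem_nodes hss
  have hts := mem_substr_of_mem_states ht
  have hc := (hch _ hsn).2
  rw [h.exists_mem_iff hch (N := fun _ => True)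
    (by simpa using fun v hv => hch.mem_nodes hsn hv) ht]
  simp only [true_and, List.flatten_cons, List.flatten_nil, List.append_nil, hc]
  rw [psuf_eq_some_iff]
  constructor
  · rintro ⟨c, hcs, htc, hw⟩
    have hlt : occ D t ⊂ occ D s := by
      have := hcs.ssubset
      rw [nodeOcc_cls hss] at this
      exact htc.trans_ssubset this
    have hst : s <:+ t := (occ_subset_iff_of_state ht).1 hlt.1
    refine ⟨hs, ⟨hst, fun h => hlt.ne (by rw [h])⟩, fun u hu hut hne => ?_⟩
    by_contra hlen
    have hsu : s <:+ u := suffix_of_suffix_of_length_le hst hut (by omega)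
    have hsne : s ≠ u := by rintro rfl; exact hlen le_rfl
    have hus := mem_substr_of_mem_states hu
    obtain ⟨c', hc', huc⟩ := exists_child (cls_mem_nodes hus) hsn
      (by rw [nodeOcc_cls hus, nodeOcc_cls hss]; exact occ_ssubset hs hsu hsne)
    rw [nodeOcc_cls hus] at huc
    have h1 := occ_ssubset hu hut hne
    rw [children_disjoint hc' hcs (huc (h1.1 (self_mem_occ ht))) (htc (self_mem_occ ht))] at huc
    exact hw _ (cls_mem_nodes hus) (by rwa [nodeOcc_cls hus]) (by rwa [nodeOcc_cls hus])
      ((hhalt _ (cls_mem_nodes hus)).2 ⟨u, hu, self_mem_cls hus⟩)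
  · rintro ⟨-, ⟨hst, hne⟩, hmax⟩
    obtain ⟨c, hcs, htc⟩ := exists_child (cls_mem_nodes hts) hsn
      (by rw [nodeOcc_cls hts, nodeOcc_cls hss]; exact occ_ssubset hs hst hne)
    rw [nodeOcc_cls hts] at htc
    refine ⟨c, hcs, htc, ?_⟩
    intro w hw h1 h2 hsw
    obtain ⟨u, hu, huw⟩ := (hhalt w hw).1 hsw
    rw [nodeOcc_of_mem hw huw] at h1 h2
    have h3 := h2.trans_ssubset hcs.ssubset
    rw [nodeOcc_cls hss] at h3
    have hsu := (occ_subset_iff_of_state hu).1 h3.1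
    have := length_lt_of_suffix hsu fun h => h3.ne (by rw [h])
    have := hmax u hu ((occ_subset_iff_of_state ht).1 h1.1) fun h => h1.ne (by rw [h])
    omega

/-- Let the nodes of the longer new states from `R` be marked. The unmarked first states below the
node of a new state `s` are those for which `s` becomes the failure link. -/
theorem Walk.exists_mem_iff_new (hch : IsChildren D ch) {s : List A} (hs : s ∈ substr D)
    (hsD : s ∉ states D) {R : Set (List A)} (hR : ∀ x ∈ R, x ∉ states D ∧ s.length < x.length)
    {M : Set (List A) → Prop} (hM : ∀ v ∈ nodes D, M v ↔ ∃ x ∈ R, x ∈ v) {out : List (Set (List A))}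
    (h : Walk (fun v => Trunk D v ∨ M v) ch [[cls D s]] out) {t : List A} (ht : t ∈ states D) :
    (∃ v ∈ out, ¬ M v ∧ t ∈ v) ↔
      s <:+ t ∧ ∀ u ∈ states D ∪ R, u <:+ t → u ≠ t → u.length ≤ s.length := by
  have hsn := cls_mem_nodes hs
  have hts := mem_substr_of_mem_states ht
  rw [h.exists_mem_iff hch (N := fun v => ¬ M v) (by simpa using hsn) ht]
  simp only [List.flatten_cons, List.flatten_nil, List.append_nil, List.mem_singleton,
    exists_eq_left, nodeOcc_cls hs, occ_subset_iff_of_state ht]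
  constructor
  · rintro ⟨hMt, hst, hw⟩
    refine ⟨hst, fun u hu hut hne => ?_⟩
    by_contra hlen
    have hsu : s <:+ u := suffix_of_suffix_of_length_le hst hut (by omega)
    have hus := mem_substr_of_suffix hut hts
    have hun := cls_mem_nodes hus
    have h1 : nodeOcc D (cls D u) ⊆ occ D s := by rw [nodeOcc_cls hus]; exact occ_anti hsu
    rcases hu with hu | hu
    · refine hw _ hun ?_ h1 (.inl ⟨u, hu, self_mem_cls hus⟩)
      rw [nodeOcc_cls hus]; exact occ_ssubset hu hut hne
    · have hMu : M (cls D u) := (hM _ hun).2 ⟨u, hu, self_mem_cls hus⟩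
      by_cases heq : cls D t = cls D u
      · rw [heq] at hMt; exact hMt hMu
      · refine hw _ hun ?_ h1 (.inr hMu)
        rw [nodeOcc_cls hus]
        exact (occ_anti hut).ssubset_of_ne fun h => heq ((cls_eq_cls_iff hts hus).2 h)
  · rintro ⟨hst, hmax⟩
    have key : ∀ w ∈ nodes D, occ D t ⊆ nodeOcc D w → ¬ M w := by
      intro w hw h1 hMw
      obtain ⟨x, hx, hxw⟩ := (hM w hw).1 hMw
      rw [nodeOcc_of_mem hw hxw] at h1
      have := hmax x (.inr hx) ((occ_subset_iff_of_state ht).1 h1)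
        (by rintro rfl; exact (hR x hx).1 ht)
      have := (hR x hx).2
      omega
    refine ⟨key _ (cls_mem_nodes hts) (nodeOcc_cls hts).ge, hst, fun w hw h1 h2 => ?_⟩
    rintro (⟨u, hu, huw⟩ | hMw)
    · rw [nodeOcc_of_mem hw huw] at h1 h2
      have hsu := (occ_subset_iff_of_state hu).1 h2
      have := hmax u (.inl hu) ((occ_subset_iff_of_state ht).1 h1.1) fun h => h1.ne (by rw [h])
      have := hsu.eq_of_length_le this
      exact hsD (this ▸ hu)
    · exact key w hw h1.1 hMw

theorem Walk.mem_nodes (hch : IsChildren D ch) {segs : List (List (Set (List A)))}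
    {out : List (Set (List A))} (h : Walk halt ch segs out)
    (hs : ∀ v ∈ segs.flatten, v ∈ nodes D) : ∀ v ∈ out, v ∈ nodes D :=
  fun v hv => ((h.mem_iff hch hs v).1 hv).1

theorem Walk.nodup_children (hch : IsChildren D ch) {v : Set (List A)} (hv : v ∈ nodes D)
    {out : List (Set (List A))} (h : Walk halt ch [ch v] out) : out.Nodup := by
  refine h.nodup hch (by simpa using fun u hu => hch.mem_nodes hv hu) ?_
  simp only [List.flatten_cons, List.flatten_nil, List.append_nil]
  refine (hch v hv).1.pairwise_of_forall_ne fun u hu w hw hne => ?_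
  refine Set.disjoint_left.2 fun t h1 h2 => hne ?_
  exact children_disjoint (((hch v hv).2 u).1 hu) (((hch v hv).2 w).1 hw) h1 h2

theorem Walk.nodup_singleton (hch : IsChildren D ch) {v : Set (List A)} (hv : v ∈ nodes D)
    {out : List (Set (List A))} (h : Walk halt ch [[v]] out) : out.Nodup :=
  h.nodup hch (by simpa using hv) (by simp)

open Classical in
/-- The visited trunk nodes with property `N` are paid for by their states. -/
theorem countP_trunk_le (hD : D.Finite) {out : List (Set (List A))} (hn : ∀ v ∈ out, v ∈ nodes D)
    (hd : out.Nodup) (N : Set (List A) → Prop) :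
    out.countP (fun v => Trunk D v ∧ N v) ≤
      {t | t ∈ states D ∧ ∃ v ∈ out, N v ∧ t ∈ v}.ncard := by
  rw [List.countP_eq_length_filter, ← List.toFinset_card_of_nodup (hd.filter _),
    ← Set.ncard_coe_finset]
  have hfin : {t | t ∈ states D ∧ ∃ v ∈ out, N v ∧ t ∈ v}.Finite :=
    (states_finite hD).subset fun t ht => ht.1
  -- a trunk node is the class of its state
  refine le_trans (Set.ncard_le_ncard (t := cls D '' {t | t ∈ states D ∧ ∃ v ∈ out, N v ∧ t ∈ v})
    ?_ (hfin.image _)) (Set.ncard_image_le hfin)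
  intro v hv
  simp only [List.coe_toFinset, List.mem_filter, decide_eq_true_eq, Set.mem_ofPred_eq] at hv
  obtain ⟨hv, ⟨t, ht, htv⟩, hN⟩ := hv
  exact ⟨t, ⟨ht, v, hv, hN, htv⟩, (eq_cls_of_mem (hn v hv) htv).2.symm⟩

open Classical in
theorem psuf_insert_eq {P : Set (List A)} {s t : List A} (hs : s ∉ P) :
    psuf (insert s P) t =
      if (s <:+ t ∧ s ≠ t) ∧ ∀ u ∈ P, u <:+ t → u ≠ t → u.length ≤ s.length then some s
      else psuf P t := by
  split_ifs with h
  · rw [psuf_eq_some_iff]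
    refine ⟨Set.mem_insert _ _, h.1, ?_⟩
    rintro w (rfl | hw) h1 h2
    · exact le_rfl
    · exact h.2 w hw h1 h2
  · by_cases hst : s <:+ t ∧ s ≠ t
    · rw [psuf_insert hs hst.1 hst.2, if_neg]
      intro heq
      refine h ⟨hst, fun u hu h1 h2 => ?_⟩
      cases hp : psuf P t with
      | none => exact absurd (psuf_eq_none_iff.1 hp u hu h1) h2
      | some w =>
        rw [heq] at hp
        exact ((psuf_eq_some_iff.1 (heq.trans hp)).2.2 u hu h1 h2).trans
          (lsuf_suffix hp).length_le
    · exact psuf_insert_of_not_suffix hst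

end Reach

/-! ### Extending the automaton -/

section Trie

variable {A : Type*} {enc : A → List Bool}

/-- A field that belongs to the search trees. -/
def Slot.isTree : Slot → Prop
  | .zero | .one | .dest => True
  | _ => False

/-- `Step enc x f y`: in the search trees of the states, the field `f` leads from the record `x` to
the record `y`. -/
inductive Step (enc : A → List Bool) :
    List A × List Bool → Slot → List A × List Bool → Prop
  | bit (s : List A) (b : List Bool) (i : Bool) : Step enc (s, b) (bitSlot i) (s, b ++ [i])
  | dest (s : List A) (c : A) : Step enc (s, enc c) .dest (s ++ [c], [])

theorem Step.isTree {x y : List A × List Bool} {f : Slot} (h : Step enc x f y) : f.isTree := by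
  cases h with
  | bit s b i => cases i <;> trivial
  | dest => trivial

theorem bitSlot_ne_dest (i : Bool) : bitSlot i ≠ .dest := by cases i <;> simp [bitSlot]

theorem bitSlot_injective {i j : Bool} (h : bitSlot i = bitSlot j) : i = j := by
  cases i <;> cases j <;> simp_all [bitSlot]

theorem Step.target_unique (hE : Function.Injective enc) {x y y' : List A × List Bool} {f : Slot}
    (h : Step enc x f y) (h' : Step enc x f y') : y = y' := by
  obtain ⟨s, b⟩ := x
  generalize hx : (s, b) = x at h'
  cases h with
  | bit _ _ i =>
    generalize hf : bitSlot i = f at h'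
    cases h' with
    | bit _ _ j =>
      cases hx
      rw [bitSlot_injective hf]
    | dest => exact absurd hf (bitSlot_ne_dest i)
  | dest _ c =>
    generalize hf : Slot.dest = f at h'
    cases h' with
    | bit _ _ j => exact absurd hf.symm (bitSlot_ne_dest j)
    | dest _ c' =>
      simp only [Prod.mk.injEq] at hx
      rw [hx.1, hE hx.2]

theorem Step.source_unique {x x' y : List A × List Bool} {f f' : Slot}
    (h : Step enc x f y) (h' : Step enc x' f' y) : x = x' ∧ f = f' := by
  cases h with
  | bit s b i =>
    generalize hy : (s, b ++ [i]) = y at h'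
    cases h' with
    | bit s' b' j =>
      simp only [Prod.mk.injEq] at hy
      obtain ⟨rfl, hy⟩ := hy
      obtain ⟨rfl, hij⟩ := List.append_inj' hy rfl
      simp at hij
      simp [hij]
    | dest => simp at hy
  | dest s c =>
    generalize hy : (s ++ [c], ([] : List Bool)) = y at h'
    cases h' with
    | bit s' b' j => simp at hy
    | dest s' c' =>
      simp only [Prod.mk.injEq, and_true] at hy
      obtain ⟨rfl, hij⟩ := List.append_inj' hy rfl
      simp at hij
      simp [hij]

/-- The records from `P`, at the locations `α` below `n`, are linked as in the search trees. -/
structure Trie (enc : A → List Bool) (P : Set (List A × List Bool)) (h : Heap)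
    (α : List A × List Bool → ℕ) (n : ℕ) : Prop where
  lt : ∀ x ∈ P, α x < n
  inj : ∀ x ∈ P, ∀ y ∈ P, α x = α y → x = y
  closed : ∀ x f y, Step enc x f y → y ∈ P → x ∈ P
  link : ∀ x f y, Step enc x f y → y ∈ P → h (α x) f = some (α y)
  null : ∀ x ∈ P, ∀ f : Slot, f.isTree → (∀ y, Step enc x f y → y ∉ P) → h (α x) f = none

/-- The records of the automaton of `D`. -/
def liveSet (enc : A → List Bool) (D : Set (List A)) : Set (List A × List Bool) :=
  {x | stateLive enc D x.1 x.2}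

theorem mem_liveSet {D : Set (List A)} {s : List A} {b : List Bool} :
    (s, b) ∈ liveSet enc D ↔
      s ∈ states D ∧ (b = [] ∨ ∃ c, s ++ [c] ∈ states D ∧ b <+: enc c) := by
  simp only [liveSet, stateLive, TreeLive, IsGoto, Set.mem_ofPred_eq]
  constructor
  · rintro ⟨h, rfl | ⟨c, w, ⟨_, hw, rfl⟩, hb⟩⟩
    · exact ⟨h, .inl rfl⟩
    · exact ⟨h, .inr ⟨c, hw, hb⟩⟩
  · rintro ⟨h, rfl | ⟨c, hw, hb⟩⟩
    · exact ⟨h, .inl rfl⟩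
    · exact ⟨h, .inr ⟨c, _, ⟨h, hw, rfl⟩, hb⟩⟩

theorem mem_liveSet_nil {D : Set (List A)} {s : List A} :
    (s, []) ∈ liveSet enc D ↔ s ∈ states D := by simp [mem_liveSet]

theorem liveSet_closed {D : Set (List A)} {x y : List A × List Bool} {f : Slot}
    (h : Step enc x f y) (hy : y ∈ liveSet enc D) : x ∈ liveSet enc D := by
  cases h with
  | bit s b i =>
    rw [mem_liveSet] at hy ⊢
    obtain ⟨hs, h | ⟨c, hc, hb⟩⟩ := hy
    · simp at h
    · exact ⟨hs, .inr ⟨c, hc, (List.prefix_append _ _).trans hb⟩⟩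
  | dest s c =>
    rw [mem_liveSet_nil] at hy
    rw [mem_liveSet]
    exact ⟨mem_states_of_prefix ⟨[c], rfl⟩ hy, .inr ⟨c, hy, List.prefix_rfl⟩⟩

theorem trie_iff (hE : Function.Injective enc) {D : Set (List A)} {h : Heap}
    {α : List A → List Bool → ℕ} {n : ℕ} :
    Trie enc (liveSet enc D) h (fun x => α x.1 x.2) n ↔
      (∀ s b, stateLive enc D s b → α s b < n) ∧
      (∀ s b s' b', stateLive enc D s b → stateLive enc D s' b' → α s b = α s' b' →
        s = s' ∧ b = b') ∧
      ∀ s ∈ states D, TreeStored enc (IsGoto D) α h s := by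
  constructor
  · intro H
    refine ⟨fun s b hl => H.lt (s, b) hl, fun s b s' b' hl hl' he => ?_, fun s hs => ?_⟩
    · simpa using H.inj (s, b) hl (s', b') hl' he
    · exact {
        zero := fun b h1 h2 => H.link _ _ _ (.bit s b false) ⟨hs, h2⟩
        zero_null := fun b h1 h2 => H.null (s, b) ⟨hs, h1⟩ .zero trivial fun y hy hy' => by
          rw [← Step.target_unique hE (.bit s b false) hy] at hy'
          exact h2 hy'.2
        one := fun b h1 h2 => H.link _ _ _ (.bit s b true) ⟨hs, h2⟩
        one_null := fun b h1 h2 => H.null (s, b) ⟨hs, h1⟩ .one trivial fun y hy hy' => by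
          rw [← Step.target_unique hE (.bit s b true) hy] at hy'
          exact h2 hy'.2
        dest := by
          rintro c w ⟨_, hw, rfl⟩
          exact H.link _ _ _ (.dest s c) (mem_liveSet_nil.2 hw)
        dest_null := fun b h1 h2 => H.null (s, b) ⟨hs, h1⟩ .dest trivial fun y hy hy' => by
          generalize hx : (s, b) = x at hy
          generalize hf : Slot.dest = f at hy
          cases hy with
          | bit _ _ j => exact bitSlot_ne_dest j hf.symm
          | dest s' c =>
            simp only [Prod.mk.injEq] at hx
            obtain ⟨rfl, rfl⟩ := hx
            exact h2 c _ ⟨hs, mem_liveSet_nil.1 hy', rfl⟩ rfl }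
  · rintro ⟨h1, h2, h3⟩
    refine ⟨fun x hx => h1 _ _ hx, fun x hx y hy he => ?_, fun _ _ _ => liveSet_closed, ?_, ?_⟩
    · obtain ⟨h4, h5⟩ := h2 _ _ _ _ hx hy he
      exact Prod.ext h4 h5
    · intro x f y hst hy
      have hx := liveSet_closed hst hy
      cases hst with
      | bit s b i =>
        cases i
        · exact (h3 s hx.1).zero b hx.2 hy.2
        · exact (h3 s hx.1).one b hx.2 hy.2
      | dest s c => exact (h3 s hx.1).dest c _ ⟨hx.1, hy.1, rfl⟩
    · rintro ⟨s, b⟩ hx f hf hn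
      have hbit : ∀ i, ¬ TreeLive enc (IsGoto D) s (b ++ [i]) → True := fun _ _ => trivial
      match f, hf with
      | .zero, _ => exact (h3 s hx.1).zero_null b hx.2 fun h => hn _ (.bit s b false) ⟨hx.1, h⟩
      | .one, _ => exact (h3 s hx.1).one_null b hx.2 fun h => hn _ (.bit s b true) ⟨hx.1, h⟩
      | .dest, _ =>
        refine (h3 s hx.1).dest_null b hx.2 ?_
        rintro c w ⟨_, hw, rfl⟩ rfl
        exact hn _ (.dest s c) (mem_liveSet_nil.2 hw)

/-- The memory `μ` with the records `P` has been obtained from the memory `μ₀` with the records `P₀`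
by adding records. -/
structure Grown (enc : A → List Bool) (P₀ : Set (List A × List Bool))
    (α₀ : List A × List Bool → ℕ) (μ₀ : Mem) (P : Set (List A × List Bool))
    (α : List A × List Bool → ℕ) (μ : Mem) : Prop where
  trie : Trie enc P μ.heap α μ.fresh
  subset : P₀ ⊆ P
  addr : ∀ x ∈ P₀, α x = α₀ x
  fresh : μ₀.fresh ≤ μ.fresh
  old : ∀ l < μ₀.fresh, ∀ f : Slot, ¬ f.isTree ∨ (∀ x ∈ P₀, l ≠ α₀ x) → μ.heap l f = μ₀.heap l f
  new : ∀ l, μ₀.fresh ≤ l → l < μ.fresh → ∀ f : Slot, ¬ f.isTree → μ.heap l f = none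
  new_addr : ∀ x ∈ P, x ∉ P₀ → μ₀.fresh ≤ α x

theorem Grown.onlyRegs {P₀ P : Set (List A × List Bool)} {α₀ α : List A × List Bool → ℕ}
    {μ₀ μ μ' : Mem} {L : List ℕ} (H : Grown enc P₀ α₀ μ₀ P α μ) (h : μ.OnlyRegs L μ') :
    Grown enc P₀ α₀ μ₀ P α μ' := by
  obtain ⟨h1, h2, h3, h4, h5, h6, h7⟩ := H
  rw [← h.heap, ← h.fresh] at h1
  rw [← h.fresh] at h4 h6
  rw [← h.heap] at h5 h6
  exact ⟨h1, h2, h3, h4, h5, h6, h7⟩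

/-- Goes from the record in register 10 along the field `f`, to a new record if there is none. -/
def ensure (f : Slot) : Cmd := .block [
  .load 14 10 f, .cond (.isNull 14) (.block [.alloc 14, .store 10 f 14]) .skip, .copy 10 14]

theorem ensure_spec (hE : Function.Injective enc) {P₀ P : Set (List A × List Bool)}
    {α₀ α : List A × List Bool → ℕ} {μ₀ μ : Mem} (H : Grown enc P₀ α₀ μ₀ P α μ)
    {x y : List A × List Bool} {f : Slot} (hs : Step enc x f y) (hx : x ∈ P)
    (h10 : μ.reg 10 = some (α x)) {k : ℕ} {Q : ℕ → Mem → Prop}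
    (hQ : ∀ k' μ' α', k' ≤ k + 6 → (∀ r, r ≠ 10 → r ≠ 14 → μ'.reg r = μ.reg r) →
      Grown enc P₀ α₀ μ₀ (insert y P) α' μ' → (∀ z ∈ P, α' z = α z) → μ'.reg 10 = some (α' y) →
      Q k' μ') : Runs (ensure f) μ k Q := by
  classical
  obtain ⟨hT, hsub, haddr, hfresh, hold, hnew, hna⟩ := id H
  by_cases hy : y ∈ P
  · simp [ensure, h10, hT.link _ _ _ hs hy]
    refine hQ _ _ α (by omega) (fun r h1 h2 => by simp [h1, h2]) ?_ (fun _ _ => rfl) (by simp)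
    rw [Set.insert_eq_self.2 hy]
    exact H.onlyRegs (L := [10, 14]) ⟨rfl, rfl, fun r hr => by simp at hr; simp [hr]⟩
  · have hnull : μ.heap (α x) f = none := hT.null _ hx _ hs.isTree fun y' hy' =>
      hs.target_unique hE hy' ▸ hy
    have hxlt := hT.lt x hx
    simp [ensure, h10, hnull]
    refine hQ _ _ (Function.update α y μ.fresh) (by omega) (fun r h1 h2 => by simp [h1, h2]) ?_
      (fun z hz => Function.update_of_ne (fun h => hy (by rwa [h] at hz)) _ _) (by simp)
    have hα : ∀ z ∈ P, Function.update α y μ.fresh z = α z := fun z hz =>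
      Function.update_of_ne (fun h => hy (by rwa [h] at hz)) _ _
    have hclosed : ∀ z g w, Step enc z g w → w ∈ insert y P → z ∈ P := by
      rintro z g w hst (rfl | hw)
      · rw [(hst.source_unique hs).1]; exact hx
      · exact hT.closed _ _ _ hst hw
    have hheap : ∀ z ∈ P, ∀ g, (z ≠ x ∨ g ≠ f) → ((μ.setReg 14 none).create 14).heap (α z) g = μ.heap (α z) g ∧
        ¬ (α z = α x ∧ g = f) := by
      intro z hz g hzg
      have := hT.lt z hz
      refine ⟨by simp [show α z ≠ μ.fresh by omega], fun ⟨h1, h2⟩ => ?_⟩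
      have := hT.inj _ hz _ hx h1
      tauto
    refine ⟨⟨?_, ?_, ?_, ?_, ?_⟩, hsub.trans (Set.subset_insert _ _), ?_, ?_, ?_, ?_, ?_⟩
    · rintro z (rfl | hz)
      · simp
      · rw [hα z hz]
        exact (hT.lt z hz).trans (by simp)
    · rintro z (rfl | hz) w (rfl | hw) he
      · rfl
      · rw [hα w hw] at he
        have := hT.lt w hw
        simp at he; omega
      · rw [hα z hz] at he
        have := hT.lt z hz
        simp at he; omega
      · rw [hα z hz, hα w hw] at he
        exact hT.inj _ hz _ hw he
    · exact fun z g w hst hw => .inr (hclosed z g w hst hw)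
    · intro z g w hst hw
      have hz := hclosed z g w hst hw
      rw [hα z hz]
      rcases hw with rfl | hw
      · obtain ⟨rfl, rfl⟩ := hst.source_unique hs
        simp
      · obtain ⟨h1, h2⟩ := hheap z hz g (by
          by_contra hcon
          push Not at hcon
          obtain ⟨rfl, rfl⟩ := hcon
          exact hy (hst.target_unique hE hs ▸ hw))
        rw [hα w hw]
        simp only [Mem.setReg_heap, Mem.setField_heap, h2, if_false, h1]
        exact hT.link _ _ _ hst hw
    · rintro z (rfl | hz) g hg hn
      · simp [show μ.fresh ≠ α x by omega]
      · rw [hα z hz]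
        have hzg : z ≠ x ∨ g ≠ f := by
          by_contra hcon
          push Not at hcon
          obtain ⟨rfl, rfl⟩ := hcon
          exact hn y hs (Set.mem_insert _ _)
        obtain ⟨h1, h2⟩ := hheap z hz g hzg
        simp only [Mem.setReg_heap, Mem.setField_heap, h2, if_false, h1]
        exact hT.null _ hz _ hg fun w hw hw' => hn w hw (.inr hw')
    · exact fun z hz => (hα z (hsub hz)).trans (haddr z hz)
    · simp; omega
    · intro l hl g hg
      have hlg : ¬ (l = α x ∧ g = f) := by
        rintro ⟨rfl, rfl⟩
        rcases hg with hg | hg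
        · exact hg hs.isTree
        · by_cases hx0 : x ∈ P₀
          · exact hg x hx0 (haddr x hx0)
          · have := hna x hx hx0
            omega
      simp [hlg, show l ≠ μ.fresh by omega, hold l hl g hg]
    · intro l hl hl' g hg
      have hlg : ¬ (l = α x ∧ g = f) := by
        rintro ⟨rfl, rfl⟩
        exact hg hs.isTree
      by_cases hlf : l = μ.fresh
      · simp [hlf, hxlt.ne']
      · simp at hl'
        simp [hlg, hlf, hnew l hl (by omega) g hg]
    · rintro z (rfl | hz) hz0
      · simpa using hfresh
      · rw [hα z hz]; exact hna z hz hz0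

/-- Moves along the code word in register 11 and creates the missing records. -/
def extendBits : Cmd := .loop (.nonNull 11) (.block [
  .load 12 11 .bit, .cond (.isNull 12) (ensure .zero) (ensure .one), .load 11 11 .next])

/-- Extends the automaton by the prefixes of the pattern. -/
def extend : Cmd := .block [.copy 3 2, .copy 10 0,
  .loop (.nonNull 3) (.block [.load 11 3 .code, extendBits, ensure .dest, .load 3 3 .next])]

theorem extendBits_spec (hE : Function.Injective enc) {P₀ P : Set (List A × List Bool)}
    {α₀ : List A × List Bool → ℕ} {μ₀ : Mem} {S : Set ℕ} {Q : ℕ → Mem → Prop}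
    (hS : ∀ l ∈ S, l < μ₀.fresh ∧ ∀ x ∈ P₀, l ≠ α₀ x) {s : List A} (rest : List Bool) :
    ∀ (b : List Bool) (μ : Mem) (k : ℕ) (α : List A × List Bool → ℕ),
    Grown enc P₀ α₀ μ₀ (P ∪ {x | x.1 = s ∧ x.2 <+: b}) α μ →
    BitsStored μ₀.heap S (μ.reg 11) rest → μ.reg 10 = some (α (s, b)) →
    (∀ k' μ' α', k' ≤ k + 10 * rest.length + 1 →
      (∀ r < 10, μ'.reg r = μ.reg r) →
      Grown enc P₀ α₀ μ₀ (P ∪ {x | x.1 = s ∧ x.2 <+: b ++ rest}) α' μ' →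
      μ'.reg 10 = some (α' (s, b ++ rest)) → Q k' μ') →
    Runs extendBits μ k Q := by
  induction rest with
  | nil =>
    intro b μ k α hG hB h10 hQ
    refine runs_loop_done (by simpa [BitsStored] using hB) ?_
    exact hQ _ _ α (by simp) (fun _ _ => rfl) (by simpa using hG) (by simpa using h10)
  | cons i rest ih =>
    intro b μ k α hG hB h10 hQ
    obtain ⟨l, hl, h11, hbit, hB⟩ := hB
    have hsame : μ.heap l = μ₀.heap l := funext fun f => hG.old l (hS l hl).1 f (.inr (hS l hl).2)
    refine runs_loop_step (by simp [h11]) ?_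
    have hset : insert (s, b ++ [i]) (P ∪ {x | x.1 = s ∧ x.2 <+: b}) =
        P ∪ {x | x.1 = s ∧ x.2 <+: b ++ [i]} := by
      ext ⟨t, b'⟩
      simp only [Set.mem_insert_iff, Set.mem_union, Set.mem_ofPred_eq, List.prefix_concat_iff,
        Prod.mk.injEq]
      tauto
    have key : Runs (ensure (bitSlot i)) (μ.setReg 12 (μ.heap l .bit)) (k + 1 + 1 + 1) fun k' μ' =>
        ∃ l, μ'.reg 11 = some l ∧
          Runs extendBits (μ'.setReg 11 (μ'.heap l .next)) (k' + 1) Q := by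
      refine ensure_spec (μ := μ.setReg 12 _) hE (hG.onlyRegs (L := [12]) ⟨rfl, rfl, fun r hr => ?_⟩)
        (.bit s b i) (.inr ⟨rfl, List.prefix_rfl⟩) (by simp [h10]) ?_
      · simp at hr; simp [hr]
      intro k' μ' α' hk' hr' hG' hα' h10'
      rw [hset] at hG'
      refine ⟨l, by rw [hr' 11 (by omega) (by omega)]; simp [h11], ?_⟩
      have hsame' : μ'.heap l = μ₀.heap l :=
        funext fun f => hG'.old l (hS l hl).1 f (.inr (hS l hl).2)
      refine ih (b ++ [i]) _ _ α' (hG'.onlyRegs (L := [11]) ⟨rfl, rfl, fun r hr => ?_⟩) ?_ ?_ ?_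
      · simp at hr; simp [hr]
      · simpa [hsame'] using hB
      · simpa using h10'
      · intro k'' μ'' α'' hk'' hr'' hG'' h10''
        refine hQ k'' μ'' α'' (by simp; omega) (fun r hr => ?_) (by simpa using hG'')
          (by simpa using h10'')
        rw [hr'' r hr, Mem.setReg_reg, if_neg (by omega), hr' r (by omega) (by omega)]
        simp [show r ≠ 12 by omega]
    cases i with
    | false =>
      have hbit' : μ.heap l .bit = none := by rw [hsame]; simpa using hbit
      simpa [h11, hbit', bitSlot, extendBits] using key
    | true =>
      have hbit' : μ.heap l .bit ≠ none := by
        rw [hsame]; intro h; simp [h] at hbit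
      simpa [h11, hbit', bitSlot, extendBits] using key

theorem liveSet_insert_append {D : Set (List A)} (x : List A) (c : A) :
    liveSet enc (insert (x ++ [c]) D) = insert (x ++ [c], [])
      (liveSet enc (insert x D) ∪ {y | y.1 = x ∧ y.2 <+: enc c}) := by
  ext ⟨s, b⟩
  have hst : ∀ t, t ∈ states (insert (x ++ [c]) D) ↔ t ∈ states (insert x D) ∨ t = x ++ [c] := by
    intro t
    rw [states_insert, states_insert]
    simp only [Set.mem_union, Set.mem_ofPred_eq, List.prefix_concat_iff]
    tauto
  have hx : x ∈ states (insert x D) := mem_states_of_mem (Set.mem_insert _ _)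
  simp only [Set.mem_insert_iff, Set.mem_union, Set.mem_ofPred_eq, Prod.mk.injEq]
  rw [mem_liveSet, mem_liveSet]
  constructor
  · rintro ⟨hs, rfl | ⟨c', hc', hb⟩⟩
    · rcases (hst s).1 hs with hs | rfl
      · exact .inr (.inl ⟨hs, .inl rfl⟩)
      · exact .inl ⟨rfl, rfl⟩
    · rcases (hst _).1 hc' with hc' | hc'
      · exact .inr (.inl ⟨mem_states_of_prefix ⟨[c'], rfl⟩ hc', .inr ⟨c', hc', hb⟩⟩)
      · obtain ⟨rfl, hcc⟩ := List.append_inj' hc' rfl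
        simp at hcc
        subst hcc
        exact .inr (.inr ⟨rfl, hb⟩)
  · rintro (⟨rfl, rfl⟩ | ⟨hs, rfl | ⟨c', hc', hb⟩⟩ | ⟨rfl, hb⟩)
    · exact ⟨(hst _).2 (.inr rfl), .inl rfl⟩
    · exact ⟨(hst _).2 (.inl hs), .inl rfl⟩
    · exact ⟨(hst _).2 (.inl hs), .inr ⟨c', (hst _).2 (.inl hc'), hb⟩⟩
    · exact ⟨(hst _).2 (.inl hx), .inr ⟨c, (hst _).2 (.inr rfl), hb⟩⟩

theorem liveSet_insert_nil {D : Set (List A)} : liveSet enc (insert [] D) = liveSet enc D := by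
  have : states (insert [] D) = states D := by
    rw [states_insert]
    ext t
    simp only [List.prefix_nil, Set.mem_union, Set.mem_ofPred_eq, or_iff_left_iff_imp]
    rintro rfl
    exact nil_mem_states
  ext ⟨s, b⟩
  rw [mem_liveSet, mem_liveSet, this]

theorem extend_spec {K : ℕ} (hE : Function.Injective enc) (hK : ∀ c, (enc c).length = K)
    {D : Set (List A)} {α₀ : List A × List Bool → ℕ} {μ₀ : Mem} {S : Set ℕ} {p : List A}
    (hT : Trie enc (liveSet enc D) μ₀.heap α₀ μ₀.fresh)
    (hS : ∀ l ∈ S, l < μ₀.fresh ∧ ∀ x ∈ liveSet enc D, l ≠ α₀ x)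
    (h0 : μ₀.reg 0 = some (α₀ ([], []))) (h2 : StringStored enc μ₀.heap S (μ₀.reg 2) p) :
    Runs extend μ₀ 0 fun t μ => t ≤ p.length * (10 * K + 10) + 3 ∧
      (∀ r < 3, μ.reg r = μ₀.reg r) ∧
      ∃ α, Grown enc (liveSet enc D) α₀ μ₀ (liveSet enc (insert p D)) α μ := by
  have main : ∀ (rest x : List A) (μ : Mem) (k : ℕ) (α : List A × List Bool → ℕ), p = x ++ rest →
      Grown enc (liveSet enc D) α₀ μ₀ (liveSet enc (insert x D)) α μ →
      StringStored enc μ₀.heap S (μ.reg 3) rest → μ.reg 10 = some (α (x, [])) →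
      (∀ r < 3, μ.reg r = μ₀.reg r) →
      Runs (.loop (.nonNull 3) (.block [.load 11 3 .code, extendBits, ensure .dest,
        .load 3 3 .next])) μ k fun t μ => t ≤ k + rest.length * (10 * K + 10) + 1 ∧
        (∀ r < 3, μ.reg r = μ₀.reg r) ∧
        ∃ α, Grown enc (liveSet enc D) α₀ μ₀ (liveSet enc (insert p D)) α μ := by
    intro rest
    induction rest with
    | nil =>
      intro x μ k α hx hG h3 h10 hr
      rw [List.append_nil] at hx
      subst hx
      exact runs_loop_done (by simpa [StringStored] using h3) ⟨by simp, hr, α, hG⟩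
    | cons c rest ih =>
      intro x μ k α hx hG h3 h10 hr
      obtain ⟨l, hl, h3, hcode, hnext⟩ := h3
      have hsame : μ.heap l = μ₀.heap l := funext fun f => hG.old l (hS l hl).1 f (.inr (hS l hl).2)
      refine runs_loop_step (by simp [h3]) ?_
      simp [h3]
      have hset : liveSet enc (insert x D) =
          liveSet enc (insert x D) ∪ {y | y.1 = x ∧ y.2 <+: ([] : List Bool)} := by
        refine (Set.union_eq_left.2 ?_).symm
        rintro ⟨s, b⟩ ⟨rfl, hb⟩
        have hb : b = [] := by simpa using hb
        subst hb
        exact mem_liveSet_nil.2 (mem_states_of_mem (Set.mem_insert _ _))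
      refine extendBits_spec (P := liveSet enc (insert x D)) hE hS (s := x) (enc c) []
        _ _ α (hset ▸ hG.onlyRegs (L := [11]) ⟨rfl, rfl, fun r hr => ?_⟩)
        (by simpa [hsame] using hcode) (by simp [h10]) ?_
      · simp at hr; simp [hr]
      intro k₁ μ₁ α₁ hk₁ hr₁ hG₁ h10₁
      rw [hK] at hk₁
      refine ensure_spec hE hG₁ (.dest x c) (.inr ⟨rfl, List.prefix_rfl⟩) (by simpa using h10₁) ?_
      intro k₂ μ₂ α₂ hk₂ hr₂ hG₂ hα₂ h10₂
      have hsame₂ : μ₂.heap l = μ₀.heap l :=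
        funext fun f => hG₂.old l (hS l hl).1 f (.inr (hS l hl).2)
      refine ⟨l, by rw [hr₂ 3 (by omega) (by omega), hr₁ 3 (by omega)]; simp [h3], ?_⟩
      refine (ih (x ++ [c]) _ _ α₂ (by simp [hx]) ?_ (by simpa [hsame₂] using hnext)
        (by simpa using h10₂) fun r hr' => ?_).mono ?_
      · rw [liveSet_insert_append]
        refine Grown.onlyRegs (μ := μ₂) (L := [3]) (by simpa using hG₂) ⟨rfl, rfl, fun r hr => ?_⟩
        simp at hr; simp [hr]
      · simp [show r ≠ 3 by omega]
        rw [hr₂ r (by omega) (by omega), hr₁ r (by omega)]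
        simp [show r ≠ 11 by omega, hr r hr']
      · rintro t μ' ⟨ht, h'⟩
        refine ⟨?_, h'⟩
        linarith
  simp [extend]
  refine (main p [] _ _ α₀ rfl ?_ (by simpa using h2) (by simp [h0]) ?_).mono ?_
  · rw [liveSet_insert_nil]
    exact ⟨hT, subset_rfl, fun _ _ => rfl, le_rfl, fun _ _ _ _ => rfl,
      fun l h1 h2 => absurd (show l < μ₀.fresh from h2) (by omega), fun x hx h => absurd hx h⟩
  · intro r hr
    simp [show r ≠ 10 by omega, show r ≠ 3 by omega]
  · rintro t μ' ⟨ht, h'⟩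
    exact ⟨by omega, h'⟩

end Trie

/-! ### Failure links and outputs in terms of longest suffixes -/

section Links

variable {A : Type*} {enc : A → List Bool} {T D : Set (List A)} {p : List A}
    {α : List A → List Bool → ℕ} {ν : Set (List A) → List Bool → ℕ}
    {ch : Set (List A) → List (Set (List A))} {n : ℕ} {pp : Option ℕ}

/-- In the heap `h`, the field `f` of every string `s` from `S` points to `g s`. -/
def Links (α : List A → List Bool → ℕ) (S : Set (List A)) (f : Slot)
    (g : List A → Option (List A)) (h : Heap) : Prop :=
  ∀ s ∈ S, h (α s []) f = (g s).map fun t => α t []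

/-- The lists of outputs are given by the longest suffixes and the longest proper suffixes that are
patterns. -/
theorem outputs_iff {h : Heap} :
    (∀ s ∈ states D, ∃ l : List (List A), l.Pairwise (fun q r => r.length < q.length) ∧
      (∀ q, q ∈ l ↔ q ∈ output D s) ∧
      ChainAt h .nextOut (h (α s []) .out) (l.map fun q => α q [])) ↔
    Links α (states D) .out (lsuf D) h ∧ Links α D .nextOut (psuf D) h := by
  constructor
  · intro H
    have key : ∀ s ∈ states D, ∀ q l, List.Pairwise (fun q r => r.length < q.length) (q :: l) →
        (∀ r : List A, r ∈ q :: l ↔ r ∈ output D s) → lsuf D s = some q := by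
      intro s hs q l hl hm
      have hq := (hm q).1 (by simp)
      refine lsuf_eq_some_iff.2 ⟨hq.1, hq.2, fun w hw hws => ?_⟩
      rcases List.mem_cons.1 ((hm w).2 ⟨hw, hws⟩) with rfl | hw
      · exact le_rfl
      · exact ((List.pairwise_cons.1 hl).1 w hw).le
    constructor
    · intro s hs
      obtain ⟨l, hl, hm, hc⟩ := H s hs
      cases l with
      | nil =>
        rw [lsuf_eq_none_iff.2 fun w hw hws => by simpa using (hm w).2 ⟨hw, hws⟩]
        exact hc
      | cons q l =>
        rw [key s hs q l hl hm]
        exact hc.1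
    · intro s hsD
      have hs := mem_states_of_mem hsD
      obtain ⟨l, hl, hm, hc⟩ := H s hs
      cases l with
      | nil => simpa using (hm s).2 ⟨hsD, List.suffix_rfl⟩
      | cons q l =>
        have hq := key s hs q l hl hm
        rw [lsuf_of_mem hsD] at hq
        obtain rfl := Option.some.inj hq
        have hc := hc.2
        obtain ⟨hl1, hl2⟩ := List.pairwise_cons.1 hl
        cases l with
        | nil =>
          rw [psuf_eq_none_iff.2 fun w hw hws => by simpa using (hm w).2 ⟨hw, hws⟩]
          exact hc
        | cons r l =>
          have hr := (hm r).1 (by simp)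
          have : psuf D s = some r := by
            refine psuf_eq_some_iff.2 ⟨hr.1, ⟨hr.2, ?_⟩, fun w hw hws hne => ?_⟩
            · rintro rfl
              exact lt_irrefl _ (hl1 r (by simp))
            · rcases List.mem_cons.1 ((hm w).2 ⟨hw, hws⟩) with rfl | hw
              · exact absurd rfl hne
              · rcases List.mem_cons.1 hw with rfl | hw
                · exact le_rfl
                · exact ((List.pairwise_cons.1 hl2).1 w hw).le
          rw [this]
          exact hc.1
  · rintro ⟨h1, h2⟩
    have key : ∀ n, ∀ q ∈ D, q.length = n → ∃ l : List (List A),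
        l.Pairwise (fun q r => r.length < q.length) ∧ (∀ r, r ∈ l ↔ r ∈ output D q) ∧
        ChainAt h .nextOut (some (α q [])) (l.map fun q => α q []) := by
      intro n
      induction n using Nat.strong_induction_on with
      | _ n ih =>
        rintro q hq rfl
        have h2q := h2 q hq
        cases hr : psuf D q with
        | none =>
          rw [hr] at h2q
          refine ⟨[q], by simp, fun r => ?_, rfl, h2q⟩
          rw [List.mem_singleton]
          constructor
          · rintro rfl
            exact ⟨hq, List.suffix_rfl⟩
          · exact fun h => psuf_eq_none_iff.1 hr r h.1 h.2
        | some r =>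
          rw [hr] at h2q
          obtain ⟨hrD, ⟨hrq, hne⟩, hmax⟩ := psuf_eq_some_iff.1 hr
          have hlt := psuf_length_lt hr
          obtain ⟨l, hl, hm, hc⟩ := ih _ hlt r hrD rfl
          refine ⟨q :: l, List.pairwise_cons.2 ⟨fun w hw => ?_, hl⟩, fun w => ?_, rfl, ?_⟩
          · exact ((hm w).1 hw).2.length_le.trans_lt hlt
          · rw [List.mem_cons, hm]
            constructor
            · rintro (rfl | h)
              · exact ⟨hq, List.suffix_rfl⟩
              · exact ⟨h.1, h.2.trans hrq⟩
            · rintro ⟨hw, hwq⟩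
              by_cases hwq' : w = q
              · exact .inl hwq'
              · exact .inr ⟨hw, suffix_of_suffix_of_length_le hwq hrq (hmax w hw hwq hwq')⟩
          · rw [h2q]; exact hc
    intro s hs
    cases hq : lsuf D s with
    | none =>
      refine ⟨[], by simp, fun r => ?_, ?_⟩
      · simpa using fun h : r ∈ output D s => lsuf_eq_none_iff.1 hq r h.1 h.2
      · rw [h1 s hs, hq]; rfl
    | some q =>
      obtain ⟨hqD, hqs, hmax⟩ := lsuf_eq_some_iff.1 hq
      obtain ⟨l, hl, hm, hc⟩ := key _ q hqD rfl
      refine ⟨l, hl, fun r => ?_, ?_⟩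
      · rw [hm]
        exact ⟨fun h => ⟨h.1, h.2.trans hqs⟩, fun h => ⟨h.1,
          suffix_of_suffix_of_length_le h.2 hqs (hmax r h.1 h.2)⟩⟩
      · rw [h1 s hs, hq]; exact hc

theorem flinks_iff {h : Heap} :
    ((∀ s ∈ states D, ∀ t, IsFlink D s t → h (α s []) .flink = some (α t [])) ∧
      h (α [] []) .flink = none) ↔ Links α (states D) .flink (psuf (states D)) h := by
  constructor
  · rintro ⟨h1, h2⟩ s hs
    cases ht : psuf (states D) s with
    | none =>
      have := psuf_eq_none_iff.1 ht [] nil_mem_states (List.nil_suffix)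
      rw [← this, h2]; rfl
    | some t => exact h1 s hs t (isFlink_iff.2 ht)
  · intro H
    refine ⟨fun s hs t ht => ?_, H [] nil_mem_states⟩
    rw [H s hs, isFlink_iff.1 ht]; rfl

theorem Layout.links_inj {h : Heap} (H : Layout enc T D p α ν ch n pp h) {o o' : Option (List A)}
    (ho : ∀ s, o = some s → s ∈ states T) (ho' : ∀ s, o' = some s → s ∈ states T) :
    (o.map fun t => α t []) = (o'.map fun t => α t []) ↔ o = o' := by
  constructor
  · intro h
    cases o with
    | none => cases o' with
      | none => rfl
      | some s' => simp at h
    | some s => cases o' with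
      | none => simp at h
      | some s' =>
        simp only [Option.map_some, Option.some.injEq] at h
        rw [(H.state_ne (ho s rfl) (ho' s' rfl)).1 h]
  · rintro rfl
    rfl

end Links

/-! ### Redirecting the failure links to the new states -/

section Redirect

variable {A : Type*} {enc : A → List Bool} {T D : Set (List A)} {p : List A}
    {α : List A → List Bool → ℕ} {ν : Set (List A) → List Bool → ℕ}
    {ch : Set (List A) → List (Set (List A))} {n : ℕ} {pp : Option ℕ}

/-- A linked list of new records, each one with pointers to a state (`aux 0`) and its node
(`aux 1`). -/
def Entries (D : Set (List A)) (α : List A → List Bool → ℕ)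
    (ν : Set (List A) → List Bool → ℕ) (n m : ℕ) (h : Heap) : Option ℕ → List (List A) → Prop
  | v, [] => v = none
  | v, x :: xs => ∃ l, n ≤ l ∧ l < m ∧ v = some l ∧ h l (.aux 0) = some (α x []) ∧
      h l (.aux 1) = some (ν (cls D x) []) ∧ Entries D α ν n m h (h l (.aux 2)) xs

theorem Entries.congr {m m' : ℕ} {h h' : Heap} (hm : m ≤ m')
    (hh : ∀ l, n ≤ l → l < m → h' l = h l) {xs : List (List A)} {v : Option ℕ}
    (H : Entries D α ν n m h v xs) : Entries D α ν n m' h' v xs := by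
  induction xs generalizing v with
  | nil => exact H
  | cons x xs ih =>
    obtain ⟨l, h1, h2, h3, h4, h5, h6⟩ := H
    refine ⟨l, h1, h2.trans_le hm, h3, ?_, ?_, ?_⟩
    · rw [hh l h1 h2]; exact h4
    · rw [hh l h1 h2]; exact h5
    · rw [hh l h1 h2]; exact ih h6

/-- Lists the prefixes of the pattern that have a node, the longest one first, in register 6. -/
def listPrefixes : Cmd := .block [.setNull 6,
  forPrefixes (.cond (.nonNull 5) (.block [.alloc 14, .store 14 (.aux 0) 4, .store 14 (.aux 1) 5,
    .store 14 (.aux 2) 6, .copy 6 14]) .skip)]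

theorem listPrefixes_spec {K : ℕ} (hE : Function.Injective enc) (hK : ∀ c, (enc c).length = K)
    (hp : p ∈ states T) {μ : Mem} (hL : Layout enc T D p α ν ch n pp μ.heap)
    (hR : Anchored α ν D pp μ) (hn : n ≤ μ.fresh) :
    Runs listPrefixes μ 0 fun t μ' => t ≤ p.length * (12 * K + 21) + 5 ∧
      Anchored α ν D pp μ' ∧ n ≤ μ'.fresh ∧ (∀ l < n, μ'.heap l = μ.heap l) ∧
      ∃ xs : List (List A), Entries D α ν n μ'.fresh μ'.heap (μ'.reg 6) xs ∧
        (∀ y, y ∈ xs ↔ y <+: p ∧ y ≠ [] ∧ y ∈ substr D) ∧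
        xs.Pairwise (fun x y => y.length < x.length) ∧ xs.length ≤ p.length := by
  simp [listPrefixes]
  refine (forPrefixes_spec hE hK hp hL (Inv := fun x k μ' =>
      k ≤ x.length * (12 * K + 21) + 5 ∧
      Anchored α ν D pp μ' ∧ n ≤ μ'.fresh ∧ (∀ l < n, μ'.heap l = μ.heap l) ∧
      ∃ xs : List (List A), Entries D α ν n μ'.fresh μ'.heap (μ'.reg 6) xs ∧
        (∀ y, y ∈ xs ↔ y <+: x ∧ y ≠ [] ∧ y ∈ substr D) ∧
        xs.Pairwise (fun x y => y.length < x.length) ∧ xs.length ≤ x.length) ?_ ?_ ?_ ?_).mono ?_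
  · rintro x k μ' ⟨-, h1, -, h2, -⟩
    exact ⟨fun l hl f _ => by rw [h2 l hl], h1⟩
  · rintro x k μ' μ'' ⟨h0, h1, h2, h3, xs, h4⟩ hμ
    rw [← hμ.fresh, ← hμ.heap, ← hμ.reg 6 (by simp)] at h4
    refine ⟨h0, ⟨?_, ?_, ?_⟩, by rwa [hμ.fresh], by rwa [hμ.heap], xs, h4⟩
    · rw [hμ.reg 0 (by simp)]; exact h1.root
    · rw [hμ.reg 1 (by simp)]; exact h1.source
    · rw [hμ.reg 2 (by simp)]; exact h1.pattern
  · rintro x c rest k μ' hx ⟨h0, h1, h2, h3, xs, h4, h5, h6, h7⟩ hr4 hr5 -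
    by_cases hxc : x ++ [c] ∈ substr D
    · rw [nodePtr, if_pos hxc] at hr5
      simp [hr4, hr5]
      refine ⟨by linarith, ⟨by simp [h1.root], by simp [h1.source], by simp [h1.pattern]⟩,
        by omega, fun l hl => ?_, (x ++ [c]) :: xs, ⟨μ'.fresh, h2, by simp, rfl, ?_⟩, fun y => ?_,
        List.pairwise_cons.2 ⟨fun y hy => ?_, h6⟩, by simpa using h7⟩
      · rw [← h3 l hl]
        funext f
        simp [show l ≠ μ'.fresh by omega]
      · simp
        refine h4.congr (by omega) fun l h8 h9 => ?_
        funext f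
        simp [show l ≠ μ'.fresh by omega]
      · rw [List.mem_cons, h5, List.prefix_concat_iff]
        constructor
        · rintro (rfl | h)
          · exact ⟨.inl rfl, by simp, hxc⟩
          · exact ⟨.inr h.1, h.2⟩
        · rintro ⟨rfl | h, h'⟩
          · exact .inl rfl
          · exact .inr ⟨h, h'⟩
      · have := ((h5 y).1 hy).1.length_le
        simp; omega
    · rw [nodePtr, if_neg hxc] at hr5
      simp [hr5]
      refine ⟨by linarith, h1, h2, h3, xs, h4, fun y => ?_, h6, by omega⟩
      rw [h5, List.prefix_concat_iff]
      constructor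
      · exact fun h => ⟨.inr h.1, h.2⟩
      · rintro ⟨rfl | h, h'⟩
        · exact absurd h'.2 hxc
        · exact ⟨h, h'⟩
  · refine ⟨by simp, ⟨by simp [hR.root], by simp [hR.source], by simp [hR.pattern]⟩, hn,
      fun _ _ => rfl, [], by simp [Entries], by simp, by simp, by simp⟩
  · rintro t μ' ⟨κ, hκ, ⟨h1, h2⟩, -⟩
    exact ⟨by omega, h2⟩

end Redirect

section WalkFrom

variable {A : Type*} {enc : A → List Bool} {T D : Set (List A)} {p : List A}
    {α : List A → List Bool → ℕ} {ν : Set (List A) → List Bool → ℕ}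
    {ch : Set (List A) → List (Set (List A))} {n : ℕ} {pp : Option ℕ}

/-- The traversal that starts with the node in register 21. -/
def walkFrom (visit : Cmd) : Cmd := .block [visit, walk visit]

theorem walkFrom_spec {h₀ : Heap} (hD : D.Finite) (hL : Layout enc T D p α ν ch n pp h₀)
    {halt : Set (List A) → Prop} {J : List (Set (List A)) → Heap → Prop} {cv : ℕ} {visit : Cmd}
    (hJ : ∀ done h h', J done h → (∀ l < n, h' l = h l) → J done h')
    (hJA : ∀ done h, J done h → Agree n h₀ h) {μ : Mem}
    (hV : VisitSpec ν D n h₀ μ.reg halt J cv visit) {v : Set (List A)} (hv : v ∈ nodes D)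
    (h21 : μ.reg 21 = some (ν v [])) (hj : J [] μ.heap) (hn : n ≤ μ.fresh) {k : ℕ} :
    Runs (walkFrom visit) μ k fun t μ' => ∃ out, Walk halt ch [[v]] out ∧
      t ≤ k + (cv + 13) * (2 * out.length) ∧ J out.reverse μ'.heap ∧ Walked n μ.reg μ μ' := by
  classical
  have hseg : ∀ u ∈ (if halt v then [] else ch v), u ∈ nodes D := by
    split_ifs
    · simp
    · exact fun u hu => hL.children.mem_nodes hv hu
  obtain ⟨out, hout⟩ := exists_walk (halt := halt) hD hL.children
    (segs := [if halt v then [] else ch v]) (by simpa using hseg)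
  simp only [walkFrom, runs_block_cons, runs_block_one]
  refine (hV v hv [] μ hj hn h21 fun _ _ => rfl).later ?_
  rintro t μ₁ ⟨ht, hj₁, hh₁, hf₁, hr₁, hs₁, hs₁'⟩
  refine (walk_spec hL hJ hJA hV hout hseg ?_ hj₁ (by omega)
    fun x hx => hr₁ x (by omega)).mono ?_
  · split_ifs with hst
    · rw [hs₁ hst]; rfl
    · rw [hs₁' hst]; exact hL.isuf v hv
  · rintro t' μ₂ ⟨ht', hj₂, hw⟩
    refine ⟨v :: out, hout.of_singleton, ?_, by simpa using hj₂, hw.trans hf₁.ge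
      fun l h1 _ => hh₁ l h1⟩
    simp only [List.length_cons]
    have : (cv + 13) * (2 * (out.length + 1)) = (cv + 13) * (2 * out.length + 1) + (cv + 13) := by
      ring
    omega

theorem stateLocs_congr {vs vs' : List (Set (List A))} (h : ∀ v, v ∈ vs ↔ v ∈ vs')
    (N : Set (List A) → Prop) : stateLocs D α vs N = stateLocs D α vs' N := by
  ext l
  simp only [stateLocs, h]

theorem mem_stateLocs {h : Heap} (hL : Layout enc T D p α ν ch n pp h) (hDT : states D ⊆ states T)
    {vs : List (Set (List A))} {N : Set (List A) → Prop} {t : List A} (ht : t ∈ states T) :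
    α t [] ∈ stateLocs D α vs N ↔ t ∈ states D ∧ ∃ v ∈ vs, N v ∧ t ∈ v := by
  constructor
  · rintro ⟨t', ht', v, hv, hN, htv, he⟩
    obtain rfl := (hL.state_ne ht (hDT ht')).1 he
    exact ⟨ht', v, hv, hN, htv⟩
  · rintro ⟨ht', v, hv, hN, htv⟩
    exact ⟨t, ht', v, hv, hN, htv, rfl⟩

end WalkFrom

section Redirect

variable {A : Type*} {enc : A → List Bool} {T D : Set (List A)} {p : List A}
    {α : List A → List Bool → ℕ} {ν : Set (List A) → List Bool → ℕ}
    {ch : Set (List A) → List (Set (List A))} {n : ℕ} {pp : Option ℕ}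

/-- The nodes and states of `D` after the new states from `R` have been processed: their nodes are
marked, and the failure links of the old states are those for the states of `D` and `R`. Apart
from that, the heap is still `hb`. -/
structure Redirected (D : Set (List A)) (α : List A → List Bool → ℕ)
    (ν : Set (List A) → List Bool → ℕ) (n : ℕ) (hb : Heap) (R : Set (List A)) (h : Heap) :
    Prop where
  links : Links α (states D) .flink (psuf (states D ∪ R)) h
  marks : ∀ v ∈ nodes D, Marked ν h v ↔ ∃ x ∈ R, x ∈ v
  other : ∀ l < n, ∀ f, (f = .flink → ∀ t ∈ states D, l ≠ α t []) →
    (f = .aux 0 → ∀ v ∈ nodes D, l ≠ ν v []) → h l f = hb l f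

theorem Redirected.agree {hb h : Heap} {R : Set (List A)} (H : Redirected D α ν n hb R h) :
    Agree n hb h := by
  intro l hl f hf
  refine H.other l hl f ?_ ?_
  · rintro rfl; exact absurd hf id
  · rintro rfl; exact absurd hf id

/-- The marked nodes that are not below other marked nodes are in `U`. -/
def Exposed (D : Set (List A)) (ν : Set (List A) → List Bool → ℕ) (h : Heap)
    (U : Finset (Set (List A))) : Prop :=
  ∀ w ∈ nodes D, Marked ν h w → (∀ w' ∈ nodes D, Marked ν h w' → ¬ nodeOcc D w ⊂ nodeOcc D w') →
    w ∈ U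

/-- The number of states of `D` whose failure link changes when the states `R` are added. -/
noncomputable def changed (D R : Set (List A)) : ℕ :=
  {t | t ∈ states D ∧ psuf (states D ∪ R) t ≠ psuf (states D) t}.ncard

/-- The new states to which failure links are redirected. -/
structure NewStates (D R : Set (List A)) (s : List A) : Prop where
  substr : s ∈ substr D
  notMem : s ∉ states D
  longer : ∀ x ∈ R, x ∉ states D ∧ s.length < x.length

theorem NewStates.notMem_union {R : Set (List A)} {s : List A} (H : NewStates D R s) :
    s ∉ states D ∪ R := by
  rintro (h | h)
  · exact H.notMem h
  · exact lt_irrefl _ (H.longer s h).2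

/-- If the node of a new state is already marked, then the state is not a failure link. -/
theorem Redirected.skip {hb h : Heap} {R : Set (List A)} (H : Redirected D α ν n hb R h)
    {s : List A} (hs : NewStates D R s) (hm : Marked ν h (cls D s)) :
    Redirected D α ν n hb (insert s R) h ∧ changed D (insert s R) = changed D R := by
  classical
  have hsn := cls_mem_nodes hs.substr
  have key : ∀ t ∈ states D, psuf (states D ∪ insert s R) t = psuf (states D ∪ R) t := by
    intro t ht
    rw [Set.union_insert, psuf_insert_eq hs.notMem_union, if_neg]
    rintro ⟨⟨hst, -⟩, hmax⟩
    obtain ⟨x, hx, hxs⟩ := (H.marks _ hsn).1 hm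
    have hocc := ((mem_cls_iff hs.substr).1 hxs).2
    have hxt : x <:+ t := by
      have : t ∈ occ D s := ⟨ht, hst⟩
      rw [← hocc] at this
      exact this.2
    have := hmax x (.inr hx) hxt (by rintro rfl; exact (hs.longer x hx).1 ht)
    have := (hs.longer x hx).2
    omega
  refine ⟨⟨fun t ht => by rw [key t ht]; exact H.links t ht, fun v hv => ?_, H.other⟩, ?_⟩
  · rw [H.marks v hv]
    simp only [Set.mem_insert_iff, exists_eq_or_imp]
    refine ⟨.inr, ?_⟩
    rintro (hsv | hx)
    · rw [← (eq_cls_of_mem hv hsv).2] at hm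
      exact (H.marks v hv).1 hm
    · exact hx
  · unfold changed
    congr 1
    ext t
    simp only [Set.mem_ofPred_eq]
    exact and_congr_right fun ht => by rw [key t ht]

/-- Processing a new state whose node is not marked: the memory is `h` before the traversal, `h₁`
after it, and `h₂` after marking the node. -/
theorem Redirected.step {h₀ hb h h₁ h₂ : Heap} (hL : Layout enc T D p α ν ch n pp h₀)
    (hDT : states D ⊆ states T) {R : Set (List A)} (H : Redirected D α ν n hb R h) {s : List A}
    (hs : NewStates D R s) {out : List (Set (List A))}
    (hW : Walk (fun v => Trunk D v ∨ Marked ν h v) ch [[cls D s]] out)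
    (hset : FlinkSet n (stateLocs D α out fun v => ¬ Marked ν h v) (some (α s [])) h h₁)
    (hmark : h₂ (ν (cls D s) []) (.aux 0) ≠ none)
    (hh₂ : ∀ l < n, ∀ f, ¬ (l = ν (cls D s) [] ∧ f = .aux 0) → h₂ l f = h₁ l f) :
    Redirected D α ν n hb (insert s R) h₂ := by
  classical
  have hsn := cls_mem_nodes hs.substr
  have hαlt : ∀ t ∈ states D, α t [] < n := fun t ht =>
    hL.state_lt _ _ (stateLive_nil (hDT ht))
  have hνlt : ∀ v ∈ nodes D, ν v [] < n := fun v hv => hL.node_lt _ _ (nodeLive_nil hv)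
  refine ⟨fun t ht => ?_, fun v hv => ?_, fun l hl f h1 h2 => ?_⟩
  · rw [hh₂ _ (hαlt t ht) _ (by simp), Set.union_insert, psuf_insert_eq hs.notMem_union]
    have hst : s ≠ t := by rintro rfl; exact hs.notMem ht
    have hiff := hW.exists_mem_iff_new hL.children hs.substr hs.notMem hs.longer H.marks ht
    have hmem := mem_stateLocs hL hDT (vs := out) (N := fun v => ¬ Marked ν h v) (hDT ht)
    split_ifs with hc
    · exact (hset _ (hαlt t ht) _).1 ⟨rfl, hmem.2 ⟨ht, hiff.2 ⟨hc.1.1, hc.2⟩⟩⟩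
    · rw [(hset _ (hαlt t ht) _).2]
      · exact H.links t ht
      · rintro ⟨-, h⟩
        have := hiff.1 (hmem.1 h).2
        exact hc ⟨⟨this.1, hst⟩, this.2⟩
  · simp only [Set.mem_insert_iff, exists_eq_or_imp]
    by_cases hvs : v = cls D s
    · subst hvs
      exact iff_of_true hmark (.inl (self_mem_cls hs.substr))
    · have hne : ν v [] ≠ ν (cls D s) [] := fun he =>
        hvs (hL.node_inj _ _ _ _ (nodeLive_nil hv) (nodeLive_nil hsn) he).1
      rw [Marked, hh₂ _ (hνlt v hv) _ (by simp [hne]), (hset _ (hνlt v hv) _).2 (by simp)]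
      refine (H.marks v hv).trans ⟨.inr, ?_⟩
      rintro (h | h)
      · exact absurd (eq_cls_of_mem hv h).2 hvs
      · exact h
  · rw [hh₂ l hl f, (hset l hl f).2, H.other l hl f h1 h2]
    · rintro ⟨rfl, t, ht, -, -, -, -, rfl⟩
      exact h1 rfl t ht rfl
    · rintro ⟨rfl, rfl⟩
      exact h2 rfl _ hsn rfl

/-- Every unmarked state that is visited gets a new failure link for the first time. -/
theorem changed_insert {h : Heap} (hD : D.Finite) (hch : IsChildren D ch) {R : Set (List A)}
    (hmarks : ∀ v ∈ nodes D, Marked ν h v ↔ ∃ x ∈ R, x ∈ v) {s : List A}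
    (hs : NewStates D R s) {out : List (Set (List A))}
    (hW : Walk (fun v => Trunk D v ∨ Marked ν h v) ch [[cls D s]] out) :
    changed D R + {t | t ∈ states D ∧ ∃ v ∈ out, ¬ Marked ν h v ∧ t ∈ v}.ncard ≤
      changed D (insert s R) := by
  classical
  have hf := states_finite hD
  unfold changed
  rw [← Set.ncard_union_eq _ (hf.subset fun t ht => ht.1) (hf.subset fun t ht => ht.1)]
  · refine Set.ncard_le_ncard ?_ (hf.subset fun t ht => ht.1)
    rintro t (⟨ht, hne⟩ | ⟨ht, hv⟩)
    · refine ⟨ht, fun h => hne ?_⟩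
      exact psuf_eq_of_between Set.subset_union_left
        (Set.union_subset_union_right _ (Set.subset_insert _ _)) h
    · refine ⟨ht, ?_⟩
      have := (hW.exists_mem_iff_new hch hs.substr hs.notMem hs.longer hmarks ht).1 hv
      have hst : s ≠ t := by rintro rfl; exact hs.notMem ht
      rw [Set.union_insert, psuf_insert_eq hs.notMem_union, if_pos ⟨⟨this.1, hst⟩, this.2⟩]
      exact fun h => hs.notMem (psuf_mem h.symm)
  · refine Set.disjoint_left.2 ?_
    rintro t ⟨ht, hne⟩ ⟨-, hv⟩
    have := (hW.exists_mem_iff_new hch hs.substr hs.notMem hs.longer hmarks ht).1 hv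
    -- the failure link that has been changed before is longer than `s`
    have hu : ∃ u ∈ R, u <:+ t ∧ u ≠ t := by
      by_contra hcon
      push Not at hcon
      refine hne ?_
      cases hp : psuf (states D) t with
      | none =>
        rw [psuf_eq_none_iff] at hp ⊢
        rintro w (hw | hw) hwt
        · exact hp w hw hwt
        · exact hcon w hw hwt
      | some u =>
        rw [psuf_eq_some_iff] at hp ⊢
        refine ⟨.inl hp.1, hp.2.1, ?_⟩
        rintro w (hw | hw) hwt hne
        · exact hp.2.2 w hw hwt hne
        · exact absurd (hcon w hw hwt) hne
    obtain ⟨u, hu, hut, hne⟩ := hu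
    have h1 := this.2 u (.inr hu) hut hne
    have h2 := (hs.longer u hu).2
    omega

open Classical in
/-- The marked nodes that a traversal meets are exposed before it, but not after it. -/
theorem exposed_insert {h h₂ : Heap} (hch : IsChildren D ch) {R : Set (List A)}
    (hmarks : ∀ v ∈ nodes D, Marked ν h v ↔ ∃ x ∈ R, x ∈ v)
    {s : List A} (hs : NewStates D R s)
    (hmarks₂ : ∀ v ∈ nodes D, Marked ν h₂ v ↔ ∃ x ∈ insert s R, x ∈ v)
    {out : List (Set (List A))}
    (hsm : ¬ Marked ν h (cls D s))
    (hW : Walk (fun v => Trunk D v ∨ Marked ν h v) ch [[cls D s]] out)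
    {U : Finset (Set (List A))} (hU : Exposed D ν h U) :
    ∃ U' : Finset (Set (List A)), Exposed D ν h₂ U' ∧
      U'.card + out.countP (fun v => Marked ν h v) ≤ U.card + 1 := by
  have hsn := cls_mem_nodes hs.substr
  have hs1 : ∀ v ∈ [[cls D s]].flatten, v ∈ nodes D := by simpa using hsn
  have hnodup := hW.nodup_singleton hch hsn
  set M := (out.filter fun v => Marked ν h v).toFinset with hM
  have hcard : M.card = out.countP (fun v => Marked ν h v) := by
    rw [hM, List.toFinset_card_of_nodup (hnodup.filter _), List.countP_eq_length_filter]
  have hMmem : ∀ w, w ∈ M ↔ w ∈ out ∧ Marked ν h w := fun w => by simp [hM]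
  have hout : ∀ w ∈ out, w ∈ nodes D ∧ nodeOcc D w ⊆ occ D s ∧ ∀ w' ∈ nodes D,
      nodeOcc D w ⊂ nodeOcc D w' → nodeOcc D w' ⊆ occ D s → ¬ (Trunk D w' ∨ Marked ν h w') := by
    intro w hw
    have := (hW.mem_iff hch hs1 w).1 hw
    simpa [nodeOcc_cls hs.substr] using this
  have hMU : M ⊆ U := by
    intro w hw
    obtain ⟨hw, hmw⟩ := (hMmem w).1 hw
    obtain ⟨hwn, hws, hcut⟩ := hout w hw
    refine hU w hwn hmw fun w' hw' hmw' hlt => ?_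
    suffices nodeOcc D w' ⊆ occ D s from hcut w' hw' hlt this (.inr hmw')
    obtain ⟨x, hx, hxw'⟩ := (hmarks w' hw').1 hmw'
    obtain ⟨t, ht⟩ := nodeOcc_nonempty hwn
    have h1 := hlt.1 ht
    rw [nodeOcc_of_mem hw' hxw'] at h1 ⊢
    exact occ_anti (suffix_of_suffix_of_length_le (hws ht).2 h1.2 (hs.longer x hx).2.le)
  refine ⟨insert (cls D s) (U \ M), fun w hw hmw htop => ?_, ?_⟩
  · rw [Finset.mem_insert, Finset.mem_sdiff]
    by_cases hws : w = cls D s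
    · exact .inl hws
    · refine .inr ⟨hU w hw ?_ fun w' hw' hmw' => htop w' hw' ?_, fun hwM => ?_⟩
      · obtain ⟨x, rfl | hx, hxw⟩ := (hmarks₂ w hw).1 hmw
        · exact absurd (eq_cls_of_mem hw hxw).2 hws
        · exact (hmarks w hw).2 ⟨x, hx, hxw⟩
      · obtain ⟨x, hx, hxw⟩ := (hmarks w' hw').1 hmw'
        exact (hmarks₂ w' hw').2 ⟨x, .inr hx, hxw⟩
      · obtain ⟨hwo, -⟩ := (hMmem w).1 hwM
        refine htop _ hsn ((hmarks₂ _ hsn).2 ⟨s, .inl rfl, self_mem_cls hs.substr⟩) ?_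
        rw [nodeOcc_cls hs.substr]
        refine (hout w hwo).2.1.ssubset_of_ne fun h => hws (node_ext hw hsn ?_)
        rw [h, nodeOcc_cls hs.substr]
  · have h1 := Finset.card_insert_le (cls D s) (U \ M)
    have h2 := Finset.card_sdiff_add_card_eq_card hMU
    omega

theorem countP_or_le {X : Type*} (P Q : X → Prop) [DecidablePred P] [DecidablePred Q]
    [DecidablePred fun x => P x ∨ Q x] [DecidablePred fun x => P x ∧ ¬ Q x] (l : List X) :
    l.countP (fun x => P x ∨ Q x) ≤ l.countP (fun x => P x ∧ ¬ Q x) + l.countP Q := by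
  induction l with
  | nil => simp
  | cons a l ih =>
    by_cases hP : P a <;> by_cases hQ : Q a <;> simp [hP, hQ] at ih ⊢ <;> omega

end Redirect

/-- The postcondition can be treated as unknown. -/
theorem Runs.of_forall {c : Cmd} {μ : Mem} {k : ℕ} {Q : ℕ → Mem → Prop}
    (h : ∀ Q' : ℕ → Mem → Prop, (∀ t μ', Q t μ' → Q' t μ') → Runs c μ k Q') : Runs c μ k Q :=
  h Q fun _ _ => id

section RedirectProgram

variable {A : Type*} {enc : A → List Bool} {T D : Set (List A)} {p : List A}
    {α : List A → List Bool → ℕ} {ν : Set (List A) → List Bool → ℕ}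
    {ch : Set (List A) → List (Set (List A))} {n : ℕ} {pp : Option ℕ}

theorem FlinkSet.refl {X : Set ℕ} (hX : ∀ l, l ∉ X) (val : Option ℕ) (h : Heap) :
    FlinkSet n X val h h := fun l _ _ => ⟨fun h' => absurd h'.2 (hX l), fun _ => rfl⟩

theorem FlinkSet.congr {X : Set ℕ} {val : Option ℕ} {h h₁ h₂ : Heap} (H : FlinkSet n X val h h₁)
    (hh : ∀ l < n, h₂ l = h₁ l) : FlinkSet n X val h h₂ := fun l hl f => by
  rw [hh l hl]; exact H l hl f

theorem OutReplaced.refl {X : Set ℕ} (hX : ∀ l, l ∉ X) (old new : Option ℕ) (h : Heap) :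
    OutReplaced n X old new h h := fun l _ _ => ⟨fun h' => absurd h'.2.1 (hX l), fun _ => rfl⟩

theorem OutReplaced.congr {X : Set ℕ} {old new : Option ℕ} {h h₁ h₂ : Heap}
    (H : OutReplaced n X old new h h₁) (hh : ∀ l < n, h₂ l = h₁ l) :
    OutReplaced n X old new h h₂ := fun l hl f => by
  rw [hh l hl]; exact H l hl f

theorem notMem_stateLocs_nil {N : Set (List A) → Prop} (l : ℕ) : l ∉ stateLocs D α [] N := by
  simp [stateLocs]

/-- Processes the states in the list in register 7, from the longest to the shortest. States of the
old automaton are left out, as are states with a marked node. -/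
def redirectLoop : Cmd := .loop (.nonNull 7) (.block [
  .load 8 7 (.aux 0), .load 14 7 (.aux 1), .load 15 14 .toState,
  .cond (.same 15 8) .skip (.block [
    .load 15 14 (.aux 0),
    .cond (.nonNull 15) .skip
      (.block [.copy 21 14, walkFrom visitFlink, .store 14 (.aux 0) 14])]),
  .load 7 7 (.aux 2)])

/-- The time is paid for by the entries of the list, by the failure links that change, and by the
exposed marked nodes in `U`. -/
theorem redirectLoop_spec {h₀ hb : Heap} (hD : D.Finite) (hL : Layout enc T D p α ν ch n pp h₀)
    (hDT : states D ⊆ states T) (hA : Agree n h₀ hb) (xs : List (List A)) :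
    ∀ (μ : Mem) (k : ℕ) (R : Set (List A)) (U : Finset (Set (List A))),
    Entries D α ν n μ.fresh μ.heap (μ.reg 7) xs → (∀ y ∈ xs, y ∈ substr D ∧ y ∈ states T) →
    xs.Pairwise (fun x y => y.length < x.length) →
    (∀ x ∈ R, x ∉ states D ∧ ∀ y ∈ xs, y.length < x.length) →
    Redirected D α ν n hb R μ.heap → Exposed D ν μ.heap U → n ≤ μ.fresh →
    Runs redirectLoop μ k fun t μ' =>
      t + 100 * changed D R ≤
        k + 200 * xs.length + 100 * U.card + 100 * changed D (R ∪ {x | x ∈ xs ∧ x ∉ states D}) + 1 ∧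
      Redirected D α ν n hb (R ∪ {x | x ∈ xs ∧ x ∉ states D}) μ'.heap ∧ Walked n μ'.reg μ μ' ∧
      ∀ r < 7, μ'.reg r = μ.reg r := by
  classical
  have hαlt : ∀ t ∈ states D, α t [] < n := fun t ht =>
    hL.state_lt _ _ (stateLive_nil (hDT ht))
  have hνlt : ∀ v ∈ nodes D, ν v [] < n := fun v hv => hL.node_lt _ _ (nodeLive_nil hv)
  induction xs with
  | nil =>
    intro μ k R U hE _ _ _ hR _ _
    refine runs_loop_done (by simpa [Entries] using hE) ?_
    have hnil : R ∪ {x | x ∈ ([] : List (List A)) ∧ x ∉ states D} = R := by simp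
    rw [hnil]
    exact ⟨by simp; omega, hR, ⟨le_rfl, fun _ _ _ => rfl, fun _ _ => rfl⟩, fun _ _ => rfl⟩
  | cons x xs ih =>
    intro μ k R U hE hxs hpw hRx hR hU hn
    obtain ⟨l, hl1, hl2, h7, e0, e1, hE⟩ := hE
    obtain ⟨hxD, hxT⟩ := hxs x (by simp)
    have hxn := cls_mem_nodes hxD
    have hpw' := List.pairwise_cons.1 hpw
    have hA' := hA.trans hR.agree
    have hread : μ.heap (ν (cls D x) []) .toState = h₀ (ν (cls D x) []) .toState :=
      hA' _ (hνlt _ hxn) .toState trivial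
    refine Runs.of_forall fun Q hQ => ?_
    -- the rest of the loop
    have rest : ∀ (k' : ℕ) (μ' : Mem) (R' : Set (List A)) (U' : Finset (Set (List A))),
        (x ∈ states D ∧ R' = R ∨ x ∉ states D ∧ R' = insert x R) →
        k' + 100 * changed D R + 100 * U'.card ≤
          k + 100 * U.card + 100 * changed D R' + 199 →
        Redirected D α ν n hb R' μ'.heap → Exposed D ν μ'.heap U' → Walked n μ'.reg μ μ' →
        (∀ r < 8, μ'.reg r = μ.reg r) →
        Runs redirectLoop (μ'.setReg 7 (μ'.heap l (.aux 2))) (k' + 1) Q := by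
      intro k' μ' R' U' hR' hk' hred hexp hw hr
      have hunion : R ∪ {y | y ∈ x :: xs ∧ y ∉ states D} =
          R' ∪ {y | y ∈ xs ∧ y ∉ states D} := by
        ext y
        rcases hR' with ⟨hx, rfl⟩ | ⟨hx, rfl⟩
        · simp only [Set.mem_union, Set.mem_ofPred_eq, List.mem_cons]
          constructor
          · rintro (h | ⟨rfl | h, h'⟩)
            · exact .inl h
            · exact absurd hx h'
            · exact .inr ⟨h, h'⟩
          · rintro (h | ⟨h, h'⟩)
            · exact .inl h
            · exact .inr ⟨.inr h, h'⟩
        · simp only [Set.mem_union, Set.mem_ofPred_eq, List.mem_cons, Set.mem_insert_iff]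
          constructor
          · rintro (h | ⟨rfl | h, h'⟩)
            · exact .inl (.inr h)
            · exact .inl (.inl rfl)
            · exact .inr ⟨h, h'⟩
          · rintro ((rfl | h) | ⟨h, h'⟩)
            · exact .inr ⟨.inl rfl, hx⟩
            · exact .inl h
            · exact .inr ⟨.inr h, h'⟩
      rw [hunion] at hQ
      refine (ih (μ'.setReg 7 (μ'.heap l (.aux 2))) (k' + 1) R' U' ?_ (fun y hy => hxs y (by simp [hy])) hpw'.2 ?_ hred hexp ?_).mono ?_
      · simp only [Mem.setReg_heap, Mem.setReg_fresh, Mem.setReg_reg, if_true]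
        rw [hw.scratch l hl1 hl2]
        exact hE.congr hw.fresh hw.scratch
      · intro y hy
        rcases hR' with ⟨-, rfl⟩ | ⟨hx, rfl⟩
        · exact ⟨(hRx y hy).1, fun z hz => (hRx y hy).2 z (by simp [hz])⟩
        · rcases hy with rfl | hy
          · exact ⟨hx, fun z hz => hpw'.1 z hz⟩
          · exact ⟨(hRx y hy).1, fun z hz => (hRx y hy).2 z (by simp [hz])⟩
      · exact hn.trans hw.fresh
      · rintro t μ'' ⟨ht, hred', hw', hr'⟩
        refine hQ _ _ ⟨?_, hred', ⟨hw.fresh.trans hw'.fresh, fun i h1 h2 => ?_, fun _ _ => rfl⟩,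
          fun r h => ?_⟩
        · simp only [List.length_cons]
          omega
        · rw [← hw.scratch i h1 h2]
          exact hw'.scratch i h1 (h2.trans_le hw.fresh)
        · rw [hr' r h]
          simp [show r ≠ 7 by omega, hr r (by omega)]
    have l_ne : l ≠ ν (cls D x) [] := by
      have := hνlt _ hxn
      omega
    by_cases hxs' : x ∈ states D
    · -- an old state
      have htr : μ.heap (ν (cls D x) []) .toState = some (α x []) := by
        rw [hread]; exact hL.trunk _ hxn x hxs' (self_mem_cls hxD)
      refine runs_loop_step (by simp [h7]) ?_
      simp [h7, e0, e1, htr]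
      refine rest _ _ R U (.inl ⟨hxs', rfl⟩) (by omega) hR hU
        ⟨le_rfl, fun _ _ _ => rfl, fun _ _ => rfl⟩ fun r hr => ?_
      simp [show r ≠ 15 by omega, show r ≠ 14 by omega, show r ≠ 8 by omega]
    · have htr : μ.heap (ν (cls D x) []) .toState ≠ some (α x []) := by
        rw [hread]
        by_cases ht : Trunk D (cls D x)
        · obtain ⟨t, ht, htx⟩ := ht
          rw [hL.trunk _ hxn t ht htx]
          intro h
          rw [Option.some.injEq, hL.state_ne (hDT ht) hxT] at h
          exact hxs' (h ▸ ht)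
        · rw [hL.non_trunk _ hxn fun s hs hsv => ht ⟨s, hs, hsv⟩]
          simp
      have hns : NewStates D R x := ⟨hxD, hxs', fun y hy =>
        ⟨(hRx y hy).1, (hRx y hy).2 x (by simp)⟩⟩
      by_cases hm : Marked ν μ.heap (cls D x)
      · -- a marked node
        have hm' : μ.heap (ν (cls D x) []) (.aux 0) ≠ none := hm
        refine runs_loop_step (by simp [h7]) ?_
        simp [h7, e0, e1, htr, hm']
        obtain ⟨hred, hchg⟩ := hR.skip hns hm
        refine rest _ _ (insert x R) U (.inr ⟨hxs', rfl⟩) (by omega) hred hU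
          ⟨le_rfl, fun _ _ _ => rfl, fun _ _ => rfl⟩ fun r hr => ?_
        simp [show r ≠ 15 by omega, show r ≠ 14 by omega, show r ≠ 8 by omega]
      · have hm' : μ.heap (ν (cls D x) []) (.aux 0) = none := by simpa [Marked] using hm
        refine runs_loop_step (by simp [h7]) ?_
        simp [h7, e0, e1, htr, hm']
        refine (walkFrom_spec hD hL ?_ ?_ (visitFlink_spec hL hDT hA') hxn ?_ ?_ ?_).mono
          ?_
        · exact fun done h h' => FlinkSet.congr
        · exact fun done h hj => hA'.trans hj.agree
        · simp
        · exact FlinkSet.refl notMem_stateLocs_nil _ _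
        · exact hn
        rintro t μ₁ ⟨out, hW, ht, hset, hw⟩
        rw [stateLocs_congr (vs' := out) (by simp)] at hset
        simp at hset
        have h14 : μ₁.reg 14 = some (ν (cls D x) []) := by
          rw [hw.reg 14 (by omega)]; simp
        have h7' : μ₁.reg 7 = some l := by
          rw [hw.reg 7 (by omega)]; simp [h7]
        refine ⟨_, h14, l, by simpa using h7', ?_⟩
        have hred := Redirected.step (h₂ := (μ₁.setField (ν (cls D x) []) (.aux 0)
          (μ₁.reg 14)).heap) hL hDT hR hns hW hset (by simp [h14]) (fun l hl f hne => by
            rw [Mem.setField_heap, if_neg hne])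
        obtain ⟨U', hU', hcard⟩ := exposed_insert hL.children hR.marks hns hred.marks hm hW hU
        have hout := hW.length_le_countP hL.children (good := fun v => Trunk D v ∨ Marked ν μ.heap v)
          (fun v => .inl) (fun v => id) (by simpa using hxn)
        have hcnt := countP_or_le (fun v => Trunk D v) (fun v => Marked ν μ.heap v) out
        have htrk : out.countP (fun v => Trunk D v ∧ ¬ Marked ν μ.heap v) ≤
            {t | t ∈ states D ∧ ∃ v ∈ out, ¬ Marked ν μ.heap v ∧ t ∈ v}.ncard := by
          convert countP_trunk_le hD (hW.mem_nodes hL.children (by simpa using hxn))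
            (hW.nodup_singleton hL.children hxn) fun v => ¬ Marked ν μ.heap v
        have hchg := changed_insert hD hL.children hR.marks hns hW
        rw [show μ₁.heap l (.aux 2) =
          (μ₁.setField (ν (cls D x) []) (.aux 0) (μ₁.reg 14)).heap l (.aux 2) by simp]
        refine rest _ _ (insert x R) U' (.inr ⟨hxs', rfl⟩) ?_ hred hU'
          ⟨by simpa using hw.fresh, fun i h1 h2 => ?_, fun _ _ => rfl⟩ fun r hr => ?_
        · generalize List.countP (fun v => decide (Marked ν μ.heap v)) out = a at *
          generalize List.countP (fun v => decide (Trunk D v ∨ Marked ν μ.heap v)) out = b at *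
          generalize List.countP (fun v => decide (Trunk D v ∧ ¬ Marked ν μ.heap v)) out = c at *
          omega
        · have := hw.scratch i h1 h2
          have hne : i ≠ ν (cls D x) [] := by
            have := hνlt _ hxn
            omega
          funext f
          simp [hne, this]
        · simp
          rw [hw.reg r (by omega)]
          simp [show r ≠ 15 by omega, show r ≠ 14 by omega, show r ≠ 8 by omega,
            show r ≠ 21 by omega]

/-- Removes the marks from the nodes of the entries of the list in register 6. -/
def unmark : Cmd := .block [.copy 7 6, .setNull 15,
  .loop (.nonNull 7) (.block [.load 14 7 (.aux 1), .store 14 (.aux 0) 15, .load 7 7 (.aux 2)])]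

theorem unmark_spec (hν : ∀ v ∈ nodes D, ν v [] < n) {μ : Mem} {k : ℕ} {xs : List (List A)}
    (hE : Entries D α ν n μ.fresh μ.heap (μ.reg 6) xs) (hxs : ∀ y ∈ xs, y ∈ substr D) :
    Runs unmark μ k fun t μ' => t ≤ k + 4 * xs.length + 3 ∧ μ'.fresh = μ.fresh ∧
      (∀ r < 7, μ'.reg r = μ.reg r) ∧ (∀ y ∈ xs, μ'.heap (ν (cls D y) []) (.aux 0) = none) ∧
      ∀ l f, μ'.heap l f ≠ μ.heap l f → ∃ y ∈ xs, l = ν (cls D y) [] ∧ f = .aux 0 := by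
  have main : ∀ (xs : List (List A)) (μ : Mem) (k : ℕ),
      Entries D α ν n μ.fresh μ.heap (μ.reg 7) xs → (∀ y ∈ xs, y ∈ substr D) →
      μ.reg 15 = none →
      Runs (.loop (.nonNull 7)
        (.block [.load 14 7 (.aux 1), .store 14 (.aux 0) 15, .load 7 7 (.aux 2)])) μ k fun t μ' =>
        t ≤ k + 4 * xs.length + 1 ∧ μ'.fresh = μ.fresh ∧
        (∀ r < 7, μ'.reg r = μ.reg r) ∧
        (∀ l, μ.heap l (.aux 0) = none → μ'.heap l (.aux 0) = none) ∧
        (∀ y ∈ xs, μ'.heap (ν (cls D y) []) (.aux 0) = none) ∧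
        ∀ l f, μ'.heap l f ≠ μ.heap l f → ∃ y ∈ xs, l = ν (cls D y) [] ∧ f = .aux 0 := by
    intro xs
    induction xs with
    | nil =>
      intro μ k hE _ _
      exact runs_loop_done (by simpa [Entries] using hE)
        ⟨by simp, rfl, fun _ _ => rfl, fun _ => id, by simp, by simp⟩
    | cons x xs ih =>
      intro μ k hE hxs h15
      obtain ⟨l, hl1, hl2, h7, e0, e1, hE⟩ := hE
      have hlt := hν _ (cls_mem_nodes (hxs x (by simp)))
      have l_ne : l ≠ ν (cls D x) [] := by omega
      refine runs_loop_step (by simp [h7]) ?_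
      simp [h7, e1, h15]
      refine (ih _ _ ?_ (fun y hy => hxs y (by simp [hy])) (by simpa using h15)).mono ?_
      · simp
        refine hE.congr le_rfl fun i h1 h2 => ?_
        funext f
        simp [show i ≠ ν (cls D x) [] by omega]
      · rintro t μ' ⟨ht, hf, hr, hkeep, hnull, hother⟩
        refine ⟨by omega, hf, fun r h => ?_, fun i hi => hkeep i ?_, ⟨hkeep _ ?_, hnull⟩, ?_⟩
        · rw [hr r h]
          simp [show r ≠ 7 by omega, show r ≠ 14 by omega]
        · simp [hi]
        · simp
        · intro i f hne
          by_cases hi : i = ν (cls D x) [] ∧ f = .aux 0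
          · exact .inl hi
          · refine .inr (hother i f ?_)
            simpa [hi] using hne
  simp [unmark]
  refine (main xs _ _ (by simpa using hE) hxs (by simp)).mono ?_
  rintro t μ' ⟨ht, hf, hr, -, hnull, hother⟩
  refine ⟨by omega, hf, fun r h => ?_, hnull, hother⟩
  rw [hr r h]
  simp [show r ≠ 7 by omega, show r ≠ 15 by omega]

end RedirectProgram

section Changes

variable {A : Type*} {D D' : Set (List A)} {p : List A}

/-- Only the suffixes matter. -/
theorem psuf_congr {P P' : Set (List A)} {t : List A} (h : ∀ w, w <:+ t → (w ∈ P ↔ w ∈ P')) :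
    psuf P t = psuf P' t := by
  cases hw : psuf P' t with
  | none =>
    rw [psuf_eq_none_iff] at hw ⊢
    exact fun w hwP hwt => hw w ((h w hwt).1 hwP) hwt
  | some w =>
    rw [psuf_eq_some_iff] at hw ⊢
    exact ⟨(h w hw.2.1.1).2 hw.1, hw.2.1, fun u hu hut => hw.2.2 u ((h u hut).1 hu) hut⟩

theorem psuf_states_nil : psuf (states D) [] = none :=
  psuf_eq_none_iff.2 fun _ _ hw => List.suffix_nil.1 hw

theorem psuf_states_ne_none {t : List A} (h : t ≠ []) : psuf (states D) t ≠ none :=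
  fun hn => h (psuf_eq_none_iff.1 hn [] nil_mem_states List.nil_suffix).symm

theorem failChanges_eq : failChanges D D' =
    {t | t ∈ states D ∧ t ∈ states D' ∧ psuf (states D) t ≠ psuf (states D') t}.ncard := by
  unfold failChanges
  congr 1
  ext t
  simp only [Set.mem_ofPred_eq, isFlink_iff]
  refine and_congr_right fun _ => and_congr_right fun _ => ?_
  constructor
  · rintro ⟨u, h1, h2⟩ h
    exact h2 (h ▸ h1)
  · intro h
    cases hu : psuf (states D) t with
    | none =>
      by_cases ht : t = []
      · subst ht
        rw [psuf_states_nil, psuf_states_nil] at h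
        exact absurd rfl h
      · exact absurd hu (psuf_states_ne_none ht)
    | some u => exact ⟨u, rfl, fun h' => h (hu.trans h'.symm)⟩

theorem outChanges_insert (hp : p ∉ D) :
    outChanges D (insert p D) = {t | t ∈ states D ∧ p <:+ t}.ncard := by
  unfold outChanges
  congr 1
  ext t
  simp only [Set.mem_ofPred_eq]
  refine and_congr_right fun ht => ?_
  have ht' : t ∈ states (insert p D) := by rw [states_insert]; exact .inl ht
  simp only [ht', true_and]
  constructor
  · intro h
    by_contra hpt
    refine h ?_
    ext q
    simp only [output, Set.mem_ofPred_eq, Set.mem_insert_iff]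
    refine ⟨fun h => ⟨.inr h.1, h.2⟩, ?_⟩
    rintro ⟨rfl | h, h'⟩
    · exact absurd h' hpt
    · exact ⟨h, h'⟩
  · intro h he
    have : p ∈ output D t := he ▸ ⟨Set.mem_insert _ _, h⟩
    exact hp this.1

theorem outChanges_diff (hp : p ∈ D) :
    outChanges D (D \ {p}) = {t | t ∈ states (D \ {p}) ∧ p <:+ t}.ncard := by
  unfold outChanges
  congr 1
  ext t
  simp only [Set.mem_ofPred_eq]
  have hsub : t ∈ states (D \ {p}) → t ∈ states D := by
    rintro (rfl | ⟨q, hq, hqt⟩)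
    · exact nil_mem_states
    · exact .inr ⟨q, hq.1, hqt⟩
  constructor
  · rintro ⟨-, ht, h⟩
    refine ⟨ht, ?_⟩
    by_contra hpt
    refine h ?_
    ext q
    simp only [output, Set.mem_ofPred_eq, Set.mem_sdiff, Set.mem_singleton_iff]
    refine ⟨fun h' => ⟨⟨h'.1, ?_⟩, h'.2⟩, fun h' => ⟨h'.1.1, h'.2⟩⟩
    rintro rfl
    exact hpt h'.2
  · rintro ⟨ht, hpt⟩
    refine ⟨hsub ht, ht, fun he => ?_⟩
    have : p ∈ output (D \ {p}) t := he ▸ ⟨hp, hpt⟩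
    exact this.1.2 rfl

end Changes

section Retarget

variable {A : Type*} {enc : A → List Bool} {D : Set (List A)} {p : List A}
    {α : List A → List Bool → ℕ} {ν : Set (List A) → List Bool → ℕ}
    {ch : Set (List A) → List (Set (List A))} {n : ℕ} {pp : Option ℕ}

/-- Redirects the failure links of old states to new states. -/
def retarget : Cmd := .block [listPrefixes, .copy 7 6, redirectLoop, unmark]

theorem changed_le (hD : D.Finite) {R : Set (List A)} (hR : ∀ t ∈ states D,
    psuf (states D ∪ R) t = psuf (states (insert p D)) t) :
    changed D R ≤ failChanges D (insert p D) := by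
  rw [failChanges_eq]
  refine Set.ncard_le_ncard ?_ ((states_finite hD).subset fun t ht => ht.1)
  rintro t ⟨ht, hne⟩
  refine ⟨ht, by rw [states_insert]; exact .inl ht, fun h => hne ?_⟩
  rw [hR t ht, h]

theorem retarget_spec {K : ℕ} (hE : Function.Injective enc) (hK : ∀ c, (enc c).length = K)
    (hD : D.Finite) {μ : Mem} (hL : Layout enc (insert p D) D p α ν ch n pp μ.heap)
    (hR : Anchored α ν D pp μ) (hn : n ≤ μ.fresh)
    (hlinks : Links α (states D) .flink (psuf (states D)) μ.heap)
    (haux : ∀ v ∈ nodes D, μ.heap (ν v []) (.aux 0) = none) :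
    Runs retarget μ 0 fun t μ' =>
      t ≤ p.length * (12 * K + 225) + 100 * failChanges D (insert p D) + 10 ∧
      Anchored α ν D pp μ' ∧ n ≤ μ'.fresh ∧
      Links α (states D) .flink (psuf (states (insert p D))) μ'.heap ∧
      ∀ l < n, ∀ f, (f = .flink → ∀ t ∈ states D, l ≠ α t []) → μ'.heap l f = μ.heap l f := by
  classical
  have hDT : states D ⊆ states (insert p D) := by
    rw [states_insert]; exact Set.subset_union_left
  have hpT : p ∈ states (insert p D) := mem_states_of_mem (Set.mem_insert _ _)
  have hαlt : ∀ t ∈ states D, α t [] < n := fun t ht =>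
    hL.state_lt _ _ (stateLive_nil (hDT ht))
  have hνlt : ∀ v ∈ nodes D, ν v [] < n := fun v hv => hL.node_lt _ _ (nodeLive_nil hv)
  simp only [retarget, runs_block_cons, runs_block_one, runs_copy]
  refine (listPrefixes_spec hE hK hpT hL hR hn).mono ?_
  rintro t₁ μ₁ ⟨ht₁, hR₁, hn₁, hh₁, xs, hxs, hmem, hpw, hlen⟩
  have hxsD : ∀ y ∈ xs, y ∈ substr D := fun y hy => ((hmem y).1 hy).2.2
  obtain ⟨R, hRdef⟩ : ∃ R, R = {x | x ∈ xs ∧ x ∉ states D} := ⟨_, rfl⟩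
  have hRp : ∀ t ∈ states D, psuf (states D ∪ R) t = psuf (states (insert p D)) t := by
    intro t ht
    refine psuf_congr fun w hwt => ?_
    rw [states_insert]
    simp only [Set.mem_union, hRdef, Set.mem_ofPred_eq, hmem]
    constructor
    · rintro (h | h)
      · exact .inl h
      · exact .inr h.1.1
    · rintro (h | h)
      · exact .inl h
      · by_cases hw : w ∈ states D
        · exact .inl hw
        · refine .inr ⟨⟨h, ?_, mem_substr_of_suffix hwt (mem_substr_of_mem_states ht)⟩, hw⟩
          rintro rfl
          exact hw nil_mem_states
  have hA₁ : Agree n μ.heap μ₁.heap := fun l hl f _ => by rw [hh₁ l hl]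
  have hinit : Redirected D α ν n μ.heap ∅ μ₁.heap := by
    refine ⟨fun s hs => ?_, fun v hv => ?_, fun l hl f _ _ => by rw [hh₁ l hl]⟩
    · rw [hh₁ _ (hαlt s hs), Set.union_empty]; exact hlinks s hs
    · simp [Marked, hh₁ _ (hνlt v hv), haux v hv]
  refine (redirectLoop_spec hD hL hDT (Agree.refl n μ.heap) xs (μ₁.setReg 7 (μ₁.reg 6)) _ ∅ ∅
    (by simpa using hxs) (fun y hy => ⟨hxsD y hy, mem_states_of_prefix ((hmem y).1 hy).1 hpT⟩) hpw
    (by simp) (by simpa using hinit) ?_ (by simpa using hn₁)).mono ?_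
  · intro w hw hm
    obtain ⟨x, hx, -⟩ := (hinit.marks w hw).1 hm
    exact absurd hx (Set.notMem_empty _)
  · rintro t₂ μ₂ ⟨ht₂, hred, hw, hr₂⟩
    rw [Set.empty_union, ← hRdef] at ht₂ hred
    have hch0 : changed D ∅ = 0 := by simp [changed]
    have hch := changed_le hD hRp
    have hxs₂ : Entries D α ν n μ₂.fresh μ₂.heap (μ₂.reg 6) xs := by
      have := hxs.congr hw.fresh hw.scratch
      rw [hr₂ 6 (by omega)]
      simpa using this
    refine (unmark_spec hνlt hxs₂ hxsD).mono ?_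
    rintro t₃ μ₃ ⟨ht₃, hf₃, hr₃, hnull, hother⟩
    have hreg : ∀ r < 3, μ₃.reg r = μ₁.reg r := by
      intro r hr
      rw [hr₃ r (by omega), hr₂ r (by omega)]
      simp [show r ≠ 7 by omega]
    have hkeep : ∀ l f, f ≠ .aux 0 → μ₃.heap l f = μ₂.heap l f := by
      intro l f hf
      by_contra hne
      obtain ⟨y, -, -, h⟩ := hother l f hne
      exact hf h
    refine ⟨?_, ⟨?_, ?_, ?_⟩, ?_, fun s hs => ?_, fun l hl f hf => ?_⟩
    · simp only [hch0, Finset.card_empty] at ht₂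
      have : p.length * (12 * K + 225) = p.length * (12 * K + 21) + 204 * p.length := by ring
      omega
    · rw [hreg 0 (by omega)]; exact hR₁.root
    · rw [hreg 1 (by omega)]; exact hR₁.source
    · rw [hreg 2 (by omega)]; exact hR₁.pattern
    · rw [hf₃]; exact hn₁.trans hw.fresh
    · rw [hkeep _ _ (by simp), ← hRp s hs]
      exact hred.links s hs
    · by_cases hnode : f = .aux 0 ∧ ∃ v ∈ nodes D, l = ν v []
      · obtain ⟨rfl, v, hv, rfl⟩ := hnode
        rw [haux v hv]
        by_contra hne
        have h2 : μ₃.heap (ν v []) (.aux 0) = μ₂.heap (ν v []) (.aux 0) := by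
          by_contra hne'
          obtain ⟨y, hy, he, -⟩ := hother _ _ hne'
          exact hne (he ▸ hnull y hy)
        rw [h2] at hne
        obtain ⟨x, hx, hxv⟩ := (hred.marks v hv).1 hne
        obtain ⟨-, rfl⟩ := eq_cls_of_mem hv hxv
        rw [← h2] at hne
        exact hne (hnull x (hRdef ▸ hx).1)
      · have h3 : μ₃.heap l f = μ₂.heap l f := by
          by_contra hne
          obtain ⟨y, hy, he, hf⟩ := hother _ _ hne
          exact hnode ⟨hf, _, cls_mem_nodes (hxsD y hy), he⟩
        rw [h3]
        refine hred.other l hl f hf fun h v hv he => hnode ⟨h, v, hv, he⟩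

end Retarget

/-! ### The failure links and outputs of the prefixes of the new pattern -/

section LinkNew

variable {A : Type*} {enc : A → List Bool} {T D : Set (List A)} {p : List A}
    {α : List A → List Bool → ℕ} {ν : Set (List A) → List Bool → ℕ}
    {ch : Set (List A) → List (Set (List A))} {n : ℕ} {pp : Option ℕ}

/-- The states with an outgoing transition for `c`. -/
def sources (T : Set (List A)) (c : A) : Set (List A) := {y | y ++ [c] ∈ states T}

theorem sources_subset (T : Set (List A)) (c : A) : sources T c ⊆ states T :=
  fun _ hy => mem_states_of_prefix ⟨[c], rfl⟩ hy

/-- The failure link of `x ++ [c]` extends a proper suffix of `x`, or is the root. -/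
theorem psuf_states_concat (x : List A) (c : A) :
    psuf (states T) (x ++ [c]) =
      some (((psuf (states T) x).bind (lsuf (sources T c))).elim [] (· ++ [c])) := by
  rw [← psuf_eq_bind (sources_subset T c)]
  have key : ∀ w, w ∈ states T → w <:+ x ++ [c] → w ≠ x ++ [c] → w = [] ∨
      ∃ v, w = v ++ [c] ∧ v ∈ sources T c ∧ v <:+ x ∧ v ≠ x := by
    intro w hw hs hne
    rcases List.suffix_concat_iff.1 hs with rfl | ⟨v, hv, hvx⟩
    · exact .inl rfl
    · subst hv
      exact .inr ⟨v, rfl, hw, hvx, fun h => hne (by rw [h])⟩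
  cases hv : psuf (sources T c) x with
  | none =>
    refine psuf_eq_some_iff.2 ⟨nil_mem_states, ⟨List.nil_suffix, by simp⟩, fun w hw hs hne => ?_⟩
    rcases key w hw hs hne with rfl | ⟨v, rfl, hv', hvx, hne'⟩
    · exact le_rfl
    · exact absurd (psuf_eq_none_iff.1 hv v hv' hvx) hne'
  | some v =>
    obtain ⟨h1, ⟨h2, h3⟩, h4⟩ := psuf_eq_some_iff.1 hv
    refine psuf_eq_some_iff.2 ⟨h1, ⟨?_, by simpa using h3⟩, fun w hw hs hne => ?_⟩
    · obtain ⟨z, rfl⟩ := h2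
      exact ⟨z, by simp⟩
    · rcases key w hw hs hne with rfl | ⟨u, rfl, hu, hux, hne'⟩
      · simp
      · have := h4 u hu hux hne'
        simpa using this

/-- The length of a string, plus 1; 0 if there is no string. -/
def depth (o : Option (List A)) : ℕ := o.elim 0 fun u => u.length + 1

/-- Follows failure links from the state in register 16 until there is a transition for the letter
with code word in register 13. The target of the transition, or null, goes to register 17. -/
def searchLoop : Cmd := .loop (.nonNull 16) (.block [.copy 10 16, .copy 11 13, follow,
  .cond (.isNull 10) (.load 16 16 .flink) (.block [.copy 17 10, .setNull 16])])

/-- Every failure link that is followed decreases the depth of the state in register 16, which pays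
for the step. -/
theorem searchLoop_spec {K : ℕ} (hE : Function.Injective enc) (hK : ∀ c, (enc c).length = K)
    {h : Heap} (hL : Layout enc T D p α ν ch n pp h) {c : A} {N : ℕ}
    (hl : Links α {u | u ∈ states T ∧ u.length ≤ N} .flink (psuf (states T)) h) :
    ∀ (N' : ℕ) (o : Option (List A)) (μ : Mem) (k : ℕ), depth o ≤ N' →
    (∀ u, o = some u → u ∈ states T ∧ u.length ≤ N) → μ.heap = h →
    μ.reg 16 = o.map (fun u => α u []) → μ.reg 17 = none →
    BitsStored h {l | l < n} (μ.reg 13) (enc c) →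
    Runs searchLoop μ k fun t μ' => μ.OnlyRegs [10, 11, 12, 16, 17] μ' ∧
      μ'.reg 17 = (o.bind (lsuf (sources T c))).map (fun v => α (v ++ [c]) []) ∧
      t + (6 * K + 9) * depth (o.bind (lsuf (sources T c))) ≤
        k + (6 * K + 9) * (depth o + 1) + 1 := by
  intro N'
  induction N' with
  | zero =>
    intro o μ k hN' ho hh h16 h17 hB
    cases o with
    | none => exact runs_loop_done (by simp [h16]) ⟨⟨rfl, rfl, fun _ _ => rfl⟩, by simp [h17],
        by simp [depth]⟩
    | some u => simp [depth] at hN'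
  | succ N' ih =>
    intro o μ k hN' ho hh h16 h17 hB
    cases o with
    | none => exact runs_loop_done (by simp [h16]) ⟨⟨rfl, rfl, fun _ _ => rfl⟩, by simp [h17],
        by simp [depth]⟩
    | some u =>
      obtain ⟨hu, huN⟩ := ho u rfl
      simp only [Option.map_some] at h16
      refine Runs.of_forall fun Q hQ => runs_loop_step (by simp [h16]) ?_
      simp only [runs_block_cons, runs_block_one, runs_copy]
      refine follow_tree (a := u) (c := c) hE hK (E := IsGoto T) (addr := α)
        (S := {l | l < n}) ?_ ?_ ?_ ?_
      · simpa [hh] using hL.goto u hu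
      · simpa [hh] using hB
      · simpa using h16
      · intro k₁ μ₁ hk₁ hμ₁ hg hn
        have h16' : μ₁.reg 16 = some (α u []) := by rw [hμ₁.reg 16 (by simp)]; simp [h16]
        have hheap : μ₁.heap = h := by rw [hμ₁.heap]; simpa using hh
        by_cases hy : u ∈ sources T c
        · have h10 := hg _ ⟨hu, hy, rfl⟩
          have hlsuf : (some u).bind (lsuf (sources T c)) = some u := lsuf_of_mem hy
          simp [h10]
          refine runs_loop_done (by simp) (hQ _ _ ⟨⟨?_, ?_, fun r hr => ?_⟩, ?_, ?_⟩)
          · simpa using hμ₁.heap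
          · simpa using hμ₁.fresh
          · simp at hr
            simp [hr]
            rw [hμ₁.reg r (by simp [hr])]
            simp [hr]
          · rw [hlsuf]; simp
          · rw [hlsuf]
            have : (6 * K + 9) * (depth (some u) + 1) = (6 * K + 9) * depth (some u) + (6 * K + 9) := by
              ring
            omega
        · have h10 : μ₁.reg 10 = none := hn fun w hw => hy (show u ++ [c] ∈ states T from hw.2.2 ▸ hw.2.1)
          have hlsuf : (some u).bind (lsuf (sources T c)) =
              (psuf (states T) u).bind (lsuf (sources T c)) := by
            rw [Option.bind_some, lsuf_of_notMem hy, psuf_eq_bind (sources_subset T c)]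
          have hdep : depth (psuf (states T) u) + 1 ≤ depth (some u) := by
            cases hw : psuf (states T) u with
            | none => simp [depth]
            | some w =>
              have := psuf_length_lt hw
              simp [depth]; omega
          simp [h10, h16', hheap, hl u ⟨hu, huN⟩]
          refine (ih (psuf (states T) u) _ _ (by omega) ?_ (by simpa using hheap) (by simp) ?_ ?_).mono
            ?_
          · intro w hw
            have := psuf_length_lt hw
            exact ⟨psuf_mem hw, by omega⟩
          · simp; rw [hμ₁.reg 17 (by simp)]; simpa using h17
          · simp; rw [hμ₁.reg 13 (by simp)]; simpa using hB
          · rintro t μ' ⟨hμ', h17', ht⟩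
            refine hQ _ _ ⟨⟨?_, ?_, fun r hr => ?_⟩, ?_, ?_⟩
            · rw [hμ'.heap]; simpa [hh] using hheap
            · rw [hμ'.fresh]; simpa using hμ₁.fresh
            · rw [hμ'.reg r hr]
              simp at hr
              simp [hr]
              rw [hμ₁.reg r (by simp [hr])]
              simp [hr]
            · rw [hlsuf, h17']
            · rw [hlsuf]
              have h1 : (6 * K + 9) * (depth (psuf (states T) u) + 1) + (6 * K + 9) ≤
                  (6 * K + 9) * (depth (some u) + 1) := by
                rw [← Nat.mul_succ]
                exact Nat.mul_le_mul_left _ (by omega)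
              omega

/-- Computes the failure links and outputs of the prefixes of the pattern; the pattern itself does
not count as an output yet. -/
def linkNew : Cmd := .block [.setNull 16, forPrefixes (.block [
  .setNull 17, searchLoop, .cond (.isNull 17) (.copy 17 0) .skip,
  .store 4 .flink 17, .copy 16 17,
  .load 18 4 .out, .cond (.same 18 4) .skip (.block [.load 18 17 .out, .store 4 .out 18])])]

/-- The automaton after the prefixes of `x` have been processed. -/
structure Linked (D : Set (List A)) (p : List A) (α : List A → List Bool → ℕ) (h₀ : Heap)
    (x : List A) (h : Heap) : Prop where
  flink : Links α {u | u ∈ states (insert p D) ∧ (u ∈ states D ∨ u <+: x)} .flink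
    (psuf (states (insert p D))) h
  out : Links α {u | u ∈ states (insert p D) ∧ (u ∈ states D ∨ u <+: x)} .out (lsuf D) h
  later : ∀ u ∈ states (insert p D), u ∉ states D → ¬ u <+: x → h (α u []) .out = none
  other : ∀ l f, ((f = .flink ∨ f = .out) → ∀ u ∈ states (insert p D), l ≠ α u []) → h l f = h₀ l f

theorem linkNew_spec {K : ℕ} (hE : Function.Injective enc) (hK : ∀ c, (enc c).length = K)
    {μ : Mem} (hL : Layout enc (insert p D) D p α ν ch n pp μ.heap)
    (hR : Anchored α ν D pp μ)
    (hfl : Links α (states D) .flink (psuf (states (insert p D))) μ.heap)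
    (hout : Links α (states D) .out (lsuf D) μ.heap)
    (hnew : ∀ s ∈ states (insert p D), s ∉ states D → μ.heap (α s []) .out = none) :
    Runs linkNew μ 0 fun t μ' => t ≤ p.length * (24 * K + 50) + 5 ∧
      Anchored α ν D pp μ' ∧ μ'.fresh = μ.fresh ∧ Linked D p α μ.heap p μ'.heap ∧
      μ'.reg 16 = (psuf (states (insert p D)) p).map (fun u => α u []) ∧
      μ'.reg 4 = some (α p []) ∧ μ'.reg 5 = nodePtr D ν p := by
  have hDT : states D ⊆ states (insert p D) := by
    rw [states_insert]; exact Set.subset_union_left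
  have hpT : p ∈ states (insert p D) := mem_states_of_mem (Set.mem_insert _ _)
  simp [linkNew]
  refine (forPrefixes_spec hE hK hpT hL (Inv := fun x k μ' =>
      k + (6 * K + 9) * depth (psuf (states (insert p D)) x) ≤ x.length * (24 * K + 50) + 5 ∧
      Anchored α ν D pp μ' ∧ μ'.fresh = μ.fresh ∧ Linked D p α μ.heap x μ'.heap ∧
      μ'.reg 16 = (psuf (states (insert p D)) x).map (fun u => α u [])) ?_ ?_ ?_ ?_).mono ?_
  · rintro x k μ' ⟨-, h1, -, h2, -⟩
    refine ⟨fun l hl f hf => h2.other l f ?_, h1⟩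
    rintro (rfl | rfl) <;> exact absurd hf id
  · rintro x k μ' μ'' ⟨h0, h1, h2, h3, h4⟩ hμ
    refine ⟨h0, ⟨?_, ?_, ?_⟩, by rwa [hμ.fresh], by rwa [hμ.heap], ?_⟩
    · rw [hμ.reg 0 (by simp)]; exact h1.root
    · rw [hμ.reg 1 (by simp)]; exact h1.source
    · rw [hμ.reg 2 (by simp)]; exact h1.pattern
    · rw [hμ.reg 16 (by simp)]; exact h4
  · rintro x c rest k μ₁ hx ⟨h0, h1, h2, h3, h16⟩ h4 h5 hB
    have hA : Agree n μ.heap μ₁.heap := by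
      refine fun l hl f hf => h3.other l f ?_
      rintro (rfl | rfl) <;> exact absurd hf id
    have hL' := hL.congr hA
    have hxc : x ++ [c] ∈ states (insert p D) := mem_states_of_prefix ⟨rest, by simp [hx]⟩ hpT
    have hxp : x <+: p := ⟨c :: rest, hx.symm⟩
    have hxcp : x ++ [c] <+: p := ⟨rest, by simp [hx]⟩
    have hshort : ∀ u ∈ states (insert p D), u.length ≤ x.length → u ∈ states D ∨ u <+: x := by
      intro u hu hlen
      rw [states_insert] at hu
      rcases hu with hu | hu
      · exact .inl hu
      · exact .inr (List.prefix_of_prefix_length_le hu hxp hlen)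
    have hshort' : ∀ u ∈ states (insert p D), u.length ≤ x.length →
        u ∈ states (insert p D) ∧ (u ∈ states D ∨ u <+: x) := fun u hu hlen => ⟨hu, hshort u hu hlen⟩
    refine Runs.of_forall fun Q hQ => ?_
    simp only [runs_block_cons, runs_setNull]
    refine (searchLoop_spec hE hK hL' (c := c) (N := x.length)
      (fun u hu => h3.flink u (hshort' u hu.1 hu.2)) _ (psuf (states (insert p D)) x) _ _ le_rfl ?_
      ?_ ?_ ?_ ?_).mono ?_
    · exact fun u hu => ⟨psuf_mem hu, (psuf_length_lt hu).le⟩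
    · rfl
    · simpa using h16
    · simp
    · simpa using hB
    rintro t μ₂ ⟨hμ₂, h17, ht⟩
    -- the failure link
    obtain ⟨g, hg⟩ : ∃ g, psuf (states (insert p D)) (x ++ [c]) = some g :=
      ⟨_, psuf_states_concat x c⟩
    have hg' := hg
    rw [psuf_states_concat, Option.some.injEq] at hg'
    have hgT := psuf_mem hg
    have hglt := psuf_length_lt hg
    have hdep : depth (some g) =
        depth ((psuf (states (insert p D)) x).bind (lsuf (sources (insert p D) c))) + 1 := by
      rw [← hg']
      cases ((psuf (states (insert p D)) x).bind (lsuf (sources (insert p D) c))) <;> simp [depth]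
    have hgx : g.length ≤ x.length := by simpa [Nat.lt_succ_iff] using hglt
    have hgne : g ≠ x ++ [c] := by rintro rfl; omega
    have hout_g := h3.out g (hshort' g hgT hgx)
    have heap₂ : μ₂.heap = μ₁.heap := by rw [hμ₂.heap]; rfl
    have hαne : α g [] ≠ α (x ++ [c]) [] := fun h => hgne ((hL.state_ne hgT hxc).1 h)
    have hreg₂ : ∀ r ∉ [10, 11, 12, 16, 17], μ₂.reg r = μ₁.reg r := by
      intro r hr
      rw [hμ₂.reg r hr]
      simp at hr
      simp [hr]
    have h4₂ : μ₂.reg 4 = some (α (x ++ [c]) []) := by rw [hreg₂ 4 (by simp), h4]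
    -- from the place where register 17 holds the failure link
    have key : ∀ (k₃ : ℕ) (μ₃ : Mem), k₃ ≤ t + 2 → μ₂.OnlyRegs [17] μ₃ →
        μ₃.reg 17 = some (α g []) →
        Runs (.block [.store 4 .flink 17, .copy 16 17,
          .load 18 4 .out, .cond (.same 18 4) .skip (.block [.load 18 17 .out, .store 4 .out 18])])
          μ₃ k₃ Q := by
      intro k₃ μ₃ hk₃ hμ₃ h17₃
      have h4₃ : μ₃.reg 4 = some (α (x ++ [c]) []) := by rw [hμ₃.reg 4 (by simp), h4₂]
      have heap₃ : μ₃.heap = μ₁.heap := by rw [hμ₃.heap, heap₂]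
      have hfresh₃ : μ₃.fresh = μ.fresh := by
        rw [hμ₃.fresh, hμ₂.fresh]; exact h2
      have fin : ∀ (k₄ : ℕ) (μ₄ : Mem), k₄ ≤ k₃ + 6 → μ₄.fresh = μ₃.fresh →
          (∀ r, r ≠ 16 → r ≠ 18 → μ₄.reg r = μ₃.reg r) → μ₄.reg 16 = some (α g []) →
          μ₄.heap (α (x ++ [c]) []) .flink = some (α g []) →
          μ₄.heap (α (x ++ [c]) []) .out = (lsuf D (x ++ [c])).map (fun u => α u []) →
          (∀ l f, ((f = .flink ∨ f = .out) → l ≠ α (x ++ [c]) []) → μ₄.heap l f = μ₁.heap l f) →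
          Q k₄ μ₄ := by
        intro k₄ μ₄ hk₄ hf₄ hr₄ h16₄ hfl₄ hout₄ ho₄
        have hr : ∀ r ∉ [10, 11, 12, 16, 17, 18], μ₄.reg r = μ₁.reg r := by
          intro r hr
          simp at hr
          rw [hr₄ r (by tauto) (by tauto), hμ₃.reg r (by simp; tauto), hreg₂ r (by simp; tauto)]
        have hne : ∀ u ∈ states (insert p D), u ≠ x ++ [c] → α u [] ≠ α (x ++ [c]) [] :=
          fun u hu hne h => hne ((hL.state_ne hu hxc).1 h)
        have hmem : ∀ u, u ∈ states (insert p D) ∧ (u ∈ states D ∨ u <+: x ++ [c]) →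
            u = x ++ [c] ∨
            (u ≠ x ++ [c] ∧ (u ∈ states (insert p D) ∧ (u ∈ states D ∨ u <+: x))) := by
          rintro u ⟨hu, h⟩
          by_cases he : u = x ++ [c]
          · exact .inl he
          · refine .inr ⟨he, hu, h.imp id fun h => ?_⟩
            rcases List.prefix_concat_iff.1 h with h | h
            · exact absurd h he
            · exact h
        refine hQ _ _ ⟨fun r hr' => hr r (by fin_cases hr' <;> simp), ?_, ⟨?_, ?_, ?_⟩, ?_,
          ⟨fun u hu => ?_, fun u hu => ?_, fun u hu huD hux => ?_, fun l f hlf => ?_⟩, ?_⟩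
        · rw [hg, hdep, List.length_append, List.length_singleton]
          generalize depth ((psuf (states (insert p D)) x).bind (lsuf (sources (insert p D) c))) = d
            at ht ⊢
          have e1 : (x.length + 1) * (24 * K + 50) = x.length * (24 * K + 50) + (24 * K + 50) := by
            ring
          have e2 : ∀ d, (6 * K + 9) * (d + 1) = (6 * K + 9) * d + (6 * K + 9) := fun d => by ring
          rw [e2] at ht
          rw [e1, e2]
          omega
        · rw [hr 0 (by simp)]; exact h1.root
        · rw [hr 1 (by simp)]; exact h1.source
        · rw [hr 2 (by simp)]; exact h1.pattern
        · rw [hf₄, hfresh₃]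
        · rcases hmem u hu with rfl | ⟨hne', hu⟩
          · rw [hfl₄, hg]; rfl
          · rw [ho₄ _ _ fun _ => hne u hu.1 hne']
            exact h3.flink u hu
        · rcases hmem u hu with rfl | ⟨hne', hu⟩
          · rw [hout₄]
          · rw [ho₄ _ _ fun _ => hne u hu.1 hne']
            exact h3.out u hu
        · have hne' : u ≠ x ++ [c] := by rintro rfl; exact hux List.prefix_rfl
          rw [ho₄ _ _ fun _ => hne u hu hne']
          exact h3.later u hu huD fun h => hux (h.trans ⟨[c], rfl⟩)
        · rw [ho₄ l f fun h => hlf h _ hxc]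
          exact h3.other l f hlf
        · rw [h16₄, hg]; rfl
      have hval : x ++ [c] ∉ D → lsuf D (x ++ [c]) = lsuf D g := by
        intro hxcD
        rw [lsuf_of_notMem hxcD, psuf_eq_bind (Y := D) (S := states (insert p D))
          (fun q hq => hDT (mem_states_of_mem hq)), hg]
        rfl
      have hold : μ₁.heap (α (x ++ [c]) []) .out = some (α (x ++ [c]) []) ↔ x ++ [c] ∈ D := by
        constructor
        · intro h
          by_cases hD : x ++ [c] ∈ states D
          · rw [h3.out _ ⟨hxc, .inl hD⟩] at h
            cases hq : lsuf D (x ++ [c]) with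
            | none => rw [hq] at h; simp at h
            | some q =>
              rw [hq, Option.map_some, Option.some.injEq, hL.state_ne
                (hDT (mem_states_of_mem (lsuf_mem hq))) hxc] at h
              exact h ▸ lsuf_mem hq
          · rw [h3.later _ hxc hD (fun h => by have := h.length_le; simp at this)] at h
            simp at h
        · intro hD
          rw [h3.out _ ⟨hxc, .inl (mem_states_of_mem hD)⟩, lsuf_of_mem hD]
          rfl
      by_cases hxcD : x ++ [c] ∈ D
      · simp [h4₃, h17₃, heap₃, hold.2 hxcD]
        refine fin _ _ (by omega) (by simp) (fun r h h' => by simp [h, h']) (by simp) (by simp) ?_ ?_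
        · simp [heap₃, hold.2 hxcD, lsuf_of_mem hxcD]
        · intro l f hlf
          have : ¬ (l = α (x ++ [c]) [] ∧ f = .flink) := fun h => hlf (.inl h.2) h.1
          simp [this, heap₃]
      · have hold' := mt hold.1 hxcD
        simp [h4₃, h17₃, heap₃, hold']
        refine fin _ _ (by omega) (by simp) (fun r h h' => by simp [h, h']) (by simp) (by simp) ?_ ?_
        · simp [hval hxcD, hout_g]
        · intro l f hlf
          have h1 : ¬ (l = α (x ++ [c]) [] ∧ f = .flink) := fun h => hlf (.inl h.2) h.1
          have h2 : ¬ (l = α (x ++ [c]) [] ∧ f = .out) := fun h => hlf (.inr h.2) h.1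
          simp [h1, h2, heap₃]
    simp only [runs_block_cons] at key
    have h0₂ : μ₂.reg 0 = some (α [] []) := by rw [hreg₂ 0 (by simp), h1.root]
    cases hw : (psuf (states (insert p D)) x).bind (lsuf (sources (insert p D) c)) with
    | none =>
      rw [hw] at h17 hg'
      simp only [Option.map_none] at h17
      have hg0 : [] = g := hg'
      refine runs_cond.2 ⟨fun _ => runs_copy.2 (key _ _ ?_ ⟨rfl, rfl, fun r hr => ?_⟩ ?_),
        fun h => absurd h17 h⟩
      · omega
      · simp at hr; simp [hr]
      · simp [h0₂, hg0]
    | some v =>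
      rw [hw] at h17 hg'
      have hgv : v ++ [c] = g := hg'
      simp only [Option.map_some, hgv] at h17
      refine runs_cond.2 ⟨fun h => ?_, fun _ => runs_skip.2 (key _ _ ?_ ⟨rfl, rfl, fun r hr => rfl⟩
        h17)⟩
      · rw [holds_isNull, h17] at h
        simp at h
      · omega
  · refine ⟨by simp [psuf_states_nil, depth], ⟨by simp [hR.root], by simp [hR.source],
      by simp [hR.pattern]⟩, rfl, ⟨?_, ?_, ?_, fun _ _ _ => rfl⟩, by simp [psuf_states_nil]⟩
    · rintro u ⟨-, hu | hu⟩
      · exact hfl u hu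
      · obtain rfl := List.prefix_nil.1 hu
        exact hfl [] nil_mem_states
    · rintro u ⟨-, hu | hu⟩
      · exact hout u hu
      · obtain rfl := List.prefix_nil.1 hu
        exact hout [] nil_mem_states
    · intro u hu huD _
      exact hnew u hu huD
  · rintro t μ' ⟨κ, hκ, ⟨h1, h2, h3, h4, h5⟩, h6, h7⟩
    exact ⟨by omega, h2, h3, h4, h5, h6, h7⟩

end LinkNew

/-! ### Outputs of the states below the node of the pattern -/

section Outputs

variable {A : Type*} {enc : A → List Bool} {T D : Set (List A)} {p : List A}
    {α : List A → List Bool → ℕ} {ν : Set (List A) → List Bool → ℕ}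
    {ch : Set (List A) → List (Set (List A))} {n : ℕ} {pp : Option ℕ}

/-- The locations of the states of `D` with suffix `p`. -/
def superLocs (D : Set (List A)) (p : List A) (α : List A → List Bool → ℕ) : Set ℕ :=
  {l | ∃ t ∈ states D, p <:+ t ∧ l = α t []}

theorem Layout.mem_superLocs {h : Heap} (hL : Layout enc T D p α ν ch n pp h)
    (hDT : states D ⊆ states T) {t : List A} (ht : t ∈ states T) :
    α t [] ∈ superLocs D p α ↔ t ∈ states D ∧ p <:+ t := by
  constructor
  · rintro ⟨t', ht', hp, he⟩
    obtain rfl := (hL.state_ne ht (hDT ht')).1 he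
    exact ⟨ht', hp⟩
  · rintro ⟨ht', hp⟩
    exact ⟨t, ht', hp, rfl⟩

/-- At least half of the visited nodes are trunk nodes, one for each state of `D` with suffix `p`. -/
theorem walkOut_spec {h₀ : Heap} (hD : D.Finite) (hL : Layout enc T D p α ν ch n pp h₀)
    (hDT : states D ⊆ states T) (hp : p ∈ substr D) {μ : Mem} (hA : Agree n h₀ μ.heap)
    (h21 : μ.reg 21 = some (ν (cls D p) [])) (hn : n ≤ μ.fresh) {k : ℕ} :
    Runs (walkFrom visitOut) μ k fun t μ' =>
      t ≤ k + 88 * {t | t ∈ states D ∧ p <:+ t}.ncard ∧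
      OutReplaced n (superLocs D p α) (μ.reg 8) (μ.reg 9) μ.heap μ'.heap ∧
      Walked n μ.reg μ μ' := by
  classical
  have hpn := cls_mem_nodes hp
  refine (walkFrom_spec hD hL ?_ ?_ (visitOut_spec hL hDT hA) hpn h21 ?_ hn).mono ?_
  · exact fun done h h' => OutReplaced.congr
  · exact fun done h hj => hA.trans hj.agree
  · exact OutReplaced.refl notMem_stateLocs_nil _ _ _
  · rintro t μ' ⟨out, hW, ht, hj, hw⟩
    have hiff : ∀ t ∈ states D, ((∃ v ∈ out, True ∧ t ∈ v) ↔ p <:+ t) := fun t ht =>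
      hW.exists_mem_iff_suffix hL.children hp ht
    refine ⟨?_, ?_, hw⟩
    · have h1 := hW.length_le_countP hL.children (good := Trunk D) (fun _ => id) (by simp)
        (by simpa using hpn)
      have h2 := countP_trunk_le hD (hW.mem_nodes hL.children (by simpa using hpn))
        (hW.nodup_singleton hL.children hpn) fun _ => True
      have h3 : {t | t ∈ states D ∧ ∃ v ∈ out, True ∧ t ∈ v} = {t | t ∈ states D ∧ p <:+ t} :=
        Set.ext fun t => and_congr_right fun ht => hiff t ht
      have h4 : out.countP (Trunk D) = out.countP (fun v => Trunk D v ∧ True) := by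
        congr 1
        simp
      rw [h3] at h2
      have h5 : out.countP (Trunk D) ≤ {t | t ∈ states D ∧ p <:+ t}.ncard := by
        refine le_trans (le_of_eq ?_) h2
        rw [h4]
        congr!
      omega
    · have : stateLocs D α out.reverse (fun _ => True) = superLocs D p α := by
        ext l
        simp only [stateLocs, superLocs, Set.mem_ofPred_eq, List.mem_reverse]
        constructor
        · rintro ⟨t, ht, v, hv, -, htv, rfl⟩
          exact ⟨t, ht, (hiff t ht).1 ⟨v, hv, trivial, htv⟩, rfl⟩
        · rintro ⟨t, ht, hpt, rfl⟩
          obtain ⟨v, hv, -, htv⟩ := (hiff t ht).2 hpt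
          exact ⟨t, ht, v, hv, trivial, htv, rfl⟩
      rw [← this]
      exact hj

/-- Makes the pattern an output. -/
def addOutput : Cmd := .block [
  .cond (.nonNull 16) (.load 8 16 .out) (.setNull 8), .copy 9 4,
  .cond (.nonNull 5) (.block [.copy 21 5, walkFrom visitOut]) .skip,
  .store 4 .out 4, .store 4 .nextOut 8]

theorem addOutput_spec (hD : D.Finite) (hpD : p ∉ D) {μ : Mem}
    (hL : Layout enc (insert p D) D p α ν ch n pp μ.heap) (hn : n ≤ μ.fresh)
    (hout : Links α (states (insert p D)) .out (lsuf D) μ.heap)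
    (hnext : Links α D .nextOut (psuf D) μ.heap)
    (h16 : μ.reg 16 = (psuf (states (insert p D)) p).map (fun u => α u []))
    (h4 : μ.reg 4 = some (α p [])) (h5 : μ.reg 5 = nodePtr D ν p) {k : ℕ} :
    Runs addOutput μ k fun t μ' => t ≤ k + 88 * outChanges D (insert p D) + 8 ∧ n ≤ μ'.fresh ∧
      Links α (states (insert p D)) .out (lsuf (insert p D)) μ'.heap ∧
      Links α (insert p D) .nextOut (psuf (insert p D)) μ'.heap ∧
      ∀ l < n, ∀ f, ((f = .out ∨ f = .nextOut) → ∀ t ∈ states (insert p D), l ≠ α t []) →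
        μ'.heap l f = μ.heap l f := by
  classical
  have hDT : states D ⊆ states (insert p D) := by
    rw [states_insert]; exact Set.subset_union_left
  have hpT : p ∈ states (insert p D) := mem_states_of_mem (Set.mem_insert _ _)
  have hDT' : D ⊆ states (insert p D) := fun q hq => hDT (mem_states_of_mem hq)
  have hαlt : ∀ t ∈ states (insert p D), α t [] < n := fun t ht =>
    hL.state_lt _ _ (stateLive_nil ht)
  have hlp : lsuf D p = psuf D p := lsuf_of_notMem hpD
  have hpb : psuf D p = (psuf (states (insert p D)) p).bind (lsuf D) := psuf_eq_bind hDT' p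
  refine Runs.of_forall fun Q hQ => ?_
  -- the end of the program, and why the result is correct
  have fin : ∀ (k' : ℕ) (μ' : Mem), k' ≤ k + 88 * outChanges D (insert p D) + 6 → n ≤ μ'.fresh →
      μ'.reg 4 = some (α p []) → μ'.reg 8 = (psuf D p).map (fun u => α u []) →
      OutReplaced n (superLocs D p α) ((psuf D p).map fun u => α u []) (some (α p []))
        μ.heap μ'.heap →
      Runs (.block [.store 4 .out 4, .store 4 .nextOut 8]) μ' k' Q := by
    intro k' μ' hk' hn' h4' h8' hrep
    simp only [runs_block_cons, runs_block_one, runs_store, Mem.setField_reg, h4',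
      Option.some.injEq, exists_eq_left', h8']
    have hmem : ∀ t ∈ states (insert p D), t ≠ p →
        (α t [] ∈ superLocs D p α ↔ p <:+ t) := by
      intro t ht hne
      rw [hL.mem_superLocs hDT ht, and_iff_right_iff_imp]
      intro hpt
      rw [states_insert] at ht
      rcases ht with ht | ht
      · exact ht
      · exact absurd (hpt.eq_of_length_le ht.length_le).symm hne
    have hpne : ∀ t ∈ states (insert p D), t ≠ p → α t [] ≠ α p [] := fun t ht hne h =>
      hne ((hL.state_ne ht hpT).1 h)
    have mem_of_l : ∀ {s u : List A}, lsuf D s = some u → u ∈ states (insert p D) :=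
      fun h => hDT' (lsuf_mem h)
    have mem_of_p : ∀ {s u : List A}, psuf D s = some u → u ∈ states (insert p D) :=
      fun h => hDT' (psuf_mem h)
    refine hQ _ _ ⟨by omega, hn', fun t ht => ?_, fun t ht => ?_, fun l hl f hf => ?_⟩
    · by_cases htp : t = p
      · subst htp
        simp [lsuf_of_mem (Set.mem_insert t D)]
      · simp only [Mem.setField_heap, hpne t ht htp, false_and, if_false]
        by_cases hpt : p <:+ t
        · rw [lsuf_insert hpD hpt, hlp]
          split_ifs with hc
          · exact (hrep _ (hαlt t ht) _).1 ⟨.inl rfl, (hmem t ht htp).2 hpt, by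
              rw [hout t ht, hc]⟩
          · rw [(hrep _ (hαlt t ht) _).2, hout t ht]
            rintro ⟨-, -, h⟩
            rw [hout t ht, hL.links_inj (fun s => mem_of_l) (fun s => mem_of_p)] at h
            exact hc h
        · rw [lsuf_insert_of_not_suffix hpt, (hrep _ (hαlt t ht) _).2, hout t ht]
          rintro ⟨-, h, -⟩
          exact hpt ((hmem t ht htp).1 h)
    · by_cases htp : t = p
      · subst htp
        rw [psuf_insert_of_not_suffix (by simp)]
        simp
      · have htD : t ∈ D := ht.resolve_left htp
        have htT := hDT' htD
        simp only [Mem.setField_heap, hpne t htT htp, false_and, if_false]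
        by_cases hpt : p <:+ t
        · rw [psuf_insert hpD hpt (Ne.symm htp), hlp]
          split_ifs with hc
          · exact (hrep _ (hαlt t htT) _).1 ⟨.inr rfl, (hmem t htT htp).2 hpt, by
              rw [hnext t htD, hc]⟩
          · rw [(hrep _ (hαlt t htT) _).2, hnext t htD]
            rintro ⟨-, -, h⟩
            rw [hnext t htD, hL.links_inj (fun s => mem_of_p) (fun s => mem_of_p)] at h
            exact hc h
        · rw [psuf_insert_of_not_suffix fun h => hpt h.1, (hrep _ (hαlt t htT) _).2, hnext t htD]
          rintro ⟨-, h, -⟩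
          exact hpt ((hmem t htT htp).1 h)
    · have h1 : ¬ (l = α p [] ∧ f = .out) := fun h => hf (.inl h.2) p hpT h.1
      have h2 : ¬ (l = α p [] ∧ f = .nextOut) := fun h => hf (.inr h.2) p hpT h.1
      rw [Mem.setField_heap, if_neg h2, Mem.setField_heap, if_neg h1, (hrep l hl f).2]
      rintro ⟨h, ⟨t, ht, -, rfl⟩, -⟩
      exact hf h t (hDT ht) rfl
  -- the traversal
  have walk : ∀ (k' : ℕ) (μ' : Mem), k' ≤ k + 2 → μ'.heap = μ.heap → μ'.fresh = μ.fresh →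
      μ'.reg 4 = μ.reg 4 → μ'.reg 5 = μ.reg 5 → μ'.reg 8 = (psuf D p).map (fun u => α u []) →
      Runs (.block [.copy 9 4, .cond (.nonNull 5) (.block [.copy 21 5, walkFrom visitOut]) .skip,
        .store 4 .out 4, .store 4 .nextOut 8]) μ' k' Q := by
    intro k' μ' hk' hh hf h4' h5' h8'
    simp only [runs_block_cons (d := .cond _ _ _), runs_copy, runs_block_cons (d := .store _ _ _)]
    by_cases hp : p ∈ substr D
    · rw [nodePtr, if_pos hp] at h5
      refine runs_cond.2 ⟨fun _ => ?_, fun h => ?_⟩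
      · simp only [runs_block_cons, runs_block_one, runs_copy]
        refine (walkOut_spec hD (h₀ := μ.heap) hL hDT hp ?_ ?_ ?_).mono ?_
        · simpa [hh] using Agree.refl n μ.heap
        · simp [h5', h5]
        · simpa [hf] using hn
        · rintro t μ₂ ⟨ht, hrep, hw⟩
          rw [← outChanges_insert hpD] at ht
          have := fin t μ₂ (by omega) (le_trans (by simpa [hf] using hn) hw.fresh)
            (by rw [hw.reg 4 (by omega)]; simp [h4', h4])
            (by rw [hw.reg 8 (by omega)]; simp [h8']) (by simpa [hh, h8', h4', h4] using hrep)
          simpa using this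
      · simp [h5', h5] at h
    · rw [nodePtr, if_neg hp] at h5
      refine runs_cond.2 ⟨fun h => ?_, fun h => runs_skip.2 ?_⟩
      · simp [h5', h5] at h
      · refine runs_block_cons.1 (fin _ _ ?_ ?_ ?_ ?_ ?_)
        · omega
        · simpa [hf] using hn
        · simp [h4', h4]
        · simp [h8']
        simp only [Mem.setReg_heap, hh]
        refine OutReplaced.refl (fun l hl => ?_) _ _ _
        obtain ⟨t, ht, hpt, -⟩ := hl
        exact hp (mem_substr_of_suffix hpt (mem_substr_of_mem_states ht))
  cases hg : psuf (states (insert p D)) p with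
  | none =>
    rw [hg] at h16 hpb
    refine runs_block_cons.2 (runs_cond.2 ⟨fun h => absurd h16 h, fun _ => runs_setNull.2 ?_⟩)
    exact walk _ _ (by omega) rfl rfl (by simp) (by simp) (by simp [hpb])
  | some g =>
    rw [hg] at h16 hpb
    have h16 : μ.reg 16 = some (α g []) := h16
    refine runs_block_cons.2 (runs_cond.2 ⟨fun _ => runs_load.2 ⟨_, h16, ?_⟩, fun h => ?_⟩)
    · refine walk _ _ (by omega) rfl rfl (by simp) (by simp) ?_
      rw [hpb, Option.bind_some, ← hout g (psuf_mem hg)]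
      simp
    · rw [holds_nonNull, h16] at h
      simp at h

end Outputs

/-! ### The insertion -/

section Insertion

variable {A : Type*} {enc : A → List Bool} {T D : Set (List A)} {p : List A}
    {α α' : List A → List Bool → ℕ} {ν : Set (List A) → List Bool → ℕ} {pp : Option ℕ}
    {μ μ' : Mem}

theorem DAWGStored.congr (H : DAWGStored enc D μ ν α) (hf : μ.fresh ≤ μ'.fresh)
    (hh : ∀ v b, nodeLive enc D v b → μ'.heap (ν v b) = μ.heap (ν v b))
    (hα : ∀ s ∈ states D, α' s [] = α s []) : DAWGStored enc D μ' ν α' where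
  allocated v b h := (H.allocated v b h).trans_le hf
  inj := H.inj
  trans v hv := (H.trans v hv).congr (fun b hb f _ => by rw [hh v b ⟨hv, hb⟩])
    fun _ _ => treeLive_enc
  slink v w h := by rw [hh _ _ (nodeLive_nil h.mem_nodes.1), H.slink v w h]
  slink_source := by
    rw [hh _ _ (nodeLive_nil (cls_mem_nodes nil_mem_substr)), H.slink_source]
  isuf v hv := by
    obtain ⟨l, h1, h2, h3⟩ := H.isuf v hv
    refine ⟨l, h1, h2, ?_⟩
    rw [hh _ _ (nodeLive_nil hv)]
    refine h3.congr fun i hi => ?_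
    obtain ⟨u, hu, rfl⟩ := List.mem_map.1 hi
    rw [hh _ _ (nodeLive_nil ((h2 u).1 hu).mem_nodes.1)]
  trunk v hv s hs hsv := by rw [hh _ _ (nodeLive_nil hv), hα s hs, H.trunk v hv s hs hsv]
  non_trunk v hv h := by rw [hh _ _ (nodeLive_nil hv), H.non_trunk v hv h]
  aux_null v b h i := by rw [hh _ _ h, H.aux_null v b h i]

theorem DAWGStored.exists_layout (H : DAWGStored enc D μ ν α)
    (lt : ∀ s b, stateLive enc T s b → α s b < μ.fresh)
    (inj : ∀ s b s' b', stateLive enc T s b → stateLive enc T s' b' → α s b = α s' b' →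
      s = s' ∧ b = b')
    (goto : ∀ s ∈ states T, TreeStored enc (IsGoto T) α μ.heap s)
    (sep : Separated enc T D α ν) (hp : StringStored enc μ.heap {l | l < μ.fresh} pp p) :
    ∃ ch, Layout enc T D p α ν ch μ.fresh pp μ.heap := by
  classical
  choose! ch h1 h2 h3 using H.isuf
  exact ⟨ch, lt, inj, goto, H.allocated, H.inj, H.trans, fun v hv => ⟨h1 v hv, h2 v hv⟩, h3,
    H.trunk, H.non_trunk, sep, hp⟩

theorem Links.congr {S : Set (List A)} {f : Slot} {g : List A → Option (List A)} {h h' : Heap}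
    (H : Links α S f g h) (hh : ∀ s ∈ S, h' (α' s []) f = h (α s []) f)
    (hg : ∀ s ∈ S, ∀ t, g s = some t → α' t [] = α t []) : Links α' S f g h' := by
  intro s hs
  rw [hh s hs, H s hs]
  cases ht : g s with
  | none => rfl
  | some t => rw [Option.map_some, Option.map_some, hg s hs t ht]

/-- The program for the insertion of a pattern. -/
def insertProg : Cmd := .block [extend, retarget, linkNew, addOutput]

theorem insertProg_spec {K : ℕ} (hE : Function.Injective enc) (hK : ∀ c, (enc c).length = K)
    (hD : D.Finite) (hp : p ∉ D) (H : Before enc D p μ α ν) :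
    Runs insertProg μ 0 fun t μ' => After enc D (insert p D) μ' α ν ∧
      t ≤ p.length * (46 * K + 285) + 100 * failChanges D (insert p D) +
        88 * outChanges D (insert p D) + 26 := by
  have hDT : states D ⊆ states (insert p D) := by
    rw [states_insert]; exact Set.subset_union_left
  have hDT' : D ⊆ states (insert p D) := fun q hq => hDT (mem_states_of_mem hq)
  simp only [insertProg, runs_block_cons, runs_block_one]
  refine (extend_spec hE hK (α₀ := fun x => α x.1 x.2) ((trie_iff hE).2 ⟨H.ac.allocated,
    H.ac.inj, H.ac.goto⟩) (fun l hl => ⟨hl.1, fun x hx => hl.2.1 x.1 x.2 hx⟩) H.root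
    H.pattern).mono ?_
  rintro t₁ μ₁ ⟨ht₁, hr₁, α₁, hG⟩
  -- the addresses after the extension
  obtain ⟨β, rfl⟩ : ∃ β : List A → List Bool → ℕ, α₁ = fun x => β x.1 x.2 :=
    ⟨fun s b => α₁ (s, b), rfl⟩
  obtain ⟨hlt, hinj, hgoto⟩ := (trie_iff hE).1 hG.trie
  have hβ : ∀ s b, stateLive enc D s b → β s b = α s b := fun s b h => hG.addr (s, b) h
  have hβ' : ∀ s ∈ states D, β s [] = α s [] := fun s hs => hβ s [] (stateLive_nil hs)
  have hnode : ∀ v b, nodeLive enc D v b → μ₁.heap (ν v b) = μ.heap (ν v b) := fun v b h =>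
    funext fun f => hG.old _ (H.dawg.allocated v b h) f
      (.inr fun x hx => (H.separated x.1 x.2 v b hx h).symm)
  have hsep : Separated enc (insert p D) D β ν := by
    intro s b v b' hs hv
    by_cases hs' : stateLive enc D s b
    · rw [hβ s b hs']; exact H.separated s b v b' hs' hv
    · have h1 := hG.new_addr (s, b) hs hs'
      have h2 := H.dawg.allocated v b' hv
      exact fun h => absurd (h1.trans_eq h) (not_le.2 h2)
  have hdawg₁ : DAWGStored enc D μ₁ ν β := H.dawg.congr hG.fresh hnode hβ'
  have hstr : StringStored enc μ₁.heap {l | l < μ₁.fresh} (μ.reg 2) p := by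
    refine (H.pattern.congr fun l hl f _ => hG.old l hl.1 f (.inr fun x hx => ?_)).mono
      fun l hl => hl.1.trans_le hG.fresh
    exact hl.2.1 x.1 x.2 hx
  obtain ⟨ch, hL⟩ := hdawg₁.exists_layout hlt hinj hgoto hsep hstr
  have hR₁ : Anchored β ν D (μ.reg 2) μ₁ :=
    ⟨by rw [hr₁ 0 (by omega), H.root, hβ' [] nil_mem_states], by rw [hr₁ 1 (by omega), H.source],
      by rw [hr₁ 2 (by omega)]⟩
  have hold : ∀ s ∈ states D, ∀ f : Slot, ¬ f.isTree → μ₁.heap (β s []) f = μ.heap (α s []) f := by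
    intro s hs f hf
    rw [hβ' s hs]
    exact hG.old _ (H.ac.allocated s [] (stateLive_nil hs)) f (.inl hf)
  have hfl₁ : Links β (states D) .flink (psuf (states D)) μ₁.heap :=
    (flinks_iff.1 ⟨H.ac.flink, H.ac.flink_root⟩).congr (fun s hs => hold s hs _ id)
      fun s _ t ht => hβ' t (psuf_mem ht)
  obtain ⟨ho, hno⟩ := outputs_iff.1 H.ac.output
  have ho₁ : Links β (states D) .out (lsuf D) μ₁.heap :=
    ho.congr (fun s hs => hold s hs _ id) fun s _ t ht => hβ' t (mem_states_of_mem (lsuf_mem ht))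
  have hno₁ : Links β D .nextOut (psuf D) μ₁.heap :=
    hno.congr (fun s hs => hold s (mem_states_of_mem hs) _ id)
      fun s _ t ht => hβ' t (mem_states_of_mem (psuf_mem ht))
  have hαlt : ∀ s ∈ states (insert p D), β s [] < μ₁.fresh := fun s hs =>
    hlt s [] (stateLive_nil hs)
  have hnewaddr : ∀ s ∈ states (insert p D), s ∉ states D → μ.fresh ≤ β s [] := fun s hs hs' =>
    hG.new_addr (s, []) (mem_liveSet_nil.2 hs) fun h => hs' (mem_liveSet_nil.1 h)
  refine (retarget_spec hE hK hD hL hR₁ le_rfl hfl₁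
    fun v hv => hdawg₁.aux_null v [] (nodeLive_nil hv) 0).later ?_
  rintro t₂ μ₂ ⟨ht₂, hR₂, hn₂, hfl₂, hoth₂⟩
  have hA₂ : Agree μ₁.fresh μ₁.heap μ₂.heap := by
    refine fun l hl f hf => hoth₂ l hl f ?_
    rintro rfl
    exact absurd hf id
  have hfield₂ : ∀ s ∈ states (insert p D), ∀ f : Slot, f ≠ .flink →
      μ₂.heap (β s []) f = μ₁.heap (β s []) f := fun s hs f hf =>
    hoth₂ _ (hαlt s hs) f fun h => absurd h hf
  refine (linkNew_spec hE hK (hL.congr hA₂) hR₂ hfl₂ ?_ ?_).later ?_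
  · exact ho₁.congr (fun s hs => hfield₂ s (hDT hs) _ (by simp)) fun _ _ _ _ => rfl
  · intro s hs hsD
    rw [hfield₂ s hs _ (by simp)]
    exact hG.new _ (hnewaddr s hs hsD) (hαlt s hs) _ id
  rintro t₃ μ₃ ⟨ht₃, -, hf₃, hlink, h16, h4, h5⟩
  have hall : {u | u ∈ states (insert p D) ∧ (u ∈ states D ∨ u <+: p)} = states (insert p D) := by
    ext u
    simp only [states_insert, Set.mem_ofPred_eq, Set.mem_union, and_self]
  have hfl₃ := hlink.flink
  have ho₃ := hlink.out
  rw [hall] at hfl₃ ho₃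
  have hA₃ : Agree μ₁.fresh μ₁.heap μ₃.heap := by
    refine hA₂.trans fun l hl f hf => hlink.other l f ?_
    rintro (rfl | rfl) <;> exact absurd hf id
  refine (addOutput_spec hD hp (hL.congr hA₃) (by rw [hf₃]; exact hn₂) ho₃ ?_ h16 h4 h5).mono ?_
  · refine hno₁.congr (fun s hs => ?_) fun _ _ _ _ => rfl
    rw [hlink.other _ _ (by simp), hfield₂ s (hDT' hs) _ (by simp)]
  rintro t₄ μ₄ ⟨ht₄, hn₄, ho₄, hno₄, hoth₄⟩
  have hoth : ∀ l < μ₁.fresh, ∀ f, ((f = .flink ∨ f = .out ∨ f = .nextOut) →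
      ∀ t ∈ states (insert p D), l ≠ β t []) → μ₄.heap l f = μ₁.heap l f := by
    intro l hl f hf
    rw [hoth₄ l hl f fun h => hf (.inr h), hlink.other l f fun h => hf (by tauto),
      hoth₂ l hl f fun h t ht => hf (.inl h) t (hDT ht)]
  have hA₄ : Agree μ₁.fresh μ₁.heap μ₄.heap := by
    refine fun l hl f hf => hoth l hl f ?_
    rintro (rfl | rfl | rfl) <;> exact absurd hf id
  have hfl₄ : Links β (states (insert p D)) .flink (psuf (states (insert p D))) μ₄.heap :=
    hfl₃.congr (fun s hs => hoth₄ _ (hαlt s hs) _ (by simp)) fun _ _ _ _ => rfl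
  refine ⟨⟨?_, β, ⟨fun s b h => (hlt s b h).trans_le hn₄, hinj, (hL.congr hA₄).goto, ?_, ?_,
    outputs_iff.2 ⟨ho₄, hno₄⟩, fun s b h i => ?_⟩, hsep, fun s hs _ => hβ' s hs⟩, ?_⟩
  · refine H.dawg.congr (hG.fresh.trans hn₄) (fun v b h => ?_) fun _ _ => rfl
    rw [← hnode v b h]
    refine funext fun f => hoth _ (hdawg₁.allocated v b h) f fun _ t ht he => ?_
    exact hsep t [] v b (stateLive_nil ht) h he.symm
  · exact (flinks_iff.2 hfl₄).1
  · exact (flinks_iff.2 hfl₄).2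
  · rw [hoth _ (hlt s b h) _ (by simp)]
    by_cases hs : stateLive enc D s b
    · rw [hβ s b hs, hG.old _ (H.ac.allocated s b hs) _ (.inl id)]
      exact H.ac.aux_null s b hs i
    · exact hG.new _ (hG.new_addr (s, b) h hs) (hlt s b h) _ id
  · have : p.length * (46 * K + 285) = p.length * (10 * K + 10) + p.length * (12 * K + 225) +
      p.length * (24 * K + 50) := by ring
    omega

end Insertion

/-! ### Where the search trees are cut in a deletion -/

section Cut

variable {A : Type*} {enc : A → List Bool} {D D' : Set (List A)} {p : List A}
    {α : List A → List Bool → ℕ} {n : ℕ}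

theorem mem_states_singleton {s : List A} : s ∈ states {p} ↔ s <+: p := by
  constructor
  · rintro (rfl | ⟨q, rfl, h⟩)
    · exact List.nil_prefix
    · exact h
  · exact fun h => .inr ⟨p, rfl, h⟩

theorem mem_states_iff_diff (hp : p ∈ D) {s : List A} :
    s ∈ states D ↔ s ∈ states (D \ {p}) ∨ s <+: p := by
  have : states D = states (insert p (D \ {p})) := by
    rw [Set.insert_sdiff_singleton, Set.insert_eq_of_mem hp]
  rw [this, states_insert]
  rfl

theorem mem_liveSet_iff_diff (hp : p ∈ D) {x : List A × List Bool} :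
    x ∈ liveSet enc D ↔ x ∈ liveSet enc (D \ {p}) ∨ x ∈ liveSet enc {p} := by
  obtain ⟨s, b⟩ := x
  simp only [mem_liveSet, mem_states_iff_diff hp, mem_states_singleton]
  constructor
  · rintro ⟨h, rfl | ⟨c, hc | hc, hb⟩⟩
    · exact h.imp (fun h => ⟨h, .inl rfl⟩) fun h => ⟨h, .inl rfl⟩
    · exact .inl ⟨mem_states_of_prefix ⟨[c], rfl⟩ hc, .inr ⟨c, hc, hb⟩⟩
    · exact .inr ⟨(List.prefix_append s [c]).trans hc, .inr ⟨c, hc, hb⟩⟩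
  · rintro (⟨h, h'⟩ | ⟨h, h'⟩)
    · exact ⟨.inl h, h'.imp id fun ⟨c, hc, hb⟩ => ⟨c, .inl hc, hb⟩⟩
    · exact ⟨.inr h, h'.imp id fun ⟨c, hc, hb⟩ => ⟨c, .inr hc, hb⟩⟩

/-- A record that belongs to the automaton of `D'` and has only one child: the child belongs to this
automaton, too, unless the record is the root or the end of a pattern. -/
theorem keep_child (hD' : liveSet enc D' ⊆ liveSet enc D) {y y' : List A × List Bool}
    (hy : y ∈ liveSet enc D') (hend : y.2 = [] → y.1 ≠ [] ∧ y.1 ∉ D')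
    (huniq : ∀ g y'', Step enc y g y'' → y'' ∈ liveSet enc D → y'' = y') :
    y' ∈ liveSet enc D' := by
  obtain ⟨s, b⟩ := y
  obtain ⟨hs, hb⟩ := mem_liveSet.1 hy
  obtain ⟨c, hc, hb⟩ : ∃ c, s ++ [c] ∈ states D' ∧ b <+: enc c := by
    rcases hb with rfl | hb
    · obtain ⟨h1, h2⟩ := hend rfl
      rcases hs with rfl | ⟨q, hq, z, rfl⟩
      · exact absurd rfl h1
      · cases z with
        | nil => exact absurd (by simpa using hq) h2
        | cons c z => exact ⟨c, .inr ⟨_, hq, z, by simp⟩, List.nil_prefix⟩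
    · exact hb
  obtain ⟨z, hz⟩ := hb
  cases z with
  | nil =>
    have hz : b = enc c := by simpa using hz
    subst hz
    have hmem : (s ++ [c], []) ∈ liveSet enc D' := mem_liveSet_nil.2 hc
    rw [← huniq _ _ (.dest s c) (hD' hmem)]
    exact hmem
  | cons i z =>
    have hmem : (s, b ++ [i]) ∈ liveSet enc D' :=
      mem_liveSet.2 ⟨hs, .inr ⟨c, hc, z, by simpa using hz⟩⟩
    rw [← huniq _ _ (.bit s b i) (hD' hmem)]
    exact hmem

/-- The records on the path for `p`, from the root on, are numbered consecutively; those that belong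
to another dictionary are the first ones. -/
theorem liveSet_initial {K : ℕ} (hK : ∀ c, (enc c).length = K) {x y : List A × List Bool}
    (hx : x ∈ liveSet enc {p}) (hy : y ∈ liveSet enc {p}) (hyD : y ∈ liveSet enc D')
    (hle : x.1.length * (K + 1) + x.2.length ≤ y.1.length * (K + 1) + y.2.length) :
    x ∈ liveSet enc D' := by
  obtain ⟨s, b⟩ := x
  obtain ⟨t, d⟩ := y
  simp only at hle
  obtain ⟨hs, hb⟩ := mem_liveSet.1 hx
  obtain ⟨ht, hd⟩ := mem_liveSet.1 hy
  obtain ⟨htD, hdD⟩ := mem_liveSet.1 hyD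
  rw [mem_states_singleton] at hs ht
  have hblen : b.length ≤ K := by
    rcases hb with rfl | ⟨c, -, hb⟩
    · simp
    · exact hb.length_le.trans (hK c).le
  have hdlen : d.length ≤ K := by
    rcases hd with rfl | ⟨c, -, hd⟩
    · simp
    · exact hd.length_le.trans (hK c).le
  have hst : s.length ≤ t.length := by
    by_contra hlt
    have : (t.length + 1) * (K + 1) ≤ s.length * (K + 1) := Nat.mul_le_mul_right _ (by omega)
    rw [Nat.add_mul] at this
    omega
  have hpre : s <+: t := List.prefix_of_prefix_length_le hs ht hst
  refine mem_liveSet.2 ⟨mem_states_of_prefix hpre htD, ?_⟩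
  rcases hb with rfl | ⟨c, hc, hb⟩
  · exact .inl rfl
  rw [mem_states_singleton] at hc
  by_cases heq : s.length = t.length
  · obtain rfl := hpre.eq_of_length heq
    have hbd : b.length ≤ d.length := by omega
    rcases hd with rfl | ⟨c', hc', hd⟩
    · exact .inl (List.length_eq_zero_iff.1 (by simpa using hbd))
    · rw [mem_states_singleton] at hc'
      have : c = c' := by
        have := (List.prefix_of_prefix_length_le hc hc' (by simp)).eq_of_length (by simp)
        simpa using this
      subst this
      have hbd' := List.prefix_of_prefix_length_le hb hd hbd
      rcases hdD with rfl | ⟨c', hc', hd'⟩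
      · exact .inl (List.prefix_nil.1 hbd')
      · exact .inr ⟨c', hc', hbd'.trans hd'⟩
  · have : s ++ [c] <+: t := List.prefix_of_prefix_length_le hc ht (by simp; omega)
    exact .inr ⟨c, mem_states_of_prefix this htD, hb⟩

theorem Step.number {K : ℕ} (hK : ∀ c, (enc c).length = K) {x y : List A × List Bool} {f : Slot}
    (h : Step enc x f y) :
    y.1.length * (K + 1) + y.2.length = x.1.length * (K + 1) + x.2.length + 1 := by
  cases h with
  | bit s b i => simp; omega
  | dest s c => simp [hK]; ring

/-- There is only one link from a remaining to a removed record. -/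
theorem cut_unique {K : ℕ} (hK : ∀ c, (enc c).length = K)
    (hp : p ∈ D) {x x' z z' : List A × List Bool} {f g : Slot} (hx : x ∈ liveSet enc (D \ {p}))
    (hx' : x' ∉ liveSet enc (D \ {p})) (hs : Step enc x f x') (hxp : x' ∈ liveSet enc {p})
    (hz : z ∈ liveSet enc (D \ {p})) (hz' : z' ∉ liveSet enc (D \ {p})) (hs' : Step enc z g z')
    (hzD : z' ∈ liveSet enc D) : x = z ∧ f = g := by
  have hzp : z' ∈ liveSet enc {p} := ((mem_liveSet_iff_diff hp).1 hzD).resolve_left hz'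
  have h1 := hs.number hK
  have h2 := hs'.number hK
  have hxp' := liveSet_closed hs hxp
  have hzp' := liveSet_closed hs' hzp
  rcases lt_trichotomy (x'.1.length * (K + 1) + x'.2.length) (z'.1.length * (K + 1) + z'.2.length)
    with h | h | h
  · exact absurd (liveSet_initial hK hxp hzp' hz (by omega)) hx'
  · have he : x' = z' := by
      obtain ⟨s, b⟩ := x'
      obtain ⟨t, d⟩ := z'
      simp only at h
      have h3 : ∀ {s : List A} {b : List Bool}, (s, b) ∈ liveSet enc {p} → b.length < K + 1 := by
        intro s b hsb
        obtain ⟨-, rfl | ⟨c, -, hb⟩⟩ := mem_liveSet.1 hsb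
        · simp
        · exact Nat.lt_succ_of_le (hb.length_le.trans (hK c).le)
      have hb := h3 hxp
      have hd := h3 hzp
      have hlen : s.length = t.length := by
        have e1 : (s.length * (K + 1) + b.length) / (K + 1) = s.length := by
          rw [Nat.mul_comm, Nat.mul_add_div (by omega), Nat.div_eq_of_lt hb, Nat.add_zero]
        have e2 : (t.length * (K + 1) + d.length) / (K + 1) = t.length := by
          rw [Nat.mul_comm, Nat.mul_add_div (by omega), Nat.div_eq_of_lt hd, Nat.add_zero]
        rw [← e1, ← e2, h]
      obtain ⟨hs1, hb1⟩ := mem_liveSet.1 hxp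
      obtain ⟨ht1, hd1⟩ := mem_liveSet.1 hzp
      rw [mem_states_singleton] at hs1 ht1
      obtain rfl := (List.prefix_of_prefix_length_le hs1 ht1 hlen.le).eq_of_length hlen
      have hbd : b.length = d.length := by omega
      rcases hb1 with rfl | ⟨c, hc, hb1⟩
      · obtain rfl := List.length_eq_zero_iff.1 hbd.symm
        rfl
      · rcases hd1 with rfl | ⟨c', hc', hd1⟩
        · obtain rfl := List.length_eq_zero_iff.1 hbd
          rfl
        · rw [mem_states_singleton] at hc hc'
          have : c = c' := by
            have := (List.prefix_of_prefix_length_le hc hc' (by simp)).eq_of_length (by simp)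
            simpa using this
          subst this
          rw [(List.prefix_of_prefix_length_le hb1 hd1 hbd.le).eq_of_length hbd]
    subst he
    exact hs.source_unique hs'
  · exact absurd (liveSet_initial hK hzp hxp' hx (by omega)) hz'

/-- The link from `x` to `x'` (in registers with contents `v` and `v'`) is a candidate for the
cut after the records on the path for `p` up to `y` have been inspected. The first state after the
cut (with location `w`) is known if it is a prefix of `s`. -/
def CutAt (enc : A → List Bool) (D' : Set (List A)) (p : List A) (α : List A → List Bool → ℕ)
    (y : List A × List Bool) (s : List A) (v v' w : Option ℕ) : Prop :=
  ∃ x f x', v = some (α x.1 x.2) ∧ v' = some (α x'.1 x'.2) ∧ x ∈ liveSet enc D' ∧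
    Step enc x f x' ∧ x' ∈ liveSet enc {p} ∧ (x' ∈ liveSet enc D' → y ∈ liveSet enc D') ∧
    x.1 <+: s ∧ (x.1 = s → w = none) ∧
    (x.1 ≠ s → w = some (α (p.take (x.1.length + 1)) []))

/-- Moves the record in register 10 along the field `f`. If register 15 is not null, then this link
becomes the candidate. -/
def stepTo (f : Slot) : Cmd := .block [.load 14 10 f,
  .cond (.nonNull 15) (.block [.copy 6 10, .copy 7 14, .setNull 17, .setNull 15]) .skip,
  .copy 10 14]

theorem stepTo_spec {h : Heap} (hT : Trie enc (liveSet enc D) h (fun x => α x.1 x.2) n)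
    (hpD : liveSet enc {p} ⊆ liveSet enc D) (hD' : liveSet enc D' ⊆ liveSet enc D)
    {y y' : List A × List Bool} {f : Slot} (hs : Step enc y f y') (hy' : y' ∈ liveSet enc {p})
    {μ : Mem} (hh : μ.heap = h) (h10 : μ.reg 10 = some (α y.1 y.2))
    (hflag : μ.reg 15 ≠ none → y ∈ liveSet enc D')
    (hno : μ.reg 15 = none → (y.2 = [] → y.1 ≠ [] ∧ y.1 ∉ D') ∧
      CutAt enc D' p α y y.1 (μ.reg 6) (μ.reg 7) (μ.reg 17) ∧
      ∀ g y'', Step enc y g y'' → y'' ∈ liveSet enc D → y'' = y')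
    {k : ℕ} {Q : ℕ → Mem → Prop}
    (hQ : ∀ k' μ', k' ≤ k + 7 → μ.OnlyRegs [6, 7, 10, 14, 15, 17] μ' →
      μ'.reg 10 = some (α y'.1 y'.2) → μ'.reg 15 = none →
      CutAt enc D' p α y' y.1 (μ'.reg 6) (μ'.reg 7) (μ'.reg 17) → Q k' μ') :
    Runs (stepTo f) μ k Q := by
  have hlink : μ.heap (α y.1 y.2) f = some (α y'.1 y'.2) := by
    rw [hh]; exact hT.link y f y' hs (hpD hy')
  by_cases h15 : μ.reg 15 = none
  · obtain ⟨hend, ⟨x, g, x', e6, e7, hx, hsx, hxp, hxy, hxs, hw, hw'⟩, huniq⟩ := hno h15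
    simp [stepTo, h10, hlink, h15]
    refine hQ _ _ (by omega) ⟨rfl, rfl, fun r hr => ?_⟩ (by simp) (by simpa using h15)
      ⟨x, g, x', by simpa using e6, by simpa using e7, hx, hsx, hxp, fun hx' => ?_, hxs, ?_, ?_⟩
    · simp at hr; simp [hr]
    · exact keep_child hD' (hxy hx') hend huniq
    · simpa using hw
    · simpa using hw'
  · simp [stepTo, h10, hlink, h15]
    refine hQ _ _ (by omega) ⟨rfl, rfl, fun r hr => ?_⟩ (by simp) (by simp)
      ⟨y, f, y', by simp, by simp, hflag h15, hs, hy', id, List.prefix_rfl, by simp, by simp⟩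
    simp at hr; simp [hr]

/-- Moves along the field `f`; the record has been kept for sure if it has the other child, too. -/
def trackBit (f g : Slot) : Cmd :=
  .block [.load 16 10 g, .cond (.nonNull 16) (.copy 15 10) .skip, stepTo f]

theorem trackBit_spec {K : ℕ} (hK : ∀ c, (enc c).length = K) {h : Heap}
    (hT : Trie enc (liveSet enc D) h (fun x => α x.1 x.2) n) (hp : p ∈ D)
    {s : List A} {b : List Bool} {i : Bool} {c : A} (hc : s ++ [c] <+: p) (hb : b ++ [i] <+: enc c)
    {μ : Mem} (hh : μ.heap = h) (h10 : μ.reg 10 = some (α s b))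
    (hflag : μ.reg 15 ≠ none → (s, b) ∈ liveSet enc (D \ {p}))
    (hno : μ.reg 15 = none → (b = [] → s ≠ [] ∧ s ∉ D \ {p}) ∧
      CutAt enc (D \ {p}) p α (s, b) s (μ.reg 6) (μ.reg 7) (μ.reg 17))
    {k : ℕ} {Q : ℕ → Mem → Prop}
    (hQ : ∀ k' μ', k' ≤ k + 10 → μ.OnlyRegs [6, 7, 10, 14, 15, 16, 17] μ' →
      μ'.reg 10 = some (α s (b ++ [i])) → μ'.reg 15 = none →
      CutAt enc (D \ {p}) p α (s, b ++ [i]) s (μ'.reg 6) (μ'.reg 7) (μ'.reg 17) → Q k' μ') :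
    Runs (trackBit (bitSlot i) (bitSlot !i)) μ k Q := by
  have hpD : liveSet enc {p} ⊆ liveSet enc D := fun x hx => (mem_liveSet_iff_diff hp).2 (.inr hx)
  have hD' : liveSet enc (D \ {p}) ⊆ liveSet enc D := fun x hx =>
    (mem_liveSet_iff_diff hp).2 (.inl hx)
  have hs : s <+: p := (List.prefix_append s [c]).trans hc
  have hy' : (s, b ++ [i]) ∈ liveSet enc {p} :=
    mem_liveSet.2 ⟨mem_states_singleton.2 hs, .inr ⟨c, mem_states_singleton.2 hc, hb⟩⟩
  have hy : (s, b) ∈ liveSet enc {p} := liveSet_closed (.bit s b i) hy'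
  have hnotdest : ∀ c', b ≠ enc c' := by
    rintro c' rfl
    have := hb.length_le
    simp [hK] at this
  simp only [trackBit, runs_block_cons, runs_block_one, runs_load, h10, Option.some.injEq,
    exists_eq_left']
  by_cases hsib : (s, b ++ [!i]) ∈ liveSet enc D
  · have hlink : μ.heap (α s b) (bitSlot !i) = some (α s (b ++ [!i])) := by
      rw [hh]; exact hT.link _ _ _ (.bit s b (!i)) hsib
    -- the other child is kept, because it is not on the path
    have hsib' : (s, b ++ [!i]) ∈ liveSet enc (D \ {p}) := by
      refine ((mem_liveSet_iff_diff hp).1 hsib).resolve_right fun hmem => ?_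
      obtain ⟨-, h | ⟨c', hc', hb'⟩⟩ := mem_liveSet.1 hmem
      · simp at h
      · rw [mem_states_singleton] at hc'
        have : c = c' := by
          have := (List.prefix_of_prefix_length_le hc hc' (by simp)).eq_of_length (by simp)
          simpa using this
        subst this
        have := (List.prefix_of_prefix_length_le hb hb' (by simp)).eq_of_length (by simp)
        simp at this
    refine runs_cond.2 ⟨fun _ => runs_copy.2 ?_, fun h => ?_⟩
    · refine stepTo_spec hT hpD hD' (.bit s b i) hy' (by simpa using hh) (by simpa using h10)
        (fun _ => liveSet_closed (.bit s b (!i)) hsib') (fun h => ?_) ?_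
      · simp [h10] at h
      · intro k' μ' hk' hμ' h10' h15' hcut
        refine hQ k' μ' (by omega) ⟨hμ'.heap, hμ'.fresh, fun r hr => ?_⟩ h10' h15' hcut
        rw [hμ'.reg r (by simp at hr ⊢; tauto)]
        simp at hr; simp [hr]
    · simp [hlink] at h
  · have hnull : μ.heap (α s b) (bitSlot !i) = none := by
      rw [hh]
      refine hT.null (s, b) (hpD hy) _ (Step.bit (enc := enc) s b (!i)).isTree fun y'' hs'' hy'' => hsib ?_
      have hK' : Step enc (s, b) (bitSlot !i) y'' → y'' = (s, b ++ [!i]) := by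
        intro hst
        generalize hx : (s, b) = x at hst
        generalize hf : bitSlot (!i) = f at hst
        cases hst with
        | bit s' b' j =>
          obtain ⟨rfl, rfl⟩ := Prod.mk.inj hx
          rw [bitSlot_injective hf]
        | dest s' c' => exact absurd hf (bitSlot_ne_dest _)
      rw [← hK' hs'']
      exact hy''
    refine runs_cond.2 ⟨fun h => ?_, fun _ => runs_skip.2 ?_⟩
    · simp [hnull] at h
    · refine stepTo_spec hT hpD hD' (.bit s b i) hy' (by simpa using hh) (by simpa using h10)
        (fun h => hflag (by simpa using h)) (fun h => ?_) ?_
      · obtain ⟨h1, h2⟩ := hno (by simpa using h)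
        refine ⟨h1, by simpa using h2, fun g y'' hst hy'' => ?_⟩
        generalize hx : (s, b) = x at hst
        cases hst with
        | bit s' b' j =>
          obtain ⟨rfl, rfl⟩ := Prod.mk.inj hx
          by_cases hij : j = i
          · rw [hij]
          · rw [Bool.eq_not_of_ne hij] at hy''
            exact absurd hy'' hsib
        | dest s' c' =>
          exact absurd (Prod.mk.inj hx).2 (hnotdest c')
      · intro k' μ' hk' hμ' h10' h15' hcut
        refine hQ k' μ' (by omega) ⟨hμ'.heap, hμ'.fresh, fun r hr => ?_⟩ h10' h15' hcut
        rw [hμ'.reg r (by simp at hr ⊢; tauto)]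
        simp at hr; simp [hr]

end Cut

section Track

variable {A : Type*} {enc : A → List Bool} {D : Set (List A)} {p : List A}
    {α : List A → List Bool → ℕ} {ν : Set (List A) → List Bool → ℕ}
    {ch : Set (List A) → List (Set (List A))} {n : ℕ} {pp : Option ℕ} {μ : Mem}

/-- Moves along the code word in register 11. -/
def trackBits : Cmd := .loop (.nonNull 11) (.block [
  .load 12 11 .bit, .cond (.isNull 12) (trackBit .zero .one) (trackBit .one .zero),
  .load 11 11 .next])

theorem trackBits_spec {K : ℕ} (hK : ∀ c, (enc c).length = K) {h : Heap} {S : Set ℕ}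
    (hT : Trie enc (liveSet enc D) h (fun x => α x.1 x.2) n) (hp : p ∈ D)
    {s : List A} {c : A} (hc : s ++ [c] <+: p) {Q : ℕ → Mem → Prop} (rest : List Bool) :
    ∀ (b : List Bool) (μ : Mem) (k : ℕ), b ++ rest = enc c → BitsStored h S (μ.reg 11) rest →
    μ.heap = h → μ.reg 10 = some (α s b) →
    (μ.reg 15 ≠ none → (s, b) ∈ liveSet enc (D \ {p})) →
    (μ.reg 15 = none → (b = [] → s ≠ [] ∧ s ∉ D \ {p}) ∧
      CutAt enc (D \ {p}) p α (s, b) s (μ.reg 6) (μ.reg 7) (μ.reg 17)) →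
    (∀ k' μ', k' ≤ k + 14 * rest.length + 1 → μ.OnlyRegs [6, 7, 10, 11, 12, 14, 15, 16, 17] μ' →
      μ'.reg 10 = some (α s (enc c)) →
      (μ'.reg 15 ≠ none → (s, enc c) ∈ liveSet enc (D \ {p})) →
      (μ'.reg 15 = none → (enc c = [] → s ≠ [] ∧ s ∉ D \ {p}) ∧
        CutAt enc (D \ {p}) p α (s, enc c) s (μ'.reg 6) (μ'.reg 7) (μ'.reg 17)) → Q k' μ') →
    Runs trackBits μ k Q := by
  induction rest with
  | nil =>
    intro b μ k hb hB hh h10 hflag hno hQ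
    obtain rfl : b = enc c := by simpa using hb
    refine runs_loop_done (by simpa [BitsStored] using hB) ?_
    exact hQ _ _ (by simp) ⟨rfl, rfl, fun _ _ => rfl⟩ h10 hflag hno
  | cons i rest ih =>
    intro b μ k hb hB hh h10 hflag hno hQ
    obtain ⟨l, -, h11, hbit, hB⟩ := hB
    have hpre : b ++ [i] <+: enc c := ⟨rest, by simpa using hb⟩
    -- after the current bit
    have key : ∀ k' μ', k' ≤ k + 13 →
        (μ.setReg 12 (μ.heap l .bit)).OnlyRegs [6, 7, 10, 14, 15, 16, 17] μ' →
        μ'.reg 10 = some (α s (b ++ [i])) → μ'.reg 15 = none →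
        CutAt enc (D \ {p}) p α (s, b ++ [i]) s (μ'.reg 6) (μ'.reg 7) (μ'.reg 17) →
        Runs (.load 11 11 .next) μ' k' fun k μ => Runs trackBits μ k Q := by
      intro k' μ' hk' hμ' h10' h15' hcut
      have h11' : μ'.reg 11 = some l := by rw [hμ'.reg 11 (by simp)]; simp [h11]
      simp only [runs_load, h11']
      refine ⟨l, rfl, ih (b ++ [i]) _ _ (by simpa using hb) ?_ ?_ ?_ ?_ ?_ ?_⟩
      · simpa [hμ'.heap, hh] using hB
      · simpa [hμ'.heap] using hh
      · simpa using h10'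
      · simp [h15']
      · intro _
        exact ⟨by simp, by simpa using hcut⟩
      · intro k'' μ'' hk'' hμ'' h1 h2 h3
        refine hQ k'' μ'' (by simp; omega) ⟨hμ''.heap.trans hμ'.heap, hμ''.fresh.trans hμ'.fresh,
          fun r hr => ?_⟩ h1 h2 h3
        rw [hμ''.reg r hr]
        have := hμ'.reg r (by simp at hr ⊢; tauto)
        simp at hr; simp [hr, this]
    refine runs_loop_step (by simp [h11]) ?_
    simp only [runs_block_cons, runs_block_one, runs_load (x := 12), h11, Option.some.injEq,
      exists_eq_left']
    cases i with
    | false =>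
      have hbit' : μ.heap l .bit = none := by simpa [hh] using hbit
      refine runs_cond.2 ⟨fun _ => ?_, fun h => absurd (by simpa using hbit') h⟩
      refine trackBit_spec hK hT hp hc hpre (by simpa using hh) (by simpa using h10)
        (by simpa using hflag) (by simpa using hno) ?_
      exact fun k' μ' hk' hμ' => key k' μ' (by omega) hμ'
    | true =>
      have hbit' : μ.heap l .bit ≠ none := by
        rw [hh]; intro h; simp [h] at hbit
      refine runs_cond.2 ⟨fun h => absurd (by simpa using h) hbit', fun _ => ?_⟩
      refine trackBit_spec hK hT hp hc hpre (by simpa using hh) (by simpa using h10)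
        (by simpa using hflag) (by simpa using hno) ?_
      exact fun k' μ' hk' hμ' => key k' μ' (by omega) hμ'

/-- Sets register 17 to null if the field `f` of the record in register 10 is not null. -/
def clearIf (f : Slot) : Cmd := .block [.load 14 10 f, .cond (.nonNull 14) (.setNull 17) .skip]

theorem clearIf_spec {f : Slot} {μ : Mem} {k l : ℕ} {Q : ℕ → Mem → Prop}
    (h10 : μ.reg 10 = some l)
    (hQ : ∀ k' μ', k' ≤ k + 3 → μ.OnlyRegs [14, 17] μ' →
      (μ.heap l f ≠ none → μ'.reg 17 = none) → (μ.heap l f = none → μ'.reg 17 = μ.reg 17) →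
      Q k' μ') : Runs (clearIf f) μ k Q := by
  by_cases hf : μ.heap l f = none
  · simp [clearIf, h10, hf]
    refine hQ _ _ (by omega) ⟨rfl, rfl, fun r hr => ?_⟩ (by simp [hf]) (by simp)
    simp at hr; simp [hr]
  · simp [clearIf, h10, hf]
    refine hQ _ _ (by omega) ⟨rfl, rfl, fun r hr => ?_⟩ (by simp) (by simp [hf])
    simp at hr; simp [hr]

/-- Makes register 15 not null if and only if the state in register 10 is the root or a pattern. -/
def inspect : Cmd := .block [.setNull 15, .load 14 10 .out, .cond (.same 14 10) (.copy 15 10) .skip,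
  .cond (.same 10 0) (.copy 15 10) .skip]

/-- Moves along the transition for the letter in register 3. -/
def trackLetter : Cmd := .block [.load 11 3 .code, trackBits, stepTo .dest,
  .cond (.isNull 17) (.copy 17 10) .skip]

/-- Moves along the transitions for the letters in register 3. -/
def trackLetters : Cmd := .loop (.nonNull 3) (.block [inspect, trackLetter, .load 3 3 .next])

/-- Walks along the pattern in the automaton and finds the link between the last remaining and the
first removed record (registers 6 and 7), and the first removed state (register 17; null if all
states remain). -/
def track : Cmd := .block [.copy 3 2, .copy 10 0, .setNull 17, trackLetters,
  clearIf .zero, clearIf .one, clearIf .dest]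

/-- The cut for the deletion of `p` is between `x` and `x'`, at the field `f` of `x`. -/
structure IsCut (enc : A → List Bool) (D : Set (List A)) (p : List A) (x : List A × List Bool)
    (f : Slot) (x' : List A × List Bool) : Prop where
  mem : x ∈ liveSet enc (D \ {p})
  step : Step enc x f x'
  notMem : x' ∉ liveSet enc (D \ {p})
  path : x' ∈ liveSet enc {p}
  lt : x.1.length < p.length

/-- The state of `p` remains exactly if it has an outgoing transition. -/
theorem exists_child_iff (hp : p ∈ D) (hne : p ≠ []) :
    (∃ f y, Step enc (p, []) f y ∧ y ∈ liveSet enc D) ↔ p ∈ states (D \ {p}) := by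
  constructor
  · rintro ⟨f, y, hs, hy⟩
    have : ∃ c, p ++ [c] ∈ states D := by
      generalize hx : (p, ([] : List Bool)) = x at hs
      cases hs with
      | bit s b i =>
        obtain ⟨rfl, rfl⟩ := Prod.mk.inj hx
        obtain ⟨-, h | ⟨c, hc, -⟩⟩ := mem_liveSet.1 hy
        · simp at h
        · exact ⟨c, hc⟩
      | dest s c =>
        obtain ⟨rfl, -⟩ := Prod.mk.inj hx
        exact ⟨c, mem_liveSet_nil.1 hy⟩
    obtain ⟨c, hc⟩ := this
    rcases (mem_states_iff_diff hp).1 hc with h | h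
    · exact mem_states_of_prefix ⟨[c], rfl⟩ h
    · have := h.length_le
      simp at this
  · rintro (h | ⟨q, hq, z, rfl⟩)
    · exact absurd h hne
    cases z with
    | nil => exact absurd (by simp) hq.2
    | cons c z =>
      have hc : p ++ [c] ∈ states D := .inr ⟨_, hq.1, z, by simp⟩
      have hps : p ∈ states D := mem_states_of_mem hp
      cases he : enc c with
      | nil =>
        have hst := Step.dest (enc := enc) p c
        rw [he] at hst
        exact ⟨.dest, (p ++ [c], []), hst, mem_liveSet_nil.2 hc⟩
      | cons i b =>
        exact ⟨_, _, .bit p [] i, mem_liveSet.2 ⟨hps, .inr ⟨c, hc, b, by simp [he]⟩⟩⟩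

theorem inspect_spec (hL : Layout enc D D p α ν ch n pp μ.heap)
    (hout : Links α (states D) .out (lsuf D) μ.heap) {s : List A} (hs : s ∈ states D)
    (h10 : μ.reg 10 = some (α s [])) (h0 : μ.reg 0 = some (α [] [])) {k : ℕ} {Q : ℕ → Mem → Prop}
    (hQ : ∀ k' μ', k' ≤ k + 6 → μ.OnlyRegs [14, 15] μ' →
      (μ'.reg 15 ≠ none ↔ s ∈ D ∨ s = []) → Q k' μ') : Runs inspect μ k Q := by
  have hout' : μ.heap (α s []) .out = some (α s []) ↔ s ∈ D := by
    rw [hout s hs]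
    constructor
    · intro h
      cases hq : lsuf D s with
      | none => rw [hq] at h; simp at h
      | some q =>
        rw [hq, Option.map_some, Option.some.injEq,
          hL.state_ne (mem_states_of_mem (lsuf_mem hq)) hs] at h
        exact h ▸ lsuf_mem hq
    · intro h
      rw [lsuf_of_mem h]
      rfl
  have hroot : α s [] = α [] [] ↔ s = [] := hL.state_ne hs nil_mem_states
  rcases eq_or_ne s [] with rfl | h2
  · by_cases h1 : [] ∈ D <;> simp [inspect, h10, h0, hout', h1] <;>
      refine hQ _ _ ?_ ⟨rfl, rfl, fun r hr => ?_⟩ ?_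
    all_goals first
      | omega
      | (simp at hr; simp [hr])
      | simp
  · by_cases h1 : s ∈ D <;> simp [inspect, h10, h0, hout', hroot, h1, h2] <;>
      refine hQ _ _ ?_ ⟨rfl, rfl, fun r hr => ?_⟩ ?_
    all_goals first
      | omega
      | (simp at hr; simp [hr])
      | simp [h1, h2]

theorem trackLetter_spec {K : ℕ} (hE : Function.Injective enc) (hK : ∀ c, (enc c).length = K)
    (hp : p ∈ D) (hT : Trie enc (liveSet enc D) μ.heap (fun x => α x.1 x.2) n)
    {s : List A} {c : A} (hsc : s ++ [c] <+: p) {l : ℕ} (h3 : μ.reg 3 = some l) {S : Set ℕ}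
    (hcode : BitsStored μ.heap S (μ.heap l .code) (enc c))
    (h10 : μ.reg 10 = some (α s [])) (hf : μ.reg 15 ≠ none ↔ s ∈ D ∨ s = [])
    (hinv : s = [] ∨ CutAt enc (D \ {p}) p α (s, []) s (μ.reg 6) (μ.reg 7) (μ.reg 17))
    {k : ℕ} {Q : ℕ → Mem → Prop}
    (hQ : ∀ k' μ', k' ≤ k + 14 * K + 12 → μ.OnlyRegs [6, 7, 10, 11, 12, 14, 15, 16, 17] μ' →
      μ'.reg 10 = some (α (s ++ [c]) []) →
      CutAt enc (D \ {p}) p α (s ++ [c], []) (s ++ [c]) (μ'.reg 6) (μ'.reg 7) (μ'.reg 17) →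
      Q k' μ') : Runs trackLetter μ k Q := by
  have hpD : liveSet enc {p} ⊆ liveSet enc D := fun x hx => (mem_liveSet_iff_diff hp).2 (.inr hx)
  have hD' : liveSet enc (D \ {p}) ⊆ liveSet enc D := fun x hx =>
    (mem_liveSet_iff_diff hp).2 (.inl hx)
  have hsne : s ≠ p := by
    rintro rfl
    simpa using hsc.length_le
  simp only [trackLetter, runs_block_cons (d := trackBits), runs_load, h3, Option.some.injEq,
    exists_eq_left']
  refine runs_block_cons.2 (trackBits_spec hK (h := μ.heap) (S := S) hT hp hsc (enc c)
    [] _ _ rfl ?_ ?_ ?_ ?_ ?_ ?_)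
  · simpa using hcode
  · simp
  · simp [h10]
  · intro h
    rw [mem_liveSet_nil]
    rcases hf.1 (by simpa using h) with h | rfl
    · exact mem_states_of_mem ⟨h, hsne⟩
    · exact nil_mem_states
  · intro h
    have h12 : ¬ (s ∈ D ∨ s = []) := fun h' => hf.2 h' (by simpa using h)
    refine ⟨fun _ => ⟨fun h => h12 (.inr h), fun h => h12 (.inl h.1)⟩, ?_⟩
    simpa using hinv.resolve_left fun h => h12 (.inr h)
  · intro k₃ μ₃ hk₃ hμ₃ h10₃ hf₃ hno₃
    rw [hK] at hk₃
    have hmem : (s ++ [c], []) ∈ liveSet enc {p} :=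
      mem_liveSet_nil.2 (mem_states_singleton.2 hsc)
    refine runs_block_cons.2 (stepTo_spec hT hpD hD' (.dest s c) hmem ?_ h10₃ hf₃ ?_ ?_)
    · rw [hμ₃.heap]; simp
    · intro h
      obtain ⟨h1, h2⟩ := hno₃ h
      refine ⟨h1, h2, fun g y'' hst hy'' => ?_⟩
      generalize hx : (s, enc c) = x at hst
      cases hst with
      | bit s' b' j =>
        obtain ⟨rfl, rfl⟩ := Prod.mk.inj hx
        obtain ⟨-, h | ⟨c', -, hb⟩⟩ := mem_liveSet.1 hy''
        · simp at h
        · have := hb.length_le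
          simp [hK] at this
      | dest s' c' =>
        obtain ⟨rfl, he⟩ := Prod.mk.inj hx
        rw [hE he]
    · intro k₄ μ₄ hk₄ hμ₄ h10₄ h15₄ hcut
      have hμ : μ.OnlyRegs [6, 7, 10, 11, 12, 14, 15, 16, 17] μ₄ := by
        refine ⟨by rw [hμ₄.heap, hμ₃.heap]; simp, by rw [hμ₄.fresh, hμ₃.fresh]; simp,
          fun r hr => ?_⟩
        rw [hμ₄.reg r (by simp at hr ⊢; tauto), hμ₃.reg r hr]
        simp at hr; simp [hr]
      obtain ⟨x, f, x', e6, e7, hx, hst, hxp, hxy, hxs, hw, hw'⟩ := hcut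
      have hne : x.1 ≠ s ++ [c] := by
        intro h
        have := h ▸ hxs.length_le
        simp at this
      -- the first removed state is known from now on
      by_cases hxs' : x.1 = s
      · refine runs_cond.2 ⟨fun _ => runs_copy.2 ?_, fun h => absurd (hw hxs') h⟩
        refine hQ _ _ (by omega) ⟨hμ.heap, hμ.fresh, fun r hr => ?_⟩ (by simpa using h10₄)
          ⟨x, f, x', by simpa using e6, by simpa using e7, hx, hst, hxp, hxy, hxs.trans ⟨[c], rfl⟩,
          fun h => absurd h hne, fun _ => ?_⟩
        · have := hμ.reg r hr
          simp at hr; simp [hr, this]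
        · have : p.take (x.1.length + 1) = s ++ [c] := by
            rw [hxs', List.prefix_iff_eq_take.1 hsc]
            simp
          rw [this]
          simpa using h10₄
      · refine runs_cond.2 ⟨fun h => ?_, fun _ => runs_skip.2 ?_⟩
        · rw [holds_isNull, hw' hxs'] at h
          simp at h
        · exact hQ _ _ (by omega) hμ h10₄ ⟨x, f, x', e6, e7, hx, hst,
            hxp, hxy, hxs.trans ⟨[c], rfl⟩, fun h => absurd h hne, fun _ => hw' hxs'⟩

theorem trackLetters_spec {K : ℕ} (hE : Function.Injective enc) (hK : ∀ c, (enc c).length = K)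
    (hp : p ∈ D) {μ₀ : Mem} (hL : Layout enc D D p α ν ch n pp μ₀.heap)
    (h0 : μ₀.reg 0 = some (α [] [])) (hout : Links α (states D) .out (lsuf D) μ₀.heap)
    (rest : List A) : ∀ (s : List A) (μ : Mem) (k : ℕ), p = s ++ rest →
      μ₀.OnlyRegs [3, 6, 7, 10, 11, 12, 14, 15, 16, 17] μ →
      StringStored enc μ₀.heap {l | l < n} (μ.reg 3) rest → μ.reg 10 = some (α s []) →
      (s = [] ∧ μ.reg 17 = none ∨
        CutAt enc (D \ {p}) p α (s, []) s (μ.reg 6) (μ.reg 7) (μ.reg 17)) →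
      Runs trackLetters μ k fun t μ' => t ≤ k + rest.length * (14 * K + 20) + 1 ∧
          μ₀.OnlyRegs [3, 6, 7, 10, 11, 12, 14, 15, 16, 17] μ' ∧ μ'.reg 10 = some (α p []) ∧
          (p = [] ∧ μ'.reg 17 = none ∨
            CutAt enc (D \ {p}) p α (p, []) p (μ'.reg 6) (μ'.reg 7) (μ'.reg 17)) := by
  induction rest with
  | nil =>
    intro s μ k hs hμ h3 h10 hinv
    obtain rfl : p = s := by simpa using hs
    exact runs_loop_done (by simpa [StringStored] using h3) ⟨by simp, hμ, h10, hinv⟩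
  | cons c rest ih =>
    intro s μ k hs hμ h3 h10 hinv
    obtain ⟨l, hl, h3, hcode, hnext⟩ := h3
    have hsc : s ++ [c] <+: p := ⟨rest, by simp [hs]⟩
    have hsS : s ∈ states D :=
      mem_states_of_prefix ((List.prefix_append s [c]).trans hsc) (mem_states_of_mem hp)
    refine Runs.of_forall fun Q hQ => runs_loop_step (by simp [h3]) ?_
    refine runs_block_cons.2 (inspect_spec (by rw [hμ.heap]; exact hL) (by rw [hμ.heap]; exact hout)
      hsS h10 (by rw [hμ.reg 0 (by simp), h0]) fun k₂ μ₂ hk₂ hμ₂ hf => ?_)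
    have h3₂ : μ₂.reg 3 = some l := by rw [hμ₂.reg 3 (by simp), h3]
    have heap₂ : μ₂.heap = μ₀.heap := hμ₂.heap.trans hμ.heap
    have hT : Trie enc (liveSet enc D) μ₂.heap (fun x => α x.1 x.2) n := by
      rw [heap₂]; exact (trie_iff hE).2 ⟨hL.state_lt, hL.state_inj, hL.goto⟩
    refine runs_block_cons.2 (trackLetter_spec hE hK hp hT hsc h3₂ (S := {l | l < n})
      (by rw [heap₂]; exact hcode) (by rw [hμ₂.reg 10 (by simp), h10]) hf ?_ ?_)
    · rw [hμ₂.reg 6 (by simp), hμ₂.reg 7 (by simp), hμ₂.reg 17 (by simp)]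
      exact hinv.imp And.left id
    intro k₃ μ₃ hk₃ hμ₃ h10₃ hcut
    have h3₃ : μ₃.reg 3 = some l := by rw [hμ₃.reg 3 (by simp), h3₂]
    have heap₃ : μ₃.heap = μ₀.heap := hμ₃.heap.trans heap₂
    refine runs_load.2 ⟨l, h3₃, (ih (s ++ [c]) (μ₃.setReg 3 (μ₃.heap l .next)) (k₃ + 1) (by simp [hs])
      ⟨heap₃, ?_, fun r hr => ?_⟩
      ?_ ?_ ?_).mono fun t μ' h => hQ t μ' ⟨?_, h.2⟩⟩
    · exact hμ₃.fresh.trans (hμ₂.fresh.trans hμ.fresh)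
    · have h1 := hμ₃.reg r (by simp at hr ⊢; tauto)
      have h2 := hμ₂.reg r (by simp at hr ⊢; tauto)
      have h3 := hμ.reg r hr
      simp at hr
      simp [hr, h1, h2, h3]
    · simpa [heap₃] using hnext
    · simpa using h10₃
    · exact .inr (by simpa using hcut)
    · have := h.1
      have e : (c :: rest).length * (14 * K + 20) =
          rest.length * (14 * K + 20) + (14 * K + 20) := by
        simp [Nat.add_mul]
      omega

theorem track_spec {K : ℕ} (hE : Function.Injective enc) (hK : ∀ c, (enc c).length = K)
    (hp : p ∈ D) (hL : Layout enc D D p α ν ch n pp μ.heap)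
    (hR : Anchored α ν D pp μ) (hout : Links α (states D) .out (lsuf D) μ.heap) :
    Runs track μ 0 fun t μ' => t ≤ p.length * (14 * K + 20) + 20 ∧
      μ.OnlyRegs [3, 6, 7, 10, 11, 12, 14, 15, 16, 17] μ' ∧
      ((p ∈ states (D \ {p}) ∧ μ'.reg 17 = none) ∨
        p ∉ states (D \ {p}) ∧ ∃ x f x', IsCut enc D p x f x' ∧
          μ'.reg 6 = some (α x.1 x.2) ∧ μ'.reg 7 = some (α x'.1 x'.2) ∧
          μ'.reg 17 = some (α (p.take (x.1.length + 1)) [])) := by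
  have hT : Trie enc (liveSet enc D) μ.heap (fun x => α x.1 x.2) n :=
    (trie_iff hE).2 ⟨hL.state_lt, hL.state_inj, hL.goto⟩
  have hpS : p ∈ states D := mem_states_of_mem hp
  simp only [track, runs_block_cons, runs_block_one, runs_copy, runs_setNull]
  refine (trackLetters_spec hE hK hp hL hR.root hout p [] _ _ rfl ?_ ?_ ?_ ?_).mono ?_
  · refine ⟨rfl, rfl, fun r hr => ?_⟩
    simp at hr; simp [hr]
  · simpa [hR.pattern] using hL.pattern
  · simp [hR.root]
  · exact .inl ⟨rfl, by simp⟩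
  rintro t μ₁ ⟨ht, hμ₁, h10, hinv⟩
  refine clearIf_spec h10 fun k₂ μ₂ hk₂ hμ₂ hz hz' => ?_
  refine clearIf_spec (by rw [hμ₂.reg 10 (by simp), h10]) fun k₃ μ₃ hk₃ hμ₃ ho ho' => ?_
  refine clearIf_spec (by rw [hμ₃.reg 10 (by simp), hμ₂.reg 10 (by simp), h10])
    fun k₄ μ₄ hk₄ hμ₄ hd hd' => ?_
  rw [hμ₁.heap] at hz hz'
  rw [hμ₂.heap, hμ₁.heap] at ho ho'
  rw [hμ₃.heap, hμ₂.heap, hμ₁.heap] at hd hd'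
  have hregs : ∀ r ∉ [14, 17], μ₄.reg r = μ₁.reg r := fun r hr => by
    rw [hμ₄.reg r hr, hμ₃.reg r hr, hμ₂.reg r hr]
  refine ⟨by omega, ⟨?_, ?_, fun r hr => ?_⟩, ?_⟩
  · rw [hμ₄.heap, hμ₃.heap, hμ₂.heap, hμ₁.heap]
  · rw [hμ₄.fresh, hμ₃.fresh, hμ₂.fresh, hμ₁.fresh]
  · rw [hregs r (by simp at hr ⊢; tauto), hμ₁.reg r hr]
  have hnone : ∀ {f : Slot} {v w : Option ℕ}, (μ.heap (α p []) f ≠ none → w = none) →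
      (μ.heap (α p []) f = none → w = v) → v = none → w = none := by
    intro f v w h1 h2 hv
    by_cases h : μ.heap (α p []) f = none
    · rw [h2 h, hv]
    · exact h1 h
  rcases hinv with ⟨hp0, h17⟩ | hcut
  · exact .inl ⟨hp0 ▸ nil_mem_states, hnone hd hd' (hnone ho ho' (hnone hz hz' h17))⟩
  by_cases hp0 : p = []
  · obtain ⟨x, f, x', -, -, -, -, -, -, hxs, hw, -⟩ := hcut
    have hx : x.1 = p := by rw [hp0] at hxs ⊢; exact List.prefix_nil.1 hxs
    exact .inl ⟨hp0 ▸ nil_mem_states, hnone hd hd' (hnone ho ho' (hnone hz hz' (hw hx)))⟩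
  by_cases hps : p ∈ states (D \ {p})
  · refine .inl ⟨hps, ?_⟩
    obtain ⟨f, y, hst, hy⟩ := (exists_child_iff (enc := enc) hp hp0).2 hps
    have hlink := hT.link _ _ _ hst hy
    have hne : μ.heap (α p []) f ≠ none := by
      intro h
      rw [h] at hlink
      simp at hlink
    match f, hst.isTree, hne with
    | .zero, _, hne => exact hnone hd hd' (hnone ho ho' (hz hne))
    | .one, _, hne => exact hnone hd hd' (ho hne)
    | .dest, _, hne => exact hd hne
  · refine .inr ⟨hps, ?_⟩
    obtain ⟨x, f, x', e6, e7, hx, hst, hxp, hxy, hxs, hw, hw'⟩ := hcut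
    have hxne : x.1 ≠ p := by
      rintro h
      exact hps (h ▸ (mem_liveSet.1 hx).1)
    refine ⟨x, f, x', ⟨hx, hst, fun h => hps (mem_liveSet_nil.1 (hxy h)), hxp, ?_⟩, ?_, ?_, ?_⟩
    · exact lt_of_le_of_ne hxs.length_le fun h => hxne (hxs.eq_of_length h)
    · rw [hregs 6 (by simp), e6]
    · rw [hregs 7 (by simp), e7]
    · have hnull : ∀ f : Slot, f.isTree → μ.heap (α p []) f = none := fun f hf =>
        hT.null (p, []) (mem_liveSet_nil.2 hpS) f hf fun y hst hy =>
          hps ((exists_child_iff hp hp0).1 ⟨f, y, hst, hy⟩)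
      rw [hd' (hnull .dest trivial), ho' (hnull .one trivial), hz' (hnull .zero trivial), hw' hxne]

end Track

/-! ### The failure links to removed states -/

section RemovedLinks

variable {A : Type*} {enc : A → List Bool} {D : Set (List A)} {p : List A}
    {α : List A → List Bool → ℕ} {ν : Set (List A) → List Bool → ℕ}
    {ch : Set (List A) → List (Set (List A))} {n : ℕ} {pp : Option ℕ} {μ : Mem}

/-- The pointer `w` leads to the first removed prefix of `p`; it is null if all prefixes remain. -/
def FirstRemoved (D : Set (List A)) (p : List A) (α : List A → List Bool → ℕ) (w : Option ℕ) :
    Prop :=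
  (p ∈ states (D \ {p}) ∧ w = none) ∨ p ∉ states (D \ {p}) ∧ ∃ y c, y ++ [c] <+: p ∧
    y ∈ states (D \ {p}) ∧ y ++ [c] ∉ states (D \ {p}) ∧ w = some (α (y ++ [c]) [])

/-- The first removed state is the one that follows the last remaining record of the path. -/
theorem IsCut.firstRemoved {K : ℕ} (hK : ∀ c, (enc c).length = K) {x x' : List A × List Bool}
    {f : Slot} (H : IsCut enc D p x f x') (hp : p ∉ states (D \ {p})) :
    FirstRemoved D p α (some (α (p.take (x.1.length + 1)) [])) := by
  obtain ⟨s, b⟩ := x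
  have hx := liveSet_closed H.step H.path
  have hs : s <+: p := mem_states_singleton.1 (mem_liveSet.1 hx).1
  obtain ⟨z, rfl⟩ := hs
  have hlt : s.length < (s ++ z).length := H.lt
  cases z with
  | nil => simp at hlt
  | cons c z =>
    have htake : (s ++ c :: z).take (s.length + 1) = s ++ [c] := by
      rw [List.take_append, List.take_of_length_le (by omega)]
      simp
    have hpre : s ++ [c] <+: s ++ c :: z := ⟨z, by simp⟩
    refine .inr ⟨hp, s, c, hpre, (mem_liveSet.1 H.mem).1, fun hmem => H.notMem ?_, by rw [htake]⟩
    refine liveSet_initial hK H.path (mem_liveSet_nil.2 (mem_states_singleton.2 hpre))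
      (mem_liveSet_nil.2 hmem) ?_
    have hb : b.length ≤ K := by
      obtain ⟨-, rfl | ⟨c, -, hb⟩⟩ := mem_liveSet.1 hx
      · simp
      · exact hb.length_le.trans (hK c).le
    have := H.step.number hK
    simp only [List.length_append, List.length_singleton, List.length_nil] at this ⊢
    have : (s.length + 1) * (K + 1) = s.length * (K + 1) + K + 1 := by ring
    omega

/-- A prefix is removed if its parent is removed or if it is the first removed state. -/
theorem FirstRemoved.concat (hp : p ∈ D) (hL : Layout enc D D p α ν ch n pp μ.heap) {w : Option ℕ}
    (H : FirstRemoved D p α w) {x : List A} {c : A} (hx : x ++ [c] <+: p) :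
    x ++ [c] ∉ states (D \ {p}) ↔ x ∉ states (D \ {p}) ∨ w = some (α (x ++ [c]) []) := by
  have hpS : p ∈ states D := mem_states_of_mem hp
  rcases H with ⟨hps, rfl⟩ | ⟨-, y, d, hy, hyS, hyS', rfl⟩
  · have h1 := mem_states_of_prefix hx hps
    have h2 := mem_states_of_prefix ((List.prefix_append x [c]).trans hx) hps
    simp [h1, h2]
  · rw [Option.some.injEq, hL.state_ne (mem_states_of_prefix hy hpS) (mem_states_of_prefix hx hpS)]
    constructor
    · intro h
      by_cases hxS : x ∈ states (D \ {p})
      · -- the prefixes before the first removed state are not removed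
        right
        rcases Nat.lt_trichotomy (y ++ [d]).length (x ++ [c]).length with hlt | heq | hgt
        · have : y ++ [d] <+: x := List.prefix_of_prefix_length_le hy
            ((List.prefix_append x [c]).trans hx) (by simp at hlt ⊢; omega)
          exact absurd (mem_states_of_prefix this hxS) hyS'
        · exact (List.prefix_of_prefix_length_le hy hx heq.le).eq_of_length heq
        · have : x ++ [c] <+: y := List.prefix_of_prefix_length_le hx
            ((List.prefix_append y [d]).trans hy) (by simp at hgt ⊢; omega)
          exact absurd (mem_states_of_prefix this hyS) h
      · exact .inl hxS
    · rintro (h | h)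
      · exact fun h' => h (mem_states_of_prefix (List.prefix_append x [c]) h')
      · exact h ▸ hyS'

/-- The removed prefixes of `x`. -/
def removed (D : Set (List A)) (p x : List A) : Set (List A) :=
  {u | u <+: x ∧ u ∉ states (D \ {p})}

/-- The states whose failure link is a removed prefix of `x`. -/
def linked (D : Set (List A)) (p x : List A) : Set (List A) :=
  {t | t ∈ states D ∧ ∃ u ∈ removed D p x, psuf (states D) t = some u}

theorem removed_nil : removed D p [] = ∅ := by
  ext u
  simp only [removed, Set.mem_ofPred_eq, Set.mem_empty_iff_false, iff_false, not_and, not_not]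
  intro h
  rw [List.prefix_nil.1 h]
  exact nil_mem_states

theorem removed_concat_of_mem {x : List A} {c : A} (h : x ++ [c] ∈ states (D \ {p})) :
    removed D p (x ++ [c]) = removed D p x := by
  ext u
  simp only [removed, Set.mem_ofPred_eq]
  constructor
  · exact fun ⟨h1, h2⟩ => absurd (mem_states_of_prefix h1 h) h2
  · exact fun ⟨h1, h2⟩ => ⟨h1.trans (List.prefix_append x [c]), h2⟩

theorem removed_concat_of_notMem {x : List A} {c : A} (h : x ++ [c] ∉ states (D \ {p})) :
    removed D p (x ++ [c]) = insert (x ++ [c]) (removed D p x) := by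
  ext u
  simp only [removed, Set.mem_ofPred_eq, Set.mem_insert_iff]
  constructor
  · rintro ⟨h1, h2⟩
    rcases List.prefix_concat_iff.1 h1 with h1 | h1
    · exact .inl h1
    · exact .inr ⟨h1, h2⟩
  · rintro (rfl | ⟨h1, h2⟩)
    · exact ⟨List.prefix_rfl, h⟩
    · exact ⟨h1.trans (List.prefix_append x [c]), h2⟩

theorem states_sdiff_removed (hp : p ∈ D) : states D \ removed D p p = states (D \ {p}) := by
  ext u
  simp only [removed, Set.mem_sdiff, Set.mem_ofPred_eq, not_and, not_not, mem_states_iff_diff hp]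
  constructor
  · rintro ⟨h | h, h'⟩
    · exact h
    · exact h' h
  · exact fun h => ⟨.inl h, fun _ => h⟩

/-- A failure link to `x` has not changed when shorter states have been removed. -/
theorem psuf_sdiff_eq_some_iff {R : Set (List A)} {x t : List A}
    (hx : x ∈ states D) (hR : ∀ u ∈ R, u.length < x.length) :
    psuf (states D \ R) t = some x ↔ psuf (states D) t = some x := by
  have hxR : x ∉ R := fun h => lt_irrefl _ (hR x h)
  simp only [psuf_eq_some_iff, Set.mem_sdiff]
  constructor
  · rintro ⟨-, h2, h3⟩
    refine ⟨hx, h2, fun w hw hwt hne => ?_⟩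
    by_cases hwR : w ∈ R
    · exact (hR w hwR).le
    · exact h3 w ⟨hw, hwR⟩ hwt hne
  · rintro ⟨-, h2, h3⟩
    exact ⟨⟨hx, hxR⟩, h2, fun w hw hwt hne => h3 w hw.1 hwt hne⟩

theorem ncard_linked_le (hD : D.Finite) (hp : p ∈ D) :
    (linked D p p).ncard ≤ p.length + failChanges D (D \ {p}) := by
  classical
  have hfin := states_finite hD
  obtain ⟨B, hB⟩ : ∃ B, B = (Finset.range p.length).image fun i => p.take (i + 1) := ⟨_, rfl⟩
  have hsub : linked D p p ⊆ (B : Set (List A)) ∪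
      {t | t ∈ states D ∧ t ∈ states (D \ {p}) ∧
        psuf (states D) t ≠ psuf (states (D \ {p})) t} := by
    rintro t ⟨ht, u, ⟨-, hu⟩, htu⟩
    by_cases htD : t ∈ states (D \ {p})
    · refine .inr ⟨ht, htD, fun h => hu ?_⟩
      rw [htu] at h
      exact psuf_mem h.symm
    · left
      have htp := ((mem_states_iff_diff hp).1 ht).resolve_left htD
      have hne : t ≠ [] := by rintro rfl; exact htD nil_mem_states
      have hpos := List.length_pos_of_ne_nil hne
      have hle := htp.length_le
      rw [hB, Finset.mem_coe, Finset.mem_image]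
      refine ⟨t.length - 1, Finset.mem_range.2 (by omega), ?_⟩
      rw [Nat.sub_add_cancel hpos]
      exact (List.prefix_iff_eq_take.1 htp).symm
  rw [failChanges_eq]
  refine (Set.ncard_le_ncard hsub ?_).trans ((Set.ncard_union_le _ _).trans ?_)
  · exact B.finite_toSet.union (hfin.subset fun t ht => ht.1)
  · refine Nat.add_le_add_right ?_ _
    rw [Set.ncard_coe_finset, hB]
    exact Finset.card_image_le.trans (by simp)

/-- For the removed state in register 4, redirects the failure links to it to its own failure
link. -/
def bypass : Cmd := .block [.load 8 4 .flink, .load 23 5 .isuf, walk visitFlink]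

theorem bypass_spec (hD : D.Finite) {h₀ : Heap} (hL : Layout enc D D p α ν ch n pp h₀)
    (hA : Agree n h₀ μ.heap) (hn : n ≤ μ.fresh)
    (haux : ∀ v ∈ nodes D, μ.heap (ν v []) (.aux 0) = none) {x : List A} (hx : x ∈ states D)
    (h4 : μ.reg 4 = some (α x [])) (h5 : μ.reg 5 = some (ν (cls D x) [])) {R : Set (List A)}
    (hR : ∀ u ∈ R, u.length < x.length)
    (hlinks : Links α (states D) .flink (psuf (states D \ R)) μ.heap) {k : ℕ} :
    Runs bypass μ k fun t μ' =>
      t ≤ k + 76 * {t | t ∈ states D ∧ psuf (states D) t = some x}.ncard + 24 ∧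
      Links α (states D) .flink (psuf (states D \ insert x R)) μ'.heap ∧
      (∀ l < n, ∀ f, (f = .flink → ∀ t ∈ states D, l ≠ α t []) → μ'.heap l f = μ.heap l f) ∧
      n ≤ μ'.fresh ∧ ∀ r < 20, r ≠ 8 → μ'.reg r = μ.reg r := by
  classical
  have hxn := cls_mem_nodes (mem_substr_of_mem_states hx)
  have hαlt : ∀ t ∈ states D, α t [] < n := fun t ht => hL.state_lt _ _ (stateLive_nil ht)
  have hνlt : ∀ v ∈ nodes D, ν v [] < n := fun v hv => hL.node_lt _ _ (nodeLive_nil hv)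
  have hch : ∀ u ∈ ch (cls D x), u ∈ nodes D := fun u hu => hL.children.mem_nodes hxn hu
  have hmark : ∀ v ∈ nodes D, ¬ Marked ν μ.heap v := fun v hv h => h (haux v hv)
  obtain ⟨out, hout⟩ := exists_walk (halt := fun v => Trunk D v ∨ Marked ν μ.heap v) hD hL.children
    (segs := [ch (cls D x)]) (by simpa using hch)
  simp only [bypass, runs_block_cons, runs_block_one, runs_load, h4, Option.some.injEq,
    exists_eq_left']
  refine ⟨ν (cls D x) [], by simpa using h5, ?_⟩
  refine (walk_spec (done := []) hL ?_ ?_ (visitFlink_spec hL subset_rfl hA) hout hch ?_ ?_ ?_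
    fun r _ => rfl).mono ?_
  · exact fun done h h' => FlinkSet.congr
  · exact fun done h hj => hA.trans hj.agree
  · simp only [Mem.setReg_reg, Mem.setReg_heap, if_true]
    rw [hA _ (hνlt _ hxn) .isuf trivial]
    exact hL.isuf _ hxn
  · exact FlinkSet.refl notMem_stateLocs_nil _ _
  · simpa using hn
  rintro t μ' ⟨ht, hj, hw⟩
  have hnodes := hout.mem_nodes hL.children (by simpa using hch)
  have hiff : ∀ t ∈ states D, ((∃ v ∈ out, True ∧ t ∈ v) ↔ psuf (states D) t = some x) :=
    fun t ht => hout.exists_mem_iff_flink hL.children hx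
      (fun v hv => ⟨fun h => h.resolve_right (hmark v hv), .inl⟩) ht
  have hloc : ∀ t ∈ states D, (α t [] ∈ stateLocs D α (out.reverse ++ [])
      (fun u => ¬ Marked ν μ.heap u) ↔ psuf (states D) t = some x) := by
    intro t ht
    rw [mem_stateLocs hL subset_rfl ht, ← hiff t ht]
    simp only [List.append_nil, List.mem_reverse, ht, true_and]
    exact exists_congr fun v => and_congr_right fun hv =>
      and_iff_right (hmark v (hnodes v hv))
  have hval : μ.heap (α x []) .flink = (psuf (states D \ R) x).map fun u => α u [] := hlinks x hx
  have hins : states D \ insert x R = (states D \ R) \ {x} := by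
    rw [Set.sdiff_sdiff, Set.union_singleton]
  refine ⟨?_, fun t ht => ?_, fun l hl f hf => ?_, hn.trans hw.fresh, fun r hr hr8 => ?_⟩
  · have h1 := hout.length_le_countP hL.children
      (good := fun v => Trunk D v ∨ Marked ν μ.heap v) (fun _ => .inl) (fun _ => id)
      (by simpa using hch)
    have h2 := countP_trunk_le hD hnodes (hout.nodup_children hL.children hxn) fun _ => True
    have h3 : {t | t ∈ states D ∧ ∃ v ∈ out, True ∧ t ∈ v} =
        {t | t ∈ states D ∧ psuf (states D) t = some x} :=
      Set.ext fun t => and_congr_right fun ht => hiff t ht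
    rw [h3] at h2
    have h4 : out.countP (fun v => Trunk D v ∨ Marked ν μ.heap v) =
        out.countP (fun v => Trunk D v ∧ True) := by
      refine List.countP_congr fun v hv => ?_
      simp [hmark v (hnodes v hv)]
    have h5 : out.countP (fun v => Trunk D v ∨ Marked ν μ.heap v) ≤
        {t | t ∈ states D ∧ psuf (states D) t = some x}.ncard := by
      rw [h4]
      convert h2
    omega
  · rw [hins, psuf_diff]
    have h := hj _ (hαlt t ht) .flink
    simp only [Mem.setReg_reg, Mem.setReg_heap] at h
    split_ifs with hc
    · rw [h.1 ⟨trivial, (hloc t ht).2 ((psuf_sdiff_eq_some_iff hx hR).1 hc)⟩]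
      simpa using hval
    · rw [h.2 fun h' => hc ((psuf_sdiff_eq_some_iff hx hR).2 ((hloc t ht).1 h'.2))]
      exact hlinks t ht
  · refine (hj l hl f).2 ?_
    rintro ⟨rfl, t, ht, -, -, -, -, rfl⟩
    exact hf rfl t ht rfl
  · rw [hw.reg r hr]
    simp [hr8, show r ≠ 23 by omega]

/-- Redirects the failure links to removed states, from the shortest removed state to the longest.
Register 17 holds the first removed state (null if there is none). -/
def bypassAll : Cmd := .block [.setNull 18, forPrefixes (.block [
  .cond (.same 4 17) (.copy 18 4) .skip, .cond (.nonNull 18) bypass .skip])]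

theorem ncard_linked_concat (hD : D.Finite) {x : List A} {c : A}
    (h : x ++ [c] ∉ states (D \ {p})) :
    (linked D p x).ncard + {t | t ∈ states D ∧ psuf (states D) t = some (x ++ [c])}.ncard ≤
      (linked D p (x ++ [c])).ncard := by
  have hfin := states_finite hD
  rw [← Set.ncard_union_eq _ (hfin.subset fun t ht => ht.1) (hfin.subset fun t ht => ht.1)]
  · refine Set.ncard_le_ncard ?_ (hfin.subset fun t ht => ht.1)
    rintro t (⟨ht, u, ⟨hu, hu'⟩, htu⟩ | ⟨ht, htu⟩)
    · exact ⟨ht, u, ⟨hu.trans (List.prefix_append x [c]), hu'⟩, htu⟩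
    · exact ⟨ht, _, ⟨List.prefix_rfl, h⟩, htu⟩
  · refine Set.disjoint_left.2 ?_
    rintro t ⟨ht, u, ⟨hu, hu'⟩, htu⟩ ⟨-, htu'⟩
    rw [htu, Option.some.injEq] at htu'
    have := htu' ▸ hu.length_le
    simp at this

theorem bypassAll_spec {K : ℕ} (hE : Function.Injective enc) (hK : ∀ c, (enc c).length = K)
    (hD : D.Finite) (hp : p ∈ D) (hL : Layout enc D D p α ν ch n pp μ.heap)
    (hR : Anchored α ν D pp μ) (hn : n ≤ μ.fresh)
    (haux : ∀ v ∈ nodes D, μ.heap (ν v []) (.aux 0) = none)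
    (hlinks : Links α (states D) .flink (psuf (states D)) μ.heap)
    (h17 : FirstRemoved D p α (μ.reg 17)) {k : ℕ} :
    Runs bypassAll μ k fun t μ' =>
      t ≤ k + p.length * (12 * K + 43) + 76 * (p.length + failChanges D (D \ {p})) + 5 ∧
      Anchored α ν D pp μ' ∧ n ≤ μ'.fresh ∧
      Links α (states D) .flink (psuf (states (D \ {p}))) μ'.heap ∧
      (∀ l < n, ∀ f, (f = .flink → ∀ t ∈ states D, l ≠ α t []) → μ'.heap l f = μ.heap l f) ∧
      (∀ r ∈ [6, 7, 17], μ'.reg r = μ.reg r) ∧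
      μ'.reg 4 = some (α p []) ∧ μ'.reg 5 = nodePtr D ν p := by
  have hpS : p ∈ states D := mem_states_of_mem hp
  simp only [bypassAll, runs_block_cons, runs_block_one, runs_setNull]
  refine (forPrefixes_spec hE hK hpS hL (Inv := fun x k' μ' =>
      k' ≤ k + x.length * (12 * K + 43) + 76 * (linked D p x).ncard + 5 ∧
      Anchored α ν D pp μ' ∧ n ≤ μ'.fresh ∧
      Links α (states D) .flink (psuf (states D \ removed D p x)) μ'.heap ∧
      (∀ l < n, ∀ f, (f = .flink → ∀ t ∈ states D, l ≠ α t []) → μ'.heap l f = μ.heap l f) ∧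
      (∀ r ∈ [6, 7, 17], μ'.reg r = μ.reg r) ∧
      (μ'.reg 18 ≠ none ↔ x ∉ states (D \ {p}))) ?_ ?_ ?_ ?_).mono ?_
  · rintro x k' μ' ⟨-, h1, -, -, h2, -⟩
    refine ⟨fun l hl f hf => h2 l hl f ?_, h1⟩
    rintro rfl
    exact absurd hf id
  · rintro x k' μ' μ'' ⟨h0, h1, h2, h3, h4, h5, h6⟩ hμ
    refine ⟨h0, ⟨?_, ?_, ?_⟩, by rwa [hμ.fresh], by rwa [hμ.heap], by rwa [hμ.heap], ?_, ?_⟩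
    · rw [hμ.reg 0 (by simp)]; exact h1.root
    · rw [hμ.reg 1 (by simp)]; exact h1.source
    · rw [hμ.reg 2 (by simp)]; exact h1.pattern
    · intro r hr
      rw [hμ.reg r (by fin_cases hr <;> simp)]; exact h5 r hr
    · rw [hμ.reg 18 (by simp)]; exact h6
  · rintro x c rest k' μ₁ hx ⟨h0, h1, h2, h3, h4, h5, h6⟩ r4 r5 hB
    have hxc : x ++ [c] <+: p := ⟨rest, by simp [hx]⟩
    have hxcS : x ++ [c] ∈ states D := mem_states_of_prefix hxc hpS
    have hA : Agree n μ.heap μ₁.heap := by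
      refine fun l hl f hf => h4 l hl f ?_
      rintro rfl
      exact absurd hf id
    have hflag := h17.concat hp hL hxc
    rw [← h5 17 (by simp), ← h6, ← r4] at hflag
    refine Runs.of_forall fun Q hQ => ?_
    have e1 : (x ++ [c]).length * (12 * K + 43) = x.length * (12 * K + 43) + (12 * K + 43) := by
      simp only [List.length_append, List.length_singleton]; ring
    -- after the update of register 18
    have key : ∀ k₂ μ₂, k₂ ≤ 2 → μ₁.OnlyRegs [18] μ₂ →
        (μ₂.reg 18 ≠ none ↔ x ++ [c] ∉ states (D \ {p})) →
        Runs (.cond (.nonNull 18) bypass .skip) μ₂ k₂ Q := by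
      intro k₂ μ₂ hk₂ hμ₂ h18
      refine runs_cond.2 ⟨fun h => ?_, fun h => runs_skip.2 ?_⟩
      · have hrem := h18.1 h
        refine (bypass_spec hD (x := x ++ [c]) (R := removed D p x) hL ?_ ?_ ?_ hxcS ?_ ?_ ?_ ?_).mono
          fun t μ₃ ⟨ht, hl₃, ho₃, hn₃, hr₃⟩ => hQ t μ₃ ⟨?_, ?_, ⟨?_, ?_, ?_⟩, hn₃, ?_, ?_, ?_, ?_⟩
        · rw [hμ₂.heap]; exact hA
        · rw [hμ₂.fresh]; exact h2
        · intro v hv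
          rw [hμ₂.heap, h4 _ (hL.node_lt _ _ (nodeLive_nil hv)) _ (by simp), haux v hv]
        · rw [hμ₂.reg 4 (by simp), r4]
        · rw [hμ₂.reg 5 (by simp), r5, nodePtr, if_pos (mem_substr_of_mem_states hxcS)]
        · rintro u ⟨hu, -⟩
          have := hu.length_le
          simp; omega
        · rw [hμ₂.heap]; exact h3
        · intro r hr
          rw [hr₃ r (by fin_cases hr <;> simp) (by fin_cases hr <;> simp),
            hμ₂.reg r (by fin_cases hr <;> simp)]
        · have := ncard_linked_concat hD hrem
          omega
        · rw [hr₃ 0 (by simp) (by simp), hμ₂.reg 0 (by simp)]; exact h1.root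
        · rw [hr₃ 1 (by simp) (by simp), hμ₂.reg 1 (by simp)]; exact h1.source
        · rw [hr₃ 2 (by simp) (by simp), hμ₂.reg 2 (by simp)]; exact h1.pattern
        · rw [removed_concat_of_notMem hrem]; exact hl₃
        · intro l hl f hf
          rw [ho₃ l hl f hf, hμ₂.heap, h4 l hl f hf]
        · intro r hr
          rw [hr₃ r (by fin_cases hr <;> simp) (by fin_cases hr <;> simp),
            hμ₂.reg r (by fin_cases hr <;> simp), h5 r hr]
        · rw [hr₃ 18 (by simp) (by simp)]; exact h18
      · have hrem : x ++ [c] ∈ states (D \ {p}) := by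
          by_contra h'
          exact h (h18.2 h')
        have hlk : linked D p (x ++ [c]) = linked D p x := by
          rw [linked, linked, removed_concat_of_mem hrem]
        refine hQ _ _ ⟨fun r hr => hμ₂.reg r (by fin_cases hr <;> simp), ?_, ⟨?_, ?_, ?_⟩, ?_, ?_,
          ?_, fun r hr => ?_, h18⟩
        · rw [hlk]; omega
        · rw [hμ₂.reg 0 (by simp)]; exact h1.root
        · rw [hμ₂.reg 1 (by simp)]; exact h1.source
        · rw [hμ₂.reg 2 (by simp)]; exact h1.pattern
        · rw [hμ₂.fresh]; exact h2
        · rw [removed_concat_of_mem hrem, hμ₂.heap]; exact h3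
        · rw [hμ₂.heap]; exact h4
        · rw [hμ₂.reg r (by fin_cases hr <;> simp), h5 r hr]
    refine runs_block_cons.2 (runs_cond.2 ⟨fun h => runs_copy.2 ?_, fun h => runs_skip.2 ?_⟩)
    · refine key _ _ (by omega) ⟨rfl, rfl, fun r hr => ?_⟩ ?_
      · simp at hr; simp [hr]
      · rw [holds_same] at h
        rw [hflag]
        simp [r4, h.symm]
    · refine key _ _ (by omega) ⟨rfl, rfl, fun r hr => rfl⟩ ?_
      rw [hflag]
      exact ⟨.inl, fun h' => h'.resolve_right fun h'' => h h''.symm⟩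
  · refine ⟨by omega, ⟨by simp [hR.root], by simp [hR.source], by simp [hR.pattern]⟩, hn, ?_,
      fun _ _ _ _ => rfl, ?_, ?_⟩
    · rw [removed_nil, Set.sdiff_empty]; exact hlinks
    · intro r hr
      fin_cases hr <;> simp
    · simp [nil_mem_states]
  · rintro t μ' ⟨κ, hκ, ⟨h0, h1, h2, h3, h4, h5, -⟩, r4, r5⟩
    rw [states_sdiff_removed hp] at h3
    have := ncard_linked_le hD hp
    exact ⟨by omega, h1, h2, h3, h4, h5, r4, r5⟩

end RemovedLinks

/-! ### The outputs and the goto function after a deletion -/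

section Removal

variable {A : Type*} {enc : A → List Bool} {D : Set (List A)} {p : List A}
    {α : List A → List Bool → ℕ} {ν : Set (List A) → List Bool → ℕ}
    {ch : Set (List A) → List (Set (List A))} {n : ℕ} {pp : Option ℕ} {μ : Mem}

theorem ncard_suffix_le (hD : D.Finite) (hp : p ∈ D) :
    {t | t ∈ states D ∧ p <:+ t}.ncard ≤ outChanges D (D \ {p}) + 1 := by
  have hsub : {t | t ∈ states D ∧ p <:+ t} ⊆
      insert p {t | t ∈ states (D \ {p}) ∧ p <:+ t} := by
    rintro t ⟨ht, hpt⟩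
    rcases (mem_states_iff_diff hp).1 ht with h | h
    · exact .inr ⟨h, hpt⟩
    · exact .inl (hpt.eq_of_length_le h.length_le).symm
  rw [outChanges_diff hp]
  refine (Set.ncard_le_ncard hsub ?_).trans (Set.ncard_insert_le _ _)
  exact ((states_finite (hD.subset Set.sdiff_subset)).subset fun t ht => ht.1).insert _

/-- Removes the pattern, whose state is in register 4, from the outputs. -/
def removeOutput : Cmd := .block [.load 9 4 .nextOut, .copy 8 4, .copy 21 5, walkFrom visitOut]

theorem removeOutput_spec (hD : D.Finite) (hp : p ∈ D) {h₀ : Heap}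
    (hL : Layout enc D D p α ν ch n pp h₀) (hA : Agree n h₀ μ.heap) (hn : n ≤ μ.fresh)
    (hout : Links α (states D) .out (lsuf D) μ.heap) (hnext : Links α D .nextOut (psuf D) μ.heap)
    (h4 : μ.reg 4 = some (α p [])) (h5 : μ.reg 5 = nodePtr D ν p) {k : ℕ} :
    Runs removeOutput μ k fun t μ' => t ≤ k + 88 * (outChanges D (D \ {p}) + 1) + 3 ∧
      Links α (states D) .out (lsuf (D \ {p})) μ'.heap ∧
      Links α D .nextOut (psuf (D \ {p})) μ'.heap ∧
      (∀ l < n, ∀ f, ((f = .out ∨ f = .nextOut) → ∀ t ∈ states D, l ≠ α t []) →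
        μ'.heap l f = μ.heap l f) ∧
      n ≤ μ'.fresh ∧ ∀ r < 20, r ≠ 8 → r ≠ 9 → μ'.reg r = μ.reg r := by
  have hDS : D ⊆ states D := fun q hq => mem_states_of_mem hq
  have hps := mem_substr_of_mem_states (hDS hp)
  have hαlt : ∀ t ∈ states D, α t [] < n := fun t ht => hL.state_lt _ _ (stateLive_nil ht)
  rw [nodePtr, if_pos hps] at h5
  simp only [removeOutput, runs_block_cons, runs_block_one, runs_load, runs_copy, h4,
    Option.some.injEq, exists_eq_left']
  refine (walkOut_spec hD hL subset_rfl hps ?_ ?_ ?_).mono ?_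
  · simpa using hA
  · simp [h5]
  · simpa using hn
  rintro t μ' ⟨ht, hrep, hw⟩
  have hc := ncard_suffix_le hD hp
  have h8 : some (α p []) = (some p).map fun u => α u [] := rfl
  have hsome : ∀ s, some p = some s → s ∈ states D := by
    rintro s hs
    cases hs
    exact hDS hp
  simp [h4, hnext p hp] at hrep
  rw [h8] at hrep
  refine ⟨by omega, fun t ht => ?_, fun t ht => ?_, fun l hl f hf => ?_, ?_, fun r hr h8 h9 => ?_⟩
  · rw [lsuf_diff]
    split_ifs with hc
    · exact (hrep _ (hαlt t ht) _).1 ⟨.inl rfl, (hL.mem_superLocs subset_rfl ht).2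
        ⟨ht, lsuf_suffix hc⟩, by rw [hout t ht, hc]⟩
    · rw [(hrep _ (hαlt t ht) _).2, hout t ht]
      rintro ⟨-, -, h⟩
      rw [hout t ht, hL.links_inj (fun s hs => hDS (lsuf_mem hs)) hsome] at h
      exact hc h
  · rw [psuf_diff]
    split_ifs with hc
    · exact (hrep _ (hαlt t (hDS ht)) _).1 ⟨.inr rfl, (hL.mem_superLocs subset_rfl (hDS ht)).2
        ⟨hDS ht, psuf_suffix hc⟩, by rw [hnext t ht, hc]⟩
    · rw [(hrep _ (hαlt t (hDS ht)) _).2, hnext t ht]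
      rintro ⟨-, -, h⟩
      rw [hnext t ht, hL.links_inj (fun s hs => hDS (psuf_mem hs)) hsome] at h
      exact hc h
  · refine (hrep l hl f).2 ?_
    rintro ⟨h, ⟨t, ht, -, rfl⟩, -⟩
    exact hf h t ht rfl
  · exact le_trans (by simpa using hn) hw.fresh
  · rw [hw.reg r hr]
    simp [h8, h9, show r ≠ 21 by omega]

/-- Removing the link at the cut leaves the search trees of the remaining records. -/
theorem Trie.cut {K : ℕ} (hK : ∀ c, (enc c).length = K)
    (hp : p ∈ D) {h h' : Heap} {β : List A × List Bool → ℕ} (hT : Trie enc (liveSet enc D) h β n)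
    {x x' : List A × List Bool} {f : Slot} (H : IsCut enc D p x f x')
    (hh : ∀ l g, g.isTree →
      h' l g = if l = β x ∧ h (β x) g = some (β x') then none else h l g) :
    Trie enc (liveSet enc (D \ {p})) h' β n := by
  have hsub : liveSet enc (D \ {p}) ⊆ liveSet enc D := fun x hx =>
    (mem_liveSet_iff_diff hp).2 (.inl hx)
  have hx' : x' ∈ liveSet enc D := (mem_liveSet_iff_diff hp).2 (.inr H.path)
  refine ⟨fun z hz => hT.lt z (hsub hz), fun z hz y hy => hT.inj z (hsub hz) y (hsub hy),
    fun _ _ _ => liveSet_closed, fun z g y hst hy => ?_, fun z hz g hg hno => ?_⟩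
  · rw [hh _ _ hst.isTree, if_neg, hT.link z g y hst (hsub hy)]
    rintro ⟨h1, h2⟩
    rw [← h1, hT.link z g y hst (hsub hy), Option.some.injEq] at h2
    exact H.notMem (hT.inj y (hsub hy) x' hx' h2 ▸ hy)
  · rw [hh _ _ hg]
    by_cases hy : ∃ y, Step enc z g y ∧ y ∈ liveSet enc D
    · obtain ⟨y, hst, hy⟩ := hy
      obtain ⟨rfl, rfl⟩ := cut_unique hK hp H.mem H.notMem H.step H.path hz (hno y hst) hst hy
      rw [if_pos ⟨rfl, hT.link _ _ _ H.step hx'⟩]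
    · rw [hT.null z (hsub hz) g hg fun y hst hy' => hy ⟨y, hst, hy'⟩]
      simp

/-- Sets the field `f` of the record in register 6 to null if it contains the pointer in
register 7. -/
def clearLink (f : Slot) : Cmd :=
  .block [.load 14 6 f, .cond (.same 14 7) (.store 6 f 16) .skip]

theorem clearLink_spec {f : Slot} {a k : ℕ} {b : Option ℕ} {Q : ℕ → Mem → Prop}
    (h6 : μ.reg 6 = some a) (h7 : μ.reg 7 = b) (h16 : μ.reg 16 = none)
    (hQ : ∀ k' μ', k' ≤ k + 3 → (∀ r ≠ 14, μ'.reg r = μ.reg r) → μ'.fresh = μ.fresh →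
      (∀ l g, μ'.heap l g = if l = a ∧ g = f ∧ μ.heap a f = b then none else μ.heap l g) →
      Q k' μ') : Runs (clearLink f) μ k Q := by
  by_cases h : μ.heap a f = b
  · simp [clearLink, h6, h7, h]
    refine hQ _ _ (by omega) (fun r hr => by simp [hr]) rfl fun l g => ?_
    simp [h, h16]
  · simp [clearLink, h6, h7, h]
    exact hQ _ _ (by omega) (fun r hr => by simp [hr]) rfl fun l g => by simp [h]

/-- Removes the link from the record in register 6 to the record in register 7, unless register 17 is
null. -/
def clearLinks : Cmd := .cond (.nonNull 17)
  (.block [.setNull 16, clearLink .zero, clearLink .one, clearLink .dest]) .skip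

theorem clearLinks_spec {K : ℕ} (hK : ∀ c, (enc c).length = K)
    (hp : p ∈ D) (hT : Trie enc (liveSet enc D) μ.heap (fun x => α x.1 x.2) n)
    (hcut : (p ∈ states (D \ {p}) ∧ μ.reg 17 = none) ∨ μ.reg 17 ≠ none ∧ ∃ x f x',
      IsCut enc D p x f x' ∧ μ.reg 6 = some (α x.1 x.2) ∧ μ.reg 7 = some (α x'.1 x'.2)) {k : ℕ} :
    Runs clearLinks μ k fun t μ' => t ≤ k + 11 ∧
      Trie enc (liveSet enc (D \ {p})) μ'.heap (fun x => α x.1 x.2) n ∧ μ'.fresh = μ.fresh ∧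
      ∀ l f, (f.isTree → ∀ x ∈ liveSet enc D, l ≠ α x.1 x.2) → μ'.heap l f = μ.heap l f := by
  rcases hcut with ⟨hps, h17⟩ | ⟨h17, x, f, x', H, h6, h7⟩
  · refine runs_cond.2 ⟨fun h => absurd h17 h, fun _ => runs_skip.2 ⟨by omega, ?_, rfl,
      fun _ _ _ => rfl⟩⟩
    have hst : ∀ s, s ∈ states D ↔ s ∈ states (D \ {p}) := fun s =>
      (mem_states_iff_diff hp).trans ⟨fun h => h.elim id fun h => mem_states_of_prefix h hps, .inl⟩
    have : liveSet enc (D \ {p}) = liveSet enc D := by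
      ext ⟨s, b⟩
      simp only [mem_liveSet, hst]
    rw [this]
    exact hT
  · refine runs_cond.2 ⟨fun _ => ?_, fun h => absurd h17 h⟩
    simp only [runs_block_cons, runs_block_one, runs_setNull]
    refine clearLink_spec (a := α x.1 x.2) (b := some (α x'.1 x'.2)) (by simp [h6]) (by simp [h7])
      (by simp) fun k₁ μ₁ hk₁ hr₁ hf₁ hh₁ => ?_
    refine clearLink_spec (a := α x.1 x.2) (b := some (α x'.1 x'.2)) (by simp [hr₁, h6])
      (by simp [hr₁, h7]) (by simp [hr₁]) fun k₂ μ₂ hk₂ hr₂ hf₂ hh₂ => ?_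
    refine clearLink_spec (a := α x.1 x.2) (b := some (α x'.1 x'.2)) (by simp [hr₂, hr₁, h6])
      (by simp [hr₂, hr₁, h7]) (by simp [hr₂, hr₁]) fun k₃ μ₃ hk₃ hr₃ hf₃ hh₃ => ?_
    have hall : ∀ l g, (g.isTree → μ₃.heap l g = if l = α x.1 x.2 ∧
          μ.heap (α x.1 x.2) g = some (α x'.1 x'.2) then none else μ.heap l g) ∧
        (l ≠ α x.1 x.2 ∨ ¬ g.isTree → μ₃.heap l g = μ.heap l g) := by
      intro l g
      simp only [Mem.setReg_heap] at hh₁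
      by_cases hl : l = α x.1 x.2
      · subst hl
        rw [hh₃, hh₂, hh₂, hh₁, hh₁, hh₁]
        cases g <;> simp [Slot.isTree]
      · simp [hh₃, hh₂, hh₁, hl]
    refine ⟨by omega, hT.cut hK hp H fun l g hg => (hall l g).1 hg, by rw [hf₃, hf₂, hf₁]; rfl,
      fun l g hlg => (hall l g).2 ?_⟩
    by_cases hg : g.isTree
    · exact .inl (hlg hg x ((mem_liveSet_iff_diff hp).2 (.inl H.mem)))
    · exact .inr hg

end Removal

/-! ### The deletion -/

section Deletion

variable {A : Type*} {enc : A → List Bool} {D : Set (List A)} {p : List A}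
    {α : List A → List Bool → ℕ} {ν : Set (List A) → List Bool → ℕ} {μ : Mem}

/-- The program for the deletion of a pattern. -/
def deleteProg : Cmd := .block [track, bypassAll, removeOutput, clearLinks]

theorem deleteProg_spec {K : ℕ} (hE : Function.Injective enc) (hK : ∀ c, (enc c).length = K)
    (hD : D.Finite) (hp : p ∈ D) (H : Before enc D p μ α ν) :
    Runs deleteProg μ 0 fun t μ' => After enc D (D \ {p}) μ' α ν ∧
      t ≤ p.length * (26 * K + 139) + 76 * failChanges D (D \ {p}) +
        88 * outChanges D (D \ {p}) + 127 := by
  have hDS : D ⊆ states D := fun q hq => mem_states_of_mem hq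
  have hlive : ∀ s b, stateLive enc (D \ {p}) s b → stateLive enc D s b := fun s b h =>
    (mem_liveSet_iff_diff (x := (s, b)) hp).2 (.inl h)
  have hstates : ∀ s ∈ states (D \ {p}), s ∈ states D := fun s hs =>
    (mem_states_iff_diff hp).2 (.inl hs)
  obtain ⟨ch, hL⟩ := H.dawg.exists_layout H.ac.allocated H.ac.inj H.ac.goto H.separated
    (H.pattern.mono fun l hl => hl.1)
  have hR : Anchored α ν D (μ.reg 2) μ := ⟨H.root, H.source, rfl⟩
  have hfl := flinks_iff.1 ⟨H.ac.flink, H.ac.flink_root⟩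
  obtain ⟨ho, hno⟩ := outputs_iff.1 H.ac.output
  have hT : Trie enc (liveSet enc D) μ.heap (fun x => α x.1 x.2) μ.fresh :=
    (trie_iff hE).2 ⟨H.ac.allocated, H.ac.inj, H.ac.goto⟩
  have hαlt : ∀ s ∈ states D, α s [] < μ.fresh := fun s hs => H.ac.allocated s [] (stateLive_nil hs)
  simp only [deleteProg, runs_block_cons, runs_block_one]
  refine (track_spec hE hK hp hL hR ho).mono ?_
  rintro t₁ μ₁ ⟨ht₁, hμ₁, hcut⟩
  have hfirst : FirstRemoved D p α (μ₁.reg 17) := by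
    rcases hcut with h | ⟨hps, x, f, x', hc, -, -, h17⟩
    · exact .inl h
    · rw [h17]
      exact hc.firstRemoved hK hps
  refine (bypassAll_spec (μ := μ₁) hE hK hD hp (by rw [hμ₁.heap]; exact hL)
    ⟨by rw [hμ₁.reg 0 (by simp), H.root], by rw [hμ₁.reg 1 (by simp), H.source],
      hμ₁.reg 2 (by simp)⟩ hμ₁.fresh.ge ?_ (by rw [hμ₁.heap]; exact hfl) hfirst).mono ?_
  · intro v hv
    rw [hμ₁.heap]
    exact H.dawg.aux_null v [] (nodeLive_nil hv) 0
  rintro t₂ μ₂ ⟨ht₂, -, hn₂, hfl₂, hoth₂, hr₂, h4, h5⟩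
  rw [hμ₁.heap] at hoth₂
  have hA₂ : Agree μ.fresh μ.heap μ₂.heap := by
    refine fun l hl f hf => hoth₂ l hl f ?_
    rintro rfl
    exact absurd hf id
  refine (removeOutput_spec hD hp hL hA₂ hn₂ ?_ ?_ h4 h5).mono ?_
  · exact ho.congr (fun s hs => hoth₂ _ (hαlt s hs) _ (by simp)) fun _ _ _ _ => rfl
  · exact hno.congr (fun s hs => hoth₂ _ (hαlt s (hDS hs)) _ (by simp)) fun _ _ _ _ => rfl
  rintro t₃ μ₃ ⟨ht₃, ho₃, hno₃, hoth₃, hn₃, hr₃⟩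
  have hA₃ : Agree μ.fresh μ.heap μ₃.heap := by
    refine hA₂.trans fun l hl f hf => hoth₃ l hl f ?_
    rintro (rfl | rfl) <;> exact absurd hf id
  have hregs : ∀ r ∈ [6, 7, 17], μ₃.reg r = μ₁.reg r := fun r hr => by
    rw [hr₃ r (by fin_cases hr <;> simp) (by fin_cases hr <;> simp) (by fin_cases hr <;> simp),
      hr₂ r hr]
  have hL₃ := hL.congr hA₃
  refine (clearLinks_spec hK hp
    ((trie_iff hE).2 ⟨hL₃.state_lt, hL₃.state_inj, hL₃.goto⟩) ?_).mono ?_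
  · rw [hregs 6 (by simp), hregs 7 (by simp), hregs 17 (by simp)]
    rcases hcut with h | ⟨-, x, f, x', hc, h6, h7, h17⟩
    · exact .inl h
    · exact .inr ⟨by simp [h17], x, f, x', hc, h6, h7⟩
  rintro t₄ μ₄ ⟨ht₄, hT₄, hf₄, hoth₄⟩
  obtain ⟨hlt, hinj, hgoto⟩ := (trie_iff hE).1 hT₄
  have hoth : ∀ l < μ.fresh, ∀ f, ((f = .flink ∨ f = .out ∨ f = .nextOut) →
      ∀ t ∈ states D, l ≠ α t []) → (f.isTree → ∀ x ∈ liveSet enc D, l ≠ α x.1 x.2) →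
      μ₄.heap l f = μ.heap l f := by
    intro l hl f h1 h2
    rw [hoth₄ l f h2, hoth₃ l hl f fun h => h1 (.inr h), hoth₂ l hl f fun h => h1 (.inl h)]
  have hfl₄ : Links α (states (D \ {p})) .flink (psuf (states (D \ {p}))) μ₄.heap := by
    intro s hs
    rw [hoth₄ _ _ (absurd · id), hoth₃ _ (hαlt s (hstates s hs)) _ (by simp)]
    exact hfl₂ s (hstates s hs)
  refine ⟨⟨?_, α, ⟨fun s b h => (hlt s b h).trans_le (by omega), hinj, hgoto, ?_, ?_,
    outputs_iff.2 ⟨?_, ?_⟩, fun s b h i => ?_⟩, fun s b v b' hs => H.separated s b v b' (hlive s b hs),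
    fun _ _ _ => rfl⟩, ?_⟩
  · refine H.dawg.congr (by omega) (fun v b h => ?_) fun _ _ => rfl
    refine funext fun f => hoth _ (H.dawg.allocated v b h) f (fun _ t ht he => ?_)
      fun _ x hx he => ?_
    · exact H.separated t [] v b (stateLive_nil ht) h he.symm
    · exact H.separated x.1 x.2 v b hx h he.symm
  · exact (flinks_iff.2 hfl₄).1
  · exact (flinks_iff.2 hfl₄).2
  · intro s hs
    rw [hoth₄ _ _ (absurd · id)]
    exact ho₃ s (hstates s hs)
  · intro s hs
    rw [hoth₄ _ _ (absurd · id)]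
    exact hno₃ s hs.1
  · rw [hoth _ (H.ac.allocated s b (hlive s b h)) _ (by simp) (absurd · id)]
    exact H.ac.aux_null s b (hlive s b h) i
  · have : p.length * (26 * K + 139) = p.length * (14 * K + 20) + p.length * (12 * K + 43) +
      76 * p.length := by ring
    omega

end Deletion

/-! ### The number of steps -/

section Bounds

variable {A : Type*} {enc : A → List Bool} {D : Set (List A)} {p : List A}

theorem one_le_ncard_suffix (hD : D.Finite) {m : ℕ} (hm : p.length = m) :
    1 ≤ m + {t | t ∈ states D ∧ p <:+ t}.ncard := by
  cases m with
  | zero =>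
    obtain rfl := List.length_eq_zero_iff.1 hm
    rw [Nat.zero_add, Nat.one_le_iff_ne_zero, ← Nat.pos_iff_ne_zero,
      Set.ncard_pos ((states_finite hD).subset fun t ht => ht.1)]
    exact ⟨[], nil_mem_states, List.suffix_rfl⟩
  | succ m => omega

/-- The length of the code words is at most twice the logarithm, and for the empty pattern the
additive constant is absorbed by the root, whose output changes. -/
theorem steps_le {σ t m uf uo : ℕ}
    (ht : t ≤ m * (46 * Nat.clog 2 σ + 285) + 100 * uf + 88 * uo + 127) (hm : 1 ≤ m + uo) :
    (t : ℝ) ≤ 1000 * (m * max 1 (Real.logb 2 σ) + uf + uo) := by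
  obtain ⟨L, hL⟩ : ∃ L, L = max 1 (Real.logb 2 σ) := ⟨_, rfl⟩
  have h1 : 1 ≤ L := hL ▸ le_max_left _ _
  have hK : (Nat.clog 2 σ : ℝ) ≤ 2 * L := by
    have h0 : 0 ≤ Real.logb 2 σ := by
      rcases Nat.eq_zero_or_pos σ with rfl | h
      · simp
      · exact Real.logb_nonneg (by norm_num) (by exact_mod_cast h)
    have h2 : Real.logb 2 σ ≤ L := hL ▸ le_max_right _ _
    have h3 := Nat.ceil_lt_add_one h0
    have h4 := Real.natCeil_logb_natCast 2 σ
    rw [Nat.cast_ofNat] at h4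
    rw [h4] at h3
    linarith
  rw [← hL]
  have ht' : (t : ℝ) ≤ m * (46 * Nat.clog 2 σ + 285) + 100 * uf + 88 * uo + 127 := by
    exact_mod_cast ht
  have hm' : (1 : ℝ) ≤ m + uo := by exact_mod_cast hm
  have hmK : (m : ℝ) * Nat.clog 2 σ ≤ m * (2 * L) := mul_le_mul_of_nonneg_left hK (by positivity)
  have hmL : (m : ℝ) ≤ m * L := le_mul_of_one_le_right (by positivity) h1
  have huf : (0 : ℝ) ≤ uf := by positivity
  have huo : (0 : ℝ) ≤ uo := by positivity
  linarith

end Bounds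

end DynAC

theorem mainTheorem2 :
    ∃ (insertProg deleteProg : DynAC.Cmd) (C : ℝ),
      ∀ (A : Type*) [Fintype A] (D : Set (List A)) (p : List A), D.Finite →
        (p ∉ D → DynAC.UpdatesWithin insertProg C p D (insert p D)) ∧
        (p ∈ D → DynAC.UpdatesWithin deleteProg C p D (D \ {p})) := by
  refine ⟨DynAC.insertProg, DynAC.deleteProg, 1000, fun A _ D p hD =>
    ⟨fun hp enc hE hK μ α ν H => ?_, fun hp enc hE hK μ α ν H => ?_⟩⟩
  · obtain ⟨t, μ', hex, hafter, ht⟩ := DynAC.insertProg_spec hE hK hD hp H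
    refine ⟨t, μ', hex, hafter, DynAC.steps_le (by omega) ?_⟩
    rw [DynAC.outChanges_insert hp]
    exact DynAC.one_le_ncard_suffix hD rfl
  · obtain ⟨t, μ', hex, hafter, ht⟩ := DynAC.deleteProg_spec hE hK hD hp H
    have hle : p.length * (26 * Nat.clog 2 (Fintype.card A) + 139) ≤
        p.length * (46 * Nat.clog 2 (Fintype.card A) + 285) :=
      Nat.mul_le_mul_left _ (by omega)
    refine ⟨t, μ', hex, hafter, DynAC.steps_le (by omega) ?_⟩
    rw [DynAC.outChanges_diff hp]
    exact DynAC.one_le_ncard_suffix (hD.subset Set.sdiff_subset) rfl
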